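/- Let $G$ be a discrete group acting strictly on a small category $I$. For $i\in I$ let $G_i=\{g\in G: gi=i\}$, and for $H\le G$ let $I^H\subset I$ be the subcategory of objects and morphisms fixed by $H$. Write $B$ for the geometric realization of the nerve $N$. For a functor $F\colon C\to D$ and an object $d$ of $D$, $F/d$ is the category of pairs $(c,\,F(c)\to d)$; if $F=\mathrm{id}_D$ we write $D/d$. Let $\iota\colon I^G\to I$ and $\iota^H\colon I^G\to I^H$ be the inclusions. A $G$-diagram of spaces is a functor $X\colon I\to \mathrm{Top}$ to compactly generated Hausdorff spaces together with natural transformations $\phi_g\colon X\to X\circ g$ $(g\in G)$ such that $\phi_1=\mathrm{id}$ and $\phi_{hg}=(\phi_h)|_g\circ\phi_g$. If $H\le G_i$, then $H$ acts on $X_i$, and $X^H\colon I^H\to\mathrm{Top}$, $i\mapsto X_i^H$, is the diagram of fixed points. For $G$-diagrams $K,X$, the space $\mathrm{Hom}_I(K,X)$ of all natural transformations $K\to X$ (a subspace, formed in compactly generated spaces, of $\prod_i\mathrm{map}(K_i,X_i)$) carries the conjugation $G$-action, and $\mathrm{Hom}_I(K,X)^G$ is the space of morphisms of $G$-diagrams.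 Put $\mathrm{holim}_I X=\mathrm{Hom}_I(B(I/ -),X)$ and $\lim_I X=\mathrm{Hom}_I(*,X)$, with these $G$-actions. Similarly $\mathrm{holim}_{I^G}X^G$ is the space of natural transformations $B(I^G/ -)\to X^G$ of $I^G$-diagrams. Restricting morphisms of $G$-diagrams to fixed points, together with the canonical map $B(I^G/ -)\to B(I/ -)^G$, gives the restriction map $$r\colon(\mathrm{holim}_I X)^G\longrightarrow \mathrm{holim}_{I^G}X^G .$$ Suppose that for every object $i$ of $I$ the simplicial set $N(I/i)$ is finite dimensional. Then: 1. $r$ is a (Serre) fibration. 2. For every morphism of $G$-diagrams $x\colon *\to X$, composition with the quotient map $B(I/ -)\to B(I/ -)/B(\iota/ -)$ is a homeomorphism from the space $$\mathrm{Hom}_*\big(B(I/ -)/B(\iota/ -),\,X\big)^G$$ of $G$-fixed pointed natural transformations onto the fiber of $r$ over the constant natural transformation $B(I^G/ -)\to *\xrightarrow{x}X^G$. Here the quotient is taken pointwise, the collapsed subspace is the base point (a disjoint base point is added where $B(\iota/i)$ is empty), and $X$ is pointed by $x$. 3. If the composite of the canonical maps $(\lim_I X)^G\to(\mathrm{holim}_I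 X)^G\xrightarrow{r}\mathrm{holim}_{I^G}X^G$ is surjective on $\pi_0$, then $r$ is $n$-connected for every integer $$n\ \le\ \inf_{i\in \mathrm{Ob}\, I}\ \inf_{\substack{H\le G_i\\ \hom(\iota^H/i)\subsetneq\hom(I^H/i)}}\big(\mathrm{conn}\,X_i^H-\dim N(I^H/i)\big)+1 ,$$ where $\hom$ denotes the set of all morphisms of a category. Here $\mathrm{conn}\,Y\in\{-2,-1,0,\dots,\infty\}$ is the largest $n$ such that $Y$ is $n$-connected (every space is $(-2)$-connected, and $(-1)$-connected means nonempty), a map is $n$-connected if all its homotopy fibers are $(n-1)$-connected, and the infimum over the empty set is $+\infty$. -/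

import Mathlib

open CategoryTheory

universe w u

/-! ### Connectivity and fibrations of spaces -/

/-- A space is `n`-connected if every map from a sphere `S^(k-1)` with `k ≤ n + 1` extends
over the disc `D^k`. The case `k = 0`, with empty sphere, says that the space is nonempty. -/
def IsNConnected (n : ℤ) (Y : Type*) [TopologicalSpace Y] : Prop :=
  ∀ k : ℕ, (k : ℤ) ≤ n + 1 →
    ∀ f : C(Metric.sphere (0 : EuclideanSpace ℝ (Fin k)) 1, Y),
      ∃ F : C(Metric.closedBall (0 : EuclideanSpace ℝ (Fin k)) 1, Y),
        ∀ x : Metric.sphere (0 : EuclideanSpace ℝ (Fin k)) 1,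
          F ⟨x.1, Metric.sphere_subset_closedBall x.2⟩ = f x

/-- The connectivity of a space: the largest `n ≥ -2` such that the space is `n`-connected,
possibly `+∞`. -/
noncomputable def conn (Y : Type*) [TopologicalSpace Y] : EReal :=
  ⨆ n : {n : ℤ // -2 ≤ n ∧ IsNConnected n Y}, ((n.1 : ℝ) : EReal)

/-- The homotopy fiber of a map over a point `b`. -/
def HoFiber {A B : Type*} [TopologicalSpace A] [TopologicalSpace B] (f : A → B) (b : B) : Type _ :=
  {p : A × C(unitInterval, B) // p.2 0 = f p.1 ∧ p.2 1 = b}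

instance {A B : Type*} [TopologicalSpace A] [TopologicalSpace B] (f : A → B) (b : B) :
    TopologicalSpace (HoFiber f b) :=
  inferInstanceAs (TopologicalSpace {p : A × C(unitInterval, B) // p.2 0 = f p.1 ∧ p.2 1 = b})

/-- A map is `n`-connected if it is continuous and all its homotopy fibers are
`(n - 1)`-connected. -/
def IsNConnectedMap (n : ℤ) {A B : Type*} [TopologicalSpace A] [TopologicalSpace B]
    (f : A → B) : Prop :=
  Continuous f ∧ ∀ b : B, IsNConnected (n - 1) (HoFiber f b)

/-- Serre fibrations: continuous maps with the homotopy lifting property for cubes. -/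
def IsSerreFibration {E B : Type*} [TopologicalSpace E] [TopologicalSpace B] (p : E → B) : Prop :=
  Continuous p ∧
    ∀ (n : ℕ) (f : C(Fin n → unitInterval, E)) (h : C((Fin n → unitInterval) × unitInterval, B)),
      (∀ z, h (z, 0) = p (f z)) →
        ∃ l : C((Fin n → unitInterval) × unitInterval, E),
          (∀ z, l (z, 0) = f z) ∧ ∀ z, p (l z) = h z

/-- Surjectivity on path components. -/
def SurjectiveOnPiZero {A B : Type*} [TopologicalSpace B] (f : A → B) : Prop :=
  ∀ b : B, ∃ a : A, Joined (f a) b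

/-- The dimension of a simplicial set: the supremum of the dimensions of its nondegenerate
simplices. -/
noncomputable def SSet.dim (S : SSet.{u}) : EReal :=
  ⨆ n : {n : ℕ // (S.nonDegenerate n).Nonempty}, ((n.1 : ℝ) : EReal)

/-! ### Spaces of natural transformations and homotopy limits -/

section Diagrams

variable {C : Type u} [SmallCategory C] {D : Type u} [SmallCategory D]

/-- The space of natural transformations between two diagrams of spaces. -/
def HomSpace (K X : C ⥤ TopCat.{u}) : Type u := K ⟶ X

/-- The topology of `HomSpace` as a subspace of the product of the mapping spaces
`C(K i, X i)` with the compact-open topologies. -/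
@[reducible] def HomSpace.compactOpen (K X : C ⥤ TopCat.{u}) : TopologicalSpace (HomSpace K X) :=
  TopologicalSpace.induced
    (fun (f : K ⟶ X) (i : C) => ((f.app i).hom : C(K.obj i, X.obj i))) inferInstance

/-- Limits and mapping spaces are formed in compactly generated spaces, so the compact-open
topology is replaced by the associated compactly generated topology. -/
noncomputable instance (K X : C ⥤ TopCat.{u}) : TopologicalSpace (HomSpace K X) :=
  @CompactCoherentification.instTopologicalSpace (HomSpace K X) (HomSpace.compactOpen K X)

/-- Two functors into a comma category `F/i` agree if they agree on sources of objects, on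
structure maps and on morphisms. -/
theorem costructuredArrow_functor_ext {A : Type*} [Category A] (F : C ⥤ D) {i : D}
    {P Q : A ⥤ CostructuredArrow F i}
    (h : P ⋙ CostructuredArrow.proj F i = Q ⋙ CostructuredArrow.proj F i)
    (hh : ∀ (x : A) (e : F.obj (P.obj x).left = F.obj (Q.obj x).left),
      eqToHom e ≫ (Q.obj x).hom = (P.obj x).hom) :
    P = Q := by
  have hx : ∀ x, (P.obj x).left = (Q.obj x).left := fun x => Functor.congr_obj h x
  refine CategoryTheory.Functor.ext (fun x => CostructuredArrow.obj_ext _ _ (hx x) ?_) ?_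
  · rw [eqToHom_map]
    exact hh x _
  intro x y f
  apply CostructuredArrow.hom_ext
  refine (Functor.congr_hom h f).trans (Eq.symm ?_)
  rw [Comma.comp_left, Comma.comp_left, CostructuredArrow.eqToHom_left,
    CostructuredArrow.eqToHom_left]
  rfl

theorem nerveMap_id' (A : Type u) [Category.{w} A] : nerveMap (𝟭 A) = 𝟙 (nerve A) := rfl

theorem nerveMap_comp' {A A' A'' : Type u} [Category.{w} A] [Category.{w} A'] [Category.{w} A'']
    (P : A ⥤ A') (Q : A' ⥤ A'') : nerveMap (P ⋙ Q) = nerveMap P ≫ nerveMap Q := rfl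

/-- The map of classifying spaces induced by a functor. -/
noncomputable def BMap {A A' : Type u} [SmallCategory A] [SmallCategory A'] (P : A ⥤ A') :
    SSet.toTop.obj (nerve A) ⟶ SSet.toTop.obj (nerve A') :=
  SSet.toTop.map (nerveMap P)

theorem BMap_id (A : Type u) [SmallCategory A] : BMap (𝟭 A) = 𝟙 _ := by
  rw [BMap, nerveMap_id', CategoryTheory.Functor.map_id]

theorem BMap_comp {A A' A'' : Type u} [SmallCategory A] [SmallCategory A'] [SmallCategory A'']
    (P : A ⥤ A') (Q : A' ⥤ A'') : BMap (P ⋙ Q) = BMap P ≫ BMap Q := by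
  rw [BMap, nerveMap_comp', CategoryTheory.Functor.map_comp]; rfl

/-- The diagram of classifying spaces `i ↦ B(F/i)` of the over categories `F/i`. -/
noncomputable def overB (F : C ⥤ D) : D ⥤ TopCat.{u} where
  obj i := SSet.toTop.obj (nerve (CostructuredArrow F i))
  map α := BMap (CostructuredArrow.map α)
  map_id i := by
    rw [← BMap_id]
    congr 1
    exact costructuredArrow_functor_ext F rfl (fun x _ => by
      change 𝟙 _ ≫ x.hom = x.hom ≫ 𝟙 _
      simp)
  map_comp α β := by
    rw [← BMap_comp]
    congr 1
    exact costructuredArrow_functor_ext F rfl (fun x _ => by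
      change 𝟙 _ ≫ (x.hom ≫ α) ≫ β = x.hom ≫ α ≫ β
      simp)

/-- The homotopy limit of a diagram of spaces, by the Bousfield-Kan formula. -/
abbrev Holim (X : C ⥤ TopCat.{u}) : Type u := HomSpace (overB (𝟭 C)) X

end Diagrams

/-! ### Categories with action and equivariant diagrams -/

/-- A (strict) action of a group `G` on a category `I`. -/
structure CatAction (G : Type w) [Group G] (I : Type u) [SmallCategory I] where
  act : G → I ⥤ I
  act_one : act 1 = 𝟭 I
  act_mul : ∀ h g, act (h * g) = act g ⋙ act h

namespace CatAction

variable {G : Type w} [Group G] {I : Type u} [SmallCategory I] (a : CatAction G I)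

theorem one_obj (i : I) : (a.act 1).obj i = i := by rw [a.act_one]; rfl

theorem mul_obj (h g : G) (i : I) : (a.act (h * g)).obj i = (a.act h).obj ((a.act g).obj i) := by
  rw [a.act_mul]; rfl

theorem one_map {i j : I} (α : i ⟶ j) :
    (a.act 1).map α = eqToHom (a.one_obj i) ≫ α ≫ eqToHom (a.one_obj j).symm := by
  simpa using Functor.congr_hom a.act_one α

theorem mul_map (h g : G) {i j : I} (α : i ⟶ j) :
    (a.act (h * g)).map α = eqToHom (a.mul_obj h g i) ≫ (a.act h).map ((a.act g).map α) ≫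
      eqToHom (a.mul_obj h g j).symm := by
  simpa using Functor.congr_hom (a.act_mul h g) α

theorem mul_map_aux (h g : G) {P S R Y i : I} (α : Y ⟶ i) (e : P = S)
    (p : S = (a.act h).obj R) (q : R = (a.act g).obj Y) (t : P = (a.act (h * g)).obj Y) :
    eqToHom e ≫ (eqToHom p ≫ (a.act h).map (eqToHom q ≫ (a.act g).map α ≫ 𝟙 _) ≫ 𝟙 _) ≫
      eqToHom (a.mul_obj h g i).symm = eqToHom t ≫ (a.act (h * g)).map α ≫ 𝟙 _ := by
  subst q p e
  simp [a.mul_map]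

theorem act_inv_obj (g : G) (i : I) : (a.act g).obj ((a.act g⁻¹).obj i) = i := by
  rw [← a.mul_obj, mul_inv_cancel, a.one_obj]

/-- The stabilizer group `G_i` of an object. -/
def stabilizer (i : I) : Subgroup G where
  carrier := {g | (a.act g).obj i = i}
  one_mem' := a.one_obj i
  mul_mem' {g h} hg hh := by
    change (a.act (g * h)).obj i = i
    rw [a.mul_obj, show (a.act h).obj i = i from hh]
    exact hg
  inv_mem' {g} hg := by
    change (a.act g⁻¹).obj i = i
    conv_lhs => rw [← show (a.act g).obj i = i from hg]
    rw [← a.mul_obj, inv_mul_cancel, a.one_obj]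

theorem stab_eq {a : CatAction G I} {H : Subgroup G} {i : I} (hH : H ≤ a.stabilizer i) {h : G} (hh : h ∈ H) :
    (a.act h).obj i = i := hH hh

/-- The trivial action on a category. -/
def trivial (G : Type w) [Group G] (I : Type u) [SmallCategory I] : CatAction G I where
  act _ := 𝟭 I
  act_one := rfl
  act_mul _ _ := rfl

end CatAction

/-- The objects of the subcategory `I^H` of `I`: the objects fixed by `H`. -/
structure FixedCat {G : Type w} [Group G] {I : Type u} [SmallCategory I] (a : CatAction G I)
    (H : Subgroup G) : Type u where
  obj : I
  le : H ≤ a.stabilizer obj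

/-- A `G`-diagram of spaces on a category with `G`-action: a diagram with natural transformations
`φ g : X ⟶ X ∘ g` such that `φ 1 = 1` and `φ (h * g) = φ h ∘ φ g`. -/
structure GDiagram {G : Type w} [Group G] {I : Type u} [SmallCategory I] (a : CatAction G I) where
  toFunctor : I ⥤ TopCat.{u}
  φ : ∀ g : G, toFunctor ⟶ a.act g ⋙ toFunctor
  φ_one : ∀ i, (φ 1).app i = toFunctor.map (eqToHom (a.one_obj i).symm)
  φ_mul : ∀ h g i, (φ (h * g)).app i =
    (φ g).app i ≫ (φ h).app ((a.act g).obj i) ≫ toFunctor.map (eqToHom (a.mul_obj h g i).symm)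

section Equivariant

variable {G : Type w} [Group G] {I : Type u} [SmallCategory I] {a : CatAction G I}

namespace FixedCat

variable {H : Subgroup G}

/-- The morphisms of `I^H` are the morphisms of `I` fixed by `H`. -/
instance : SmallCategory (FixedCat a H) where
  Hom i j := {α : i.obj ⟶ j.obj // ∀ h (hh : h ∈ H),
    (a.act h).map α = eqToHom (CatAction.stab_eq i.le hh) ≫ α ≫ eqToHom (CatAction.stab_eq j.le hh).symm}
  id i := ⟨𝟙 _, fun h hh => by simp⟩
  comp α β := ⟨α.1 ≫ β.1, fun h hh => by simp [α.2 h hh, β.2 h hh]⟩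

/-- The inclusion `I^L → I^H` for `H ≤ L`. -/
def inclusion (a : CatAction G I) {H L : Subgroup G} (hHL : H ≤ L) :
    FixedCat a L ⥤ FixedCat a H where
  obj i := ⟨i.obj, hHL.trans i.le⟩
  map α := ⟨α.1, fun h hh => α.2 h (hHL hh)⟩

/-- The inclusion `I^H → I`. -/
def ι (a : CatAction G I) (H : Subgroup G) : FixedCat a H ⥤ I where
  obj i := i.obj
  map α := α.1

end FixedCat

namespace GDiagram

variable (X Y : GDiagram a)

/-- The structure map `φ g : X i → X (g i)`, where `g i` is identified with an equal object. -/
def tr (g : G) {i j : I} (e : (a.act g).obj i = j) : X.toFunctor.obj i ⟶ X.toFunctor.obj j :=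
  (X.φ g).app i ≫ X.toFunctor.map (eqToHom e)

theorem tr_one {g : G} (hg : g = 1) {i j : I} (e : (a.act g).obj i = j) :
    X.tr g e = X.toFunctor.map (eqToHom (by subst hg; rw [← e, a.one_obj])) := by
  subst hg
  rw [tr, X.φ_one, ← Functor.map_comp, eqToHom_trans]

theorem tr_congr {g g' : G} (h : g = g') {i j : I} (e : (a.act g).obj i = j)
    (e' : (a.act g').obj i = j) : X.tr g e = X.tr g' e' := by
  subst h; rfl

theorem tr_tr (g h : G) {i j k : I} (e : (a.act g).obj i = j) (e' : (a.act h).obj j = k) :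
    X.tr g e ≫ X.tr h e' = X.tr (h * g) (by rw [a.mul_obj, e, e']) := by
  subst e e'
  simp [tr, X.φ_mul]

theorem map_tr (g : G) {i i' j j' : I} (α : i ⟶ i') (e : (a.act g).obj i = j)
    (e' : (a.act g).obj i' = j') :
    X.toFunctor.map α ≫ X.tr g e' = X.tr g e ≫
      X.toFunctor.map (eqToHom e.symm ≫ (a.act g).map α ≫ eqToHom e') := by
  subst e e'
  simp [tr]

/-- The space of fixed points `(X i)^H` of a vertex, for a subgroup `H ≤ G_i`. -/
def FixedSpace {H : Subgroup G} {i : I} (hH : H ≤ a.stabilizer i) : Type u :=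
  {x : X.toFunctor.obj i // ∀ h (hh : h ∈ H), X.tr h (CatAction.stab_eq hH hh) x = x}

instance {H : Subgroup G} {i : I} (hH : H ≤ a.stabilizer i) : TopologicalSpace (X.FixedSpace hH) :=
  inferInstanceAs (TopologicalSpace
    {x : X.toFunctor.obj i // ∀ h (hh : h ∈ H), X.tr h (CatAction.stab_eq hH hh) x = x})

theorem map_mem_fixed {H : Subgroup G} {i j : FixedCat a H} (α : i ⟶ j)
    {x : X.toFunctor.obj i.obj} (hx : ∀ h (hh : h ∈ H), X.tr h (CatAction.stab_eq i.le hh) x = x) (h : G)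
    (hh : h ∈ H) : X.tr h (CatAction.stab_eq j.le hh) (X.toFunctor.map α.1 x) = X.toFunctor.map α.1 x := by
  have := ConcreteCategory.congr_hom (X.map_tr h α.1 (CatAction.stab_eq i.le hh) (CatAction.stab_eq j.le hh)) x
  simpa [α.2 h hh, hx h hh] using this

/-- The `H`-fixed points diagram `X^H : I^H ⥤ Top`. -/
def fixedDiagram (H : Subgroup G) : FixedCat a H ⥤ TopCat.{u} where
  obj i := TopCat.of (X.FixedSpace i.le)
  map {i j} α := TopCat.ofHom
    ⟨fun x => ⟨X.toFunctor.map α.1 x.1, X.map_mem_fixed α x.2⟩,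
      ((X.toFunctor.map α.1).hom.continuous.comp continuous_subtype_val).subtype_mk _⟩
  map_id i := by
    ext x
    apply Subtype.ext
    exact ConcreteCategory.congr_hom (X.toFunctor.map_id i.obj) x.1
  map_comp α β := by
    ext x
    apply Subtype.ext
    exact ConcreteCategory.congr_hom (X.toFunctor.map_comp α.1 β.1) x.1

end GDiagram

/-! ### The `G`-space of natural transformations -/

/-- The space of natural transformations of the underlying diagrams of two `G`-diagrams. -/
def GHom (K X : GDiagram a) : Type u := HomSpace K.toFunctor X.toFunctor

noncomputable instance (K X : GDiagram a) : TopologicalSpace (GHom K X) :=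
  inferInstanceAs (TopologicalSpace (HomSpace K.toFunctor X.toFunctor))

namespace GHom

variable {K L X : GDiagram a}

/-- The component at `i` of a natural transformation. -/
def app (f : GHom K X) (i : I) : K.toFunctor.obj i ⟶ X.toFunctor.obj i := NatTrans.app f i

theorem ext {f f' : GHom K X} (h : ∀ i, f.app i = f'.app i) : f = f' :=
  NatTrans.ext (funext h)

theorem naturality (f : GHom K X) {i j : I} (α : i ⟶ j) :
    K.toFunctor.map α ≫ f.app j = f.app i ≫ X.toFunctor.map α :=
  NatTrans.naturality f α

theorem conj_indep (f : GHom K X) {g g' : G} {i k k' : I} (e : (a.act g').obj i = k)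
    (e' : (a.act g').obj i = k') (d : (a.act g).obj k = i) (d' : (a.act g).obj k' = i) :
    K.tr g' e ≫ f.app k ≫ X.tr g d = K.tr g' e' ≫ f.app k' ≫ X.tr g d' := by
  obtain rfl : k = k' := e.symm.trans e'
  rfl

/-- The conjugate natural transformation
`K ⟶ K ∘ g⁻¹ ⟶ X ∘ g⁻¹ ⟶ X`. -/
def conj (g : G) (f : GHom K X) : GHom K X where
  app i := K.tr g⁻¹ rfl ≫ f.app ((a.act g⁻¹).obj i) ≫ X.tr g (a.act_inv_obj g i)
  naturality i j α := by
    have h1 := K.map_tr g⁻¹ α rfl rfl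
    have h3 := X.map_tr g ((a.act g⁻¹).map α) (a.act_inv_obj g i) (a.act_inv_obj g j)
    have h4 : eqToHom (a.act_inv_obj g i).symm ≫ (a.act g).map ((a.act g⁻¹).map α) ≫
        eqToHom (a.act_inv_obj g j) = α := by
      have h5 := a.mul_map g g⁻¹ α
      have h6 := Functor.congr_hom (show a.act (g * g⁻¹) = 𝟭 I by rw [mul_inv_cancel, a.act_one]) α
      rw [h5] at h6
      have h7 := congrArg (fun t => eqToHom (a.mul_obj g g⁻¹ i).symm ≫ t ≫
        eqToHom (a.mul_obj g g⁻¹ j)) h6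
      simp at h7
      simp [h7]
    rw [h4] at h3
    have h2 := f.naturality ((a.act g⁻¹).map α)
    simp only [eqToHom_refl, Category.id_comp, Category.comp_id] at h1
    rw [reassoc_of% h1, reassoc_of% h2, h3]
    simp

/-- The conjugation action of `G` on the space of natural transformations. -/
instance : MulAction G (GHom K X) where
  smul := conj
  one_smul f := by
    apply ext
    intro i
    change K.tr 1⁻¹ rfl ≫ f.app ((a.act 1⁻¹).obj i) ≫ X.tr 1 (a.act_inv_obj 1 i) = f.app i
    have e : (a.act 1⁻¹).obj i = i := by rw [inv_one, a.one_obj]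
    rw [f.conj_indep rfl e (a.act_inv_obj 1 i) (a.one_obj i), K.tr_one inv_one,
      X.tr_one rfl]
    simp
  mul_smul g h f := by
    apply ext
    intro i
    change K.tr (g * h)⁻¹ rfl ≫ f.app ((a.act (g * h)⁻¹).obj i) ≫
        X.tr (g * h) (a.act_inv_obj (g * h) i) =
      K.tr g⁻¹ rfl ≫ (K.tr h⁻¹ rfl ≫ f.app ((a.act h⁻¹).obj ((a.act g⁻¹).obj i)) ≫
        X.tr h (a.act_inv_obj h _)) ≫ X.tr g (a.act_inv_obj g i)
    have e : (a.act (g * h)⁻¹).obj i = (a.act h⁻¹).obj ((a.act g⁻¹).obj i) := by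
      rw [mul_inv_rev, a.mul_obj]
    have d : (a.act (g * h)).obj ((a.act h⁻¹).obj ((a.act g⁻¹).obj i)) = i := by
      rw [← e, a.act_inv_obj]
    rw [f.conj_indep rfl e (a.act_inv_obj (g * h) i) d]
    simp only [Category.assoc]
    rw [X.tr_tr, reassoc_of% (K.tr_tr g⁻¹ h⁻¹ rfl rfl)]
    congr 1
    exact K.tr_congr (mul_inv_rev g h) _ _

theorem smul_app (g : G) (f : GHom K X) (i : I) : (g • f).app i =
    K.tr g⁻¹ rfl ≫ f.app ((a.act g⁻¹).obj i) ≫ X.tr g (a.act_inv_obj g i) := rfl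

/-- Composition of natural transformations. -/
def comp (f : GHom K L) (f' : GHom L X) : GHom K X :=
  CategoryStruct.comp (obj := I ⥤ TopCat.{u}) f f'

theorem comp_app (f : GHom K L) (f' : GHom L X) (i : I) :
    (f.comp f').app i = f.app i ≫ f'.app i := rfl

theorem comp_smul (g : G) (f : GHom K L) (f' : GHom L X) :
    g • f.comp f' = (g • f).comp (g • f') := by
  apply ext
  intro i
  rw [comp_app, smul_app, smul_app, smul_app, comp_app]
  simp only [Category.assoc]
  rw [reassoc_of% (L.tr_tr g g⁻¹ (a.act_inv_obj g i) rfl), L.tr_one (inv_mul_cancel g)]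
  simp

end GHom

/-- The fixed points space `Hom_I(K, X)^G`. -/
abbrev FixedHom (K X : GDiagram a) : Type u := MulAction.fixedPoints G (GHom K X)

/-- A natural transformation is fixed by the conjugation action exactly when it is a morphism of
`G`-diagrams. -/
theorem mem_fixedHom_iff {K X : GDiagram a} (f : GHom K X) :
    f ∈ MulAction.fixedPoints G (GHom K X) ↔
      ∀ (g : G) (i j : I) (e : (a.act g).obj i = j), K.tr g e ≫ f.app j = f.app i ≫ X.tr g e := by
  constructor
  · intro hf g i j e
    have e' : (a.act g⁻¹).obj j = i := by
      rw [← e, ← a.mul_obj, inv_mul_cancel, a.one_obj]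
    have h1 : f.app j = K.tr g⁻¹ e' ≫ f.app i ≫ X.tr g e := by
      rw [← f.conj_indep rfl e' (a.act_inv_obj g j) e, ← GHom.smul_app, hf g]
    rw [h1, reassoc_of% (K.tr_tr g g⁻¹ e e'), K.tr_one (inv_mul_cancel g)]
    simp
  · intro hf g
    apply GHom.ext
    intro i
    rw [GHom.smul_app, ← hf g, reassoc_of% (K.tr_tr g⁻¹ g rfl (a.act_inv_obj g i)),
      K.tr_one (mul_inv_cancel g)]
    simp

namespace FixedHom

variable {K L X : GDiagram a}

theorem equivariant (f : FixedHom K X) (g : G) {i j : I} (e : (a.act g).obj i = j)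
    (x : K.toFunctor.obj i) : f.1.app j (K.tr g e x) = X.tr g e (f.1.app i x) :=
  ConcreteCategory.congr_hom ((mem_fixedHom_iff f.1).1 f.2 g i j e) x

/-- Composition of morphisms of `G`-diagrams. -/
def comp (f : FixedHom K L) (f' : FixedHom L X) : FixedHom K X :=
  ⟨f.1.comp f'.1, fun g => by rw [GHom.comp_smul, f.2 g, f'.2 g]⟩

/-- The restriction of a morphism of `G`-diagrams to the `H`-fixed points diagrams. -/
def res (H : Subgroup G) (f : FixedHom K X) :
    HomSpace (K.fixedDiagram H) (X.fixedDiagram H) where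
  app i := TopCat.ofHom
    ⟨fun x => ⟨f.1.app i.obj x.1, fun h hh => by rw [← f.equivariant, x.2 h hh]⟩,
      ((f.1.app i.obj).hom.continuous.comp continuous_subtype_val).subtype_mk _⟩
  naturality i j α := by
    ext x
    apply Subtype.ext
    exact ConcreteCategory.congr_hom (f.1.naturality α.1) x.1

end FixedHom

/-! ### The one-point diagram and pointed natural transformations -/

/-- The constant diagram at a point. -/
def pt (a : CatAction G I) : GDiagram a where
  toFunctor := (Functor.const I).obj (TopCat.of PUnit.{u + 1})
  φ _ := 𝟙 _
  φ_one _ := rfl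
  φ_mul _ _ _ := rfl

/-- The `G`-space of pointed natural transformations between `G`-diagrams with base points
`k : * ⟶ K` and `x : * ⟶ X`. -/
def pointedHom {K X : GDiagram a} (k : FixedHom (pt a) K) (x : FixedHom (pt a) X) :
    SubMulAction G (GHom K X) where
  carrier := {f | k.1.comp f = x.1}
  smul_mem' g f hf := by
    change k.1.comp (g • f) = x.1
    rw [← show g • k.1 = k.1 from k.2 g, ← GHom.comp_smul, show k.1.comp f = x.1 from hf]
    exact x.2 g

/-- The fixed points space `Hom_*(K, X)^G` of the space of pointed natural transformations. -/
abbrev FixedPointedHom {K X : GDiagram a} (k : FixedHom (pt a) K) (x : FixedHom (pt a) X) :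
    Type u := MulAction.fixedPoints G (pointedHom k x)

/-- The morphism to the one-point diagram. -/
def toPt (K : GDiagram a) : FixedHom K (pt a) :=
  ⟨({ app := fun _ => TopCat.ofHom ⟨fun _ => PUnit.unit, continuous_const⟩
      naturality := fun _ _ _ => rfl } : K.toFunctor ⟶ (pt a).toFunctor),
    fun _ => rfl⟩

/-! ### Quotients of diagrams -/

/-- The relation on `L i ⊔ *` that identifies the image of `K i` with the extra point. -/
inductive QuotRel {A B : Type u} (j : A → B) : B ⊕ PUnit.{u + 1} → B ⊕ PUnit.{u + 1} → Prop
  | glue (x : A) : QuotRel j (Sum.inl (j x)) (Sum.inr PUnit.unit)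

/-- The map induced on quotients. -/
def quotMap {A B A' B' : TopCat.{u}} {j : A ⟶ B} {j' : A' ⟶ B'} (q : B ⟶ B')
    (w : ∀ x, ∃ y, q (j x) = j' y) :
    TopCat.of (Quot (QuotRel j)) ⟶ TopCat.of (Quot (QuotRel j')) :=
  TopCat.ofHom ⟨Quot.map (Sum.map q id) (by
      rintro _ _ ⟨x⟩
      obtain ⟨y, hy⟩ := w x
      simpa [hy] using QuotRel.glue (j := j') y),
    isQuotientMap_quot_mk.continuous_iff.2
      (continuous_quot_mk.comp (q.hom.continuous.sumMap continuous_id))⟩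

/-- The pointwise quotient `L/K` of a morphism `j : K ⟶ L` of `G`-diagrams: the image of `K i` in
`L i` is collapsed to a base point, which is a disjoint point if `K i` is empty. -/
def quotientDiagram {K L : GDiagram a} (j : FixedHom K L) : GDiagram a where
  toFunctor :=
    { obj := fun i => TopCat.of (Quot (QuotRel (j.1.app i)))
      map := fun {i i'} α => quotMap (L.toFunctor.map α) (fun x => ⟨K.toFunctor.map α x,
        (ConcreteCategory.congr_hom (j.1.naturality α) x).symm⟩)
      map_id := fun i => by
        ext ⟨x | x⟩
        · exact congrArg (fun y => Quot.mk _ (Sum.inl y))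
            (ConcreteCategory.congr_hom (L.toFunctor.map_id i) x)
        · rfl
      map_comp := fun α β => by
        ext ⟨x | x⟩
        · exact congrArg (fun y => Quot.mk _ (Sum.inl y))
            (ConcreteCategory.congr_hom (L.toFunctor.map_comp α β) x)
        · rfl }
  φ g :=
    { app := fun i => quotMap ((L.φ g).app i) (fun x => ⟨(K.φ g).app i x, by
        have := j.equivariant g (i := i) rfl x
        simp only [GDiagram.tr, eqToHom_refl, CategoryTheory.Functor.map_id] at this
        exact this.symm⟩)
      naturality := fun i i' α => by
        ext ⟨x | x⟩
        · exact congrArg (fun y => Quot.mk _ (Sum.inl y))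
            (ConcreteCategory.congr_hom ((L.φ g).naturality α) x)
        · rfl }
  φ_one i := by
    ext ⟨x | x⟩
    · exact congrArg (fun y => Quot.mk _ (Sum.inl y)) (ConcreteCategory.congr_hom (L.φ_one i) x)
    · rfl
  φ_mul h g i := by
    ext ⟨x | x⟩
    · exact congrArg (fun y => Quot.mk _ (Sum.inl y))
        (ConcreteCategory.congr_hom (L.φ_mul h g i) x)
    · rfl

/-- The quotient map `L ⟶ L/K`. -/
def quotientProj {K L : GDiagram a} (j : FixedHom K L) : FixedHom L (quotientDiagram j) :=
  ⟨({ app := fun _ => TopCat.ofHom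
        ⟨fun x => Quot.mk _ (Sum.inl x), continuous_quot_mk.comp continuous_inl⟩
      naturality := fun _ _ _ => rfl } : L.toFunctor ⟶ (quotientDiagram j).toFunctor),
    (mem_fixedHom_iff _).2 (fun _ _ _ _ => rfl)⟩

/-- The base point `* ⟶ L/K`. -/
def quotientPt {K L : GDiagram a} (j : FixedHom K L) : FixedHom (pt a) (quotientDiagram j) :=
  ⟨({ app := fun _ => TopCat.ofHom
        ⟨fun x => Quot.mk _ (Sum.inr x), continuous_quot_mk.comp continuous_inr⟩
      naturality := fun _ _ _ => rfl } : (pt a).toFunctor ⟶ (quotientDiagram j).toFunctor),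
    (mem_fixedHom_iff _).2 (fun _ _ _ _ => rfl)⟩

/-! ### The `G`-diagrams of classifying spaces of over categories -/

/-- The functor `F/i ⥤ F/j`, `(c, γ) ↦ (g c, g γ)`, for an equivariant functor `F` and
`j = g i`. -/
def overAct {C : Type u} [SmallCategory C] {b : CatAction G C} {F : C ⥤ I}
    (hF : ∀ g, b.act g ⋙ F = F ⋙ a.act g) (g : G) {i j : I} (e : (a.act g).obj i = j) :
    CostructuredArrow F i ⥤ CostructuredArrow F j where
  obj x := CostructuredArrow.mk (Y := (b.act g).obj x.left)
    (eqToHom (Functor.congr_obj (hF g) x.left) ≫ (a.act g).map x.hom ≫ eqToHom e)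
  map {x y} f := CostructuredArrow.homMk ((b.act g).map f.left) (by
    have h := Functor.congr_hom (hF g) f.left
    have h' := CostructuredArrow.w f
    change F.map ((b.act g).map f.left) ≫ _ ≫ (a.act g).map y.hom ≫ _ = _
    rw [show F.map ((b.act g).map f.left) = _ from h, ← h', Functor.map_comp]
    simp)

/-- The `G`-diagram `i ↦ B(F/i)` for an equivariant functor `F`. -/
noncomputable def overG {C : Type u} [SmallCategory C] (b : CatAction G C) (F : C ⥤ I)
    (hF : ∀ g, b.act g ⋙ F = F ⋙ a.act g) : GDiagram a where
  toFunctor := overB F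
  φ g :=
    { app := fun i => BMap (overAct hF g rfl)
      naturality := fun i i' α => by
        change BMap _ ≫ BMap _ = BMap _ ≫ BMap _
        rw [← BMap_comp, ← BMap_comp]
        congr 1
        refine costructuredArrow_functor_ext F rfl (fun x e => ?_)
        change 𝟙 _ ≫ (eqToHom (Functor.congr_obj (hF g) x.left) ≫ (a.act g).map x.hom ≫ 𝟙 _) ≫
          (a.act g).map α =
            eqToHom (Functor.congr_obj (hF g) x.left) ≫ (a.act g).map (x.hom ≫ α) ≫ 𝟙 _
        simp }
  φ_one i := by
    change BMap _ = BMap _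
    congr 1
    refine costructuredArrow_functor_ext F ?_ (fun x e => ?_)
    · change CostructuredArrow.proj F i ⋙ b.act 1 = CostructuredArrow.proj F i
      rw [b.act_one]
      rfl
    · change eqToHom e ≫ x.hom ≫ eqToHom (a.one_obj i).symm =
        eqToHom (Functor.congr_obj (hF 1) x.left) ≫ (a.act 1).map x.hom ≫ 𝟙 _
      rw [a.one_map]
      simp
      rfl
  φ_mul h g i := by
    change BMap _ = BMap _ ≫ BMap _ ≫ BMap _
    rw [← BMap_comp, ← BMap_comp]
    congr 1
    refine costructuredArrow_functor_ext F ?_ (fun x e => ?_)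
    · change CostructuredArrow.proj F i ⋙ b.act (h * g) =
        CostructuredArrow.proj F i ⋙ b.act g ⋙ b.act h
      rw [b.act_mul]
    · exact a.mul_map_aux h g x.hom e _ _ _

/-- The functor `F/i ⥤ I/i` induced by `F`, as a functor to `CostructuredArrow (𝟭 I) i`. -/
def overIncl {C : Type u} [SmallCategory C] (F : C ⥤ I) (i : I) :
    CostructuredArrow F i ⥤ CostructuredArrow (𝟭 I) i where
  obj x := CostructuredArrow.mk (Y := F.obj x.left) x.hom
  map f := CostructuredArrow.homMk (F.map f.left) (CostructuredArrow.w f)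

/-- The `G`-diagram `i ↦ B(I/i)`. -/
noncomputable def overI (a : CatAction G I) : GDiagram a := overG a (𝟭 I) (fun _ => rfl)

theorem ι_equivariant (a : CatAction G I) (g : G) :
    (CatAction.trivial G (FixedCat a ⊤)).act g ⋙ FixedCat.ι a ⊤ = FixedCat.ι a ⊤ ⋙ a.act g := by
  refine CategoryTheory.Functor.ext
    (fun i => (CatAction.stab_eq i.le (Subgroup.mem_top g)).symm) ?_
  intro i j α
  have := α.2 g (Subgroup.mem_top g)
  change α.1 = eqToHom (CatAction.stab_eq i.le (Subgroup.mem_top g)).symm ≫ (a.act g).map α.1 ≫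
    eqToHom (CatAction.stab_eq j.le (Subgroup.mem_top g))
  simp [this]

/-- The `G`-diagram `i ↦ B(ι/i)`, for the inclusion `ι : I^G ⥤ I`. -/
noncomputable def overIota (a : CatAction G I) : GDiagram a :=
  overG (CatAction.trivial G (FixedCat a ⊤)) (FixedCat.ι a ⊤) (ι_equivariant a)

/-- The inclusion of `i ↦ B(ι/i)` in `i ↦ B(I/i)`. -/
noncomputable def iotaIncl (a : CatAction G I) : FixedHom (overIota a) (overI a) :=
  ⟨({ app := fun i => BMap (overIncl (FixedCat.ι a ⊤) i)
      naturality := fun i j α => by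
        change BMap _ ≫ BMap _ = BMap _ ≫ BMap _
        rw [← BMap_comp, ← BMap_comp]
        rfl } : (overIota a).toFunctor ⟶ (overI a).toFunctor),
    (mem_fixedHom_iff _).2 (by
      rintro g i _ rfl
      simp only [GDiagram.tr, eqToHom_refl, CategoryTheory.Functor.map_id]
      change BMap _ ≫ BMap _ = BMap _ ≫ BMap _
      rw [← BMap_comp, ← BMap_comp]
      congr 1
      refine costructuredArrow_functor_ext (𝟭 I) ?_ (fun x e => ?_)
      · change CostructuredArrow.proj _ i ⋙ (CatAction.trivial G (FixedCat a ⊤)).act g ⋙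
          FixedCat.ι a ⊤ = CostructuredArrow.proj _ i ⋙ FixedCat.ι a ⊤ ⋙ a.act g
        rw [ι_equivariant]
      · change eqToHom e ≫ 𝟙 _ ≫ (a.act g).map x.hom ≫ 𝟙 _ =
          eqToHom (Functor.congr_obj (ι_equivariant a g) x.left) ≫ (a.act g).map x.hom ≫ 𝟙 _
        rw [Category.id_comp]
        rfl)⟩

/-! ### Homotopy limits and the restriction map -/

/-- The fixed points `(lim_I X)^G`: the fixed points of the space of natural transformations
`* ⟶ X`. -/
abbrev FixedLim (X : GDiagram a) : Type u := FixedHom (pt a) X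

/-- The fixed points `(holim_I X)^G` of the `G`-homotopy limit `Hom_I(B(I/ -), X)`. -/
abbrev FixedHolim (X : GDiagram a) : Type u := FixedHom (overI a) X

/-- The functor `I^G/i ⥤ I/i` for an object `i` of `I^G`. -/
def fixedOver (a : CatAction G I) (i : FixedCat a ⊤) :
    CostructuredArrow (𝟭 (FixedCat a ⊤)) i ⥤ CostructuredArrow (𝟭 I) i.obj where
  obj x := CostructuredArrow.mk (Y := x.left.obj) x.hom.1
  map f := CostructuredArrow.homMk f.left.1 (congrArg Subtype.val (CostructuredArrow.w f))

theorem fixedOver_act (a : CatAction G I) (i : FixedCat a ⊤) (g : G) :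
    BMap (fixedOver a i) ≫ (overI a).tr g (CatAction.stab_eq i.le (Subgroup.mem_top g)) =
      BMap (fixedOver a i) := by
  change BMap _ ≫ BMap _ ≫ BMap _ = _
  rw [← BMap_comp, ← BMap_comp]
  congr 1
  refine costructuredArrow_functor_ext (𝟭 I) ?_ (fun x e => ?_)
  · change (CostructuredArrow.proj _ i ⋙ FixedCat.ι a ⊤ ⋙ a.act g) =
      CostructuredArrow.proj _ i ⋙ FixedCat.ι a ⊤
    rw [← ι_equivariant]
    rfl
  · change eqToHom e ≫ x.hom.1 = (𝟙 _ ≫ (a.act g).map x.hom.1 ≫ 𝟙 _) ≫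
      eqToHom (CatAction.stab_eq i.le (Subgroup.mem_top g))
    have := x.hom.2 g (Subgroup.mem_top g)
    rw [this]
    simp only [Category.assoc, Category.id_comp, Category.comp_id, eqToHom_trans, eqToHom_refl]
    rfl

/-- The canonical identification `B(I^G/i) ⟶ B(I/i)^G`, natural in the object `i` of `I^G`. -/
noncomputable def fixedOverB (a : CatAction G I) :
    overB (𝟭 (FixedCat a ⊤)) ⟶ (overI a).fixedDiagram ⊤ where
  app i := TopCat.ofHom
    ⟨fun z => ⟨BMap (fixedOver a i) z, fun g _ =>
        ConcreteCategory.congr_hom (fixedOver_act a i g) z⟩,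
      (BMap (fixedOver a i)).hom.continuous.subtype_mk _⟩
  naturality i j α := by
    ext z
    apply Subtype.ext
    have h : BMap (CostructuredArrow.map α) ≫ BMap (fixedOver a j) =
        BMap (fixedOver a i) ≫ BMap (CostructuredArrow.map α.1) := by
      rw [← BMap_comp, ← BMap_comp]
      rfl
    exact ConcreteCategory.congr_hom h z

/-- The restriction map `(holim_I X)^G → holim_{I^G} X^G`: a morphism of `G`-diagrams from
`i ↦ B(I/i)` to `X` is restricted to the fixed points diagrams. -/
noncomputable def restriction (X : GDiagram a) (f : FixedHolim X) : Holim (X.fixedDiagram ⊤) :=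
  CategoryStruct.comp (obj := FixedCat a ⊤ ⥤ TopCat.{u}) (fixedOverB a) (FixedHom.res ⊤ f)

/-- The canonical map `(lim_I X)^G → (holim_I X)^G`, given by precomposition with `B(I/i) → *`. -/
noncomputable def limToHolim (X : GDiagram a) (x : FixedLim X) : FixedHolim X :=
  (toPt (overI a)).comp x

/-- The constant natural transformation from `i ↦ B(I^G/i)` to `X^G` at a base point
`x : * ⟶ X`. -/
noncomputable def constHolim (X : GDiagram a) (x : FixedLim X) : Holim (X.fixedDiagram ⊤) :=
  CategoryStruct.comp (obj := FixedCat a ⊤ ⥤ TopCat.{u})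
    ({ app := fun _ => TopCat.ofHom ⟨fun _ => ⟨PUnit.unit, fun _ _ => rfl⟩, continuous_const⟩
       naturality := fun _ _ _ => rfl } :
      overB (𝟭 (FixedCat a ⊤)) ⟶ (pt a).fixedDiagram ⊤) (FixedHom.res ⊤ x)

/-- The functor `ι^H/i ⥤ I^H/i`, for the inclusion `ι^H : I^G ⥤ I^H`, fails to be surjective on
morphisms; that is, `hom(ι^H/i)` is a proper subset of `hom(I^H/i)`. -/
def ProperOnMorphisms (a : CatAction G I) (i : I) (H : Subgroup G) (hH : H ≤ a.stabilizer i) :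
    Prop :=
  ¬ Function.Surjective (CostructuredArrow.toOver (FixedCat.inclusion a (le_top (a := H)))
    (⟨i, hH⟩ : FixedCat a H)).mapArrow.obj

/-- The minimum over all objects `i` and all subgroups `H ≤ G_i` such that `hom(ι^H/i)` is a
proper subset of `hom(I^H/i)` of `conn (X i)^H - dim N(I^H/i)`. -/
noncomputable def connBound (X : GDiagram a) : EReal :=
  ⨅ (i : I) (H : Subgroup G) (hH : H ≤ a.stabilizer i) (_ : ProperOnMorphisms a i H hH),
    (conn (X.FixedSpace hH) - (nerve (Over (⟨i, hH⟩ : FixedCat a H))).dim)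

end Equivariant

open Opposite

/-! ### Geometric realizations and their simplices -/

/-- The standard topological simplex of an object of the simplex category. -/
abbrev TopSimplex (m : SimplexCategory) : Type := stdSimplex ℝ (Fin (m.len + 1))

/-- The affine map of topological simplices induced by a monotone map. -/
noncomputable abbrev TopSimplex.map {k m : SimplexCategory} (θ : k ⟶ m) (z : TopSimplex k) :
    TopSimplex m := stdSimplex.map θ z

namespace SSet

variable {S S' : SSet.{u}}

/-- The characteristic map `Δᵐ → |S|` of a simplex. -/
noncomputable def charMap {m : SimplexCategory} (x : S.obj (op m)) :
    C(TopSimplex m, SSet.toTop.obj S) :=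
  TopCat.toSSetObjEquiv _ _ ((sSetTopAdj.unit.app S).app (op m) x)

theorem toSSetObjEquiv_map {Y : TopCat.{u}} {m k : SimplexCategory} (θ : k ⟶ m)
    (y : (TopCat.toSSet.obj Y).obj (op m)) (z : TopSimplex k) :
    TopCat.toSSetObjEquiv _ _ ((TopCat.toSSet.obj Y).map θ.op y) z =
      TopCat.toSSetObjEquiv _ _ y (TopSimplex.map θ z) := rfl

theorem toSSetObjEquiv_app {Y Y' : TopCat.{u}} {m : SimplexCategory} (F : Y ⟶ Y')
    (y : (TopCat.toSSet.obj Y).obj (op m)) (z : TopSimplex m) :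
    TopCat.toSSetObjEquiv _ _ ((TopCat.toSSet.map F).app _ y) z =
      F (TopCat.toSSetObjEquiv _ _ y z) := rfl

theorem charMap_map {m k : SimplexCategory} (θ : k ⟶ m) (x : S.obj (op m))
    (z : TopSimplex k) :
    charMap (S.map θ.op x) z = charMap x (TopSimplex.map θ z) := by
  have := ConcreteCategory.congr_hom ((sSetTopAdj.unit.app S).naturality θ.op) x
  rw [charMap, charMap, ← toSSetObjEquiv_map]
  exact congrArg (fun y => TopCat.toSSetObjEquiv _ _ y z) this

theorem toTop_map_charMap (F : S ⟶ S') {m : SimplexCategory} (x : S.obj (op m))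
    (z : TopSimplex m) :
    SSet.toTop.map F (charMap x z) = charMap (F.app _ x) z := by
  have := ConcreteCategory.congr_hom
    (NatTrans.congr_app (sSetTopAdj.unit.naturality F) (op m)) x
  rw [charMap, charMap, ← toSSetObjEquiv_app]
  exact congrArg (fun y => TopCat.toSSetObjEquiv _ _ y z) this.symm

/-- By adjunction a map out of |S| is a map from S to the singular set of Y, and the composite with
`charMap x` is the value of this transpose at x. -/
theorem toTop_hom_ext {Y : TopCat.{u}} {F F' : SSet.toTop.obj S ⟶ Y}
    (h : ∀ (m : SimplexCategory) (x : S.obj (op m)) (z : TopSimplex m),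
      F (charMap x z) = F' (charMap x z)) : F = F' := by
  apply (sSetTopAdj.homEquiv S Y).injective
  ext m x
  apply (TopCat.toSSetObjEquiv _ _).injective
  ext z
  rw [Adjunction.homEquiv_unit, Adjunction.homEquiv_unit]
  exact h m.unop x z

/-- A family compatible with all simplicial operators, degeneracies included, is a simplicial map to
the singular set of Y; its transpose is the required map. -/
theorem exists_toTop_desc {Y : TopCat.{u}}
    (y : ∀ m : SimplexCategory, S.obj (op m) → C(TopSimplex m, Y))
    (hy : ∀ (m k : SimplexCategory) (θ : k ⟶ m) (x : S.obj (op m))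
      (z : TopSimplex k), y k (S.map θ.op x) z = y m x (TopSimplex.map θ z)) :
    ∃ F : SSet.toTop.obj S ⟶ Y, ∀ (m : SimplexCategory) (x : S.obj (op m))
      (z : TopSimplex m), F (charMap x z) = y m x z := by
  let Φ : S ⟶ TopCat.toSSet.obj Y :=
    { app := fun m => TypeCat.ofHom fun x => (TopCat.toSSetObjEquiv Y m).symm (y m.unop x)
      naturality := fun m k θ => by
        ext x
        apply (TopCat.toSSetObjEquiv Y k).injective
        ext z
        refine (congrArg (fun f => f z) ((TopCat.toSSetObjEquiv Y k).apply_symm_apply _)).trans ?_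
        refine (hy m.unop k.unop θ.unop x z).trans ?_
        symm
        refine (toSSetObjEquiv_map θ.unop _ z).trans ?_
        exact congrArg (fun f : C(TopSimplex m.unop, Y) => f (TopSimplex.map θ.unop z))
          ((TopCat.toSSetObjEquiv Y m).apply_symm_apply (y m.unop x)) }
  refine ⟨(sSetTopAdj.homEquiv S Y).symm Φ, fun m x z => ?_⟩
  have h := (sSetTopAdj.homEquiv S Y).apply_symm_apply Φ
  rw [Adjunction.homEquiv_unit] at h
  have h' := ConcreteCategory.congr_hom (NatTrans.congr_app h (op m)) x
  have h2 := congrArg (fun y => TopCat.toSSetObjEquiv Y (op m) y z) h'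
  refine Eq.trans ?_ (h2.trans ?_)
  · rfl
  · exact congrArg (fun f : C(TopSimplex m, Y) => f z)
      ((TopCat.toSSetObjEquiv Y (op m)).apply_symm_apply (y m x))

/-- The geometric realization with the weak topology of its simplices. -/
noncomputable def WeakRealization (S : SSet.{u}) : Type u := SSet.toTop.obj S

noncomputable instance (S : SSet.{u}) : TopologicalSpace (WeakRealization S) :=
  ⨆ (m : SimplexCategory) (x : S.obj (op m)),
    TopologicalSpace.coinduced (Y := SSet.toTop.obj S) (charMap x) inferInstance

theorem WeakRealization.continuous_dom {Z : Type*} [TopologicalSpace Z] {F : WeakRealization S → Z}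
    (h : ∀ (m : SimplexCategory) (x : S.obj (op m)), Continuous fun z => F (charMap x z)) :
    Continuous F :=
  continuous_iSup_dom.2 fun m => continuous_iSup_dom.2 fun x => continuous_coinduced_dom.2 (h m x)

theorem WeakRealization.continuous_charMap {m : SimplexCategory} (x : S.obj (op m)) :
    Continuous (Y := WeakRealization S) (fun z : TopSimplex m => charMap x z) :=
  continuous_iff_coinduced_le.2 (le_iSup₂_of_le (f := fun (m : SimplexCategory)
    (x : S.obj (op m)) => TopologicalSpace.coinduced (Y := SSet.toTop.obj S) (charMap x)
      inferInstance) m x le_rfl)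

/-- The topology of a geometric realization is the weak topology of its simplices. -/
theorem continuous_toTop_iff {Z : Type*} [TopologicalSpace Z] {F : SSet.toTop.obj S → Z} :
    Continuous F ↔ ∀ (m : SimplexCategory) (x : S.obj (op m)), Continuous (F ∘ charMap x) := by
  refine ⟨fun h m x => h.comp (charMap x).continuous, fun h => ?_⟩
  -- The universal property yields a continuous c to the weak topology. Followed by the continuous
  -- identity b it is the identity, so c is the identity on points and the two topologies agree.
  obtain ⟨c, hc⟩ := exists_toTop_desc (S := S) (Y := TopCat.of (WeakRealization S))
    (fun m x => ⟨fun z => charMap x z, WeakRealization.continuous_charMap x⟩)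
    (fun m k θ x z => charMap_map θ x z)
  let b : TopCat.of (WeakRealization S) ⟶ SSet.toTop.obj S :=
    TopCat.ofHom ⟨fun z => z, WeakRealization.continuous_dom fun m x => (charMap x).continuous⟩
  have hcb : c ≫ b = 𝟙 _ := toTop_hom_ext fun m x z => hc m x z
  have hid : ∀ z, c z = z := fun z => ConcreteCategory.congr_hom hcb z
  have : F = (fun z : WeakRealization S => F z) ∘ c := by
    funext z
    exact congrArg F (hid z).symm
  rw [this]
  exact (WeakRealization.continuous_dom h).comp c.hom.continuous

/-- If z lay on no simplex, the indicator of z and the constant `False`, both continuous into an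
indiscrete space, would agree on all simplices and hence be equal. -/
theorem exists_charMap_eq (z : SSet.toTop.obj S) :
    ∃ (m : SimplexCategory) (x : S.obj (op m)) (w : TopSimplex m),
      charMap x w = z := by
  by_contra hz
  let Y : TopCat.{u} := TopCat.trivial.obj (ULift.{u} Prop)
  let F : SSet.toTop.obj S ⟶ Y := TopCat.ofHom (Y := Y) ⟨fun z' => (⟨z' = z⟩ : ULift Prop),
      continuous_top⟩
  let F' : SSet.toTop.obj S ⟶ Y := TopCat.ofHom (Y := Y) ⟨fun _ => (⟨False⟩ : ULift Prop),
      continuous_top⟩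
  have h : F = F' := toTop_hom_ext fun m x w => by
    have : ¬ charMap x w = z := fun h => hz ⟨m, x, w, h⟩
    exact congrArg (ULift.up : Prop → ULift.{u} Prop) (eq_false this)
  have h2 : (z = z) = False := congrArg ULift.down (ConcreteCategory.congr_hom h z)
  exact h2.mp rfl

variable {T Y : Type*} [TopologicalSpace T] [TopologicalSpace Y]

/-- A family of maps parametrized by a compact Hausdorff space is continuous as soon as it is
jointly continuous on every simplex. -/
theorem continuous_uncurry_of_charMap [CompactSpace T] [T2Space T]
    (f : T → C(SSet.toTop.obj S, Y))
    (h : ∀ (m : SimplexCategory) (x : S.obj (op m)),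
      Continuous fun p : T × TopSimplex m => f p.1 (charMap x p.2)) :
    Continuous fun p : SSet.toTop.obj S × T => f p.2 p.1 := by
  have ht : ∀ z, Continuous fun t => f t z := fun z => by
    obtain ⟨m, x, w, rfl⟩ := exists_charMap_eq z
    exact (h m x).comp (continuous_id.prodMk continuous_const)
  -- After transposition the realization is the source, so continuity can be tested on simplices; T
  -- being compact Hausdorff, the result can be uncurried again.
  have hc : Continuous fun z : SSet.toTop.obj S => (⟨fun t => f t z, ht z⟩ : C(T, Y)) := by
    refine continuous_toTop_iff.2 fun m x => ?_
    refine ContinuousMap.continuous_of_continuous_uncurry _ ?_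
    exact (h m x).comp continuous_swap
  exact ContinuousMap.continuous_uncurry_of_continuous ⟨_, hc⟩

theorem continuous_of_charMap [CompactSpace T] [T2Space T]
    (f : T → C(SSet.toTop.obj S, Y))
    (h : ∀ (m : SimplexCategory) (x : S.obj (op m)),
      Continuous fun p : T × TopSimplex m => f p.1 (charMap x p.2)) :
    Continuous f :=
  ContinuousMap.continuous_of_continuous_uncurry _
    ((continuous_uncurry_of_charMap f h).comp continuous_swap)

theorem continuous_charMap_of_continuous {f : T → C(SSet.toTop.obj S, Y)} (hf : Continuous f)
    {m : SimplexCategory} (x : S.obj (op m)) :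
    Continuous fun p : T × TopSimplex m => f p.1 (charMap x p.2) :=
  ContinuousMap.continuous_uncurry_of_continuous
    ⟨fun t => (f t).comp (charMap x), (ContinuousMap.continuous_precomp _).comp hf⟩

end SSet

/-! ### Spaces of natural transformations -/

section HomSpace

variable {C : Type u} [SmallCategory C] {K X : C ⥤ TopCat.{u}}

/-- The component of a point of `HomSpace K X`, as a continuous map. -/
def HomSpace.comp (f : HomSpace K X) (i : C) : C(K.obj i, X.obj i) := (NatTrans.app f i).hom

theorem HomSpace.ext_comp {f f' : HomSpace K X} (h : ∀ i z, f.comp i z = f'.comp i z) : f = f' := by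
  apply NatTrans.ext
  funext i
  ext z
  exact h i z

theorem HomSpace.continuous_comp (i : C) :
    Continuous fun f : HomSpace K X => f.comp i := by
  have h0 : @Continuous _ _ (HomSpace.compactOpen K X) _
      (fun (f : HomSpace K X) (i : C) => f.comp i) := continuous_induced_dom
  have h : @Continuous _ _ (HomSpace.compactOpen K X) _ (fun f : HomSpace K X => f.comp i) :=
    @Continuous.comp _ _ _ (HomSpace.compactOpen K X) _ _ _
      (fun f : ∀ i, C(K.obj i, X.obj i) => f i) (continuous_apply i) h0
  exact @Continuous.comp _ _ _ _ (HomSpace.compactOpen K X) _ _ _ h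
      (@CompactCoherentification.continuous_mk_symm _ (HomSpace.compactOpen K X))

/-- Maps from a compact space do not distinguish a topology from its compactly generated refinement,
so the compact-open topology may be used. -/
theorem HomSpace.continuous_of_comp {T : Type*} [TopologicalSpace T] [CompactSpace T]
    {f : T → HomSpace K X} (hf : ∀ i, Continuous fun t => (f t).comp i) : Continuous f := by
  refine (@CompactCoherentification.continuous_rng_of_compactSpace _ _ _
    (HomSpace.compactOpen K X) f _).2 ?_
  exact continuous_induced_rng.2 (continuous_pi hf)

instance HomSpace.t2Space [∀ i, T2Space (X.obj i)] : T2Space (HomSpace K X) := by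
  refine T2Space.of_injective_continuous
    (f := fun (f : HomSpace K X) (p : Σ i, K.obj i) => f.comp p.1 p.2) ?_ ?_
  · intro f f' h
    exact HomSpace.ext_comp fun i z => congrFun h ⟨i, z⟩
  · exact continuous_pi fun p =>
      (continuous_eval_const (F := C(K.obj p.1, X.obj p.1)) p.2).comp (HomSpace.continuous_comp p.1)

instance HomSpace.compactlyCoherent : CompactlyCoherentSpace (HomSpace K X) :=
  @CompactCoherentification.instCompactlyCoherentSpace _ (HomSpace.compactOpen K X)

end HomSpace

/-- On a closed subspace of a compactly coherent Hausdorff space, continuity can be tested on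
compact Hausdorff spaces. -/
theorem Topology.IsClosedEmbedding.continuous_of_compact {W Z : Type u} {Y : Type*}
    [TopologicalSpace W] [TopologicalSpace Z] [TopologicalSpace Y] [CompactlyCoherentSpace Z]
    [T2Space Z] {e : W → Z} (he : Topology.IsClosedEmbedding e) {f : W → Y}
    (h : ∀ (T : Type u) [TopologicalSpace T] [CompactSpace T] [T2Space T] (k : T → W),
      Continuous k → Continuous (f ∘ k)) : Continuous f := by
  have : T2Space W := he.isEmbedding.t2Space
  refine continuous_iff_isClosed.2 fun D hD => ?_
  rw [he.isClosed_iff_image_isClosed, CompactlyCoherentSpace.isClosed_iff]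
  intro K hK
  -- Closedness of the image of f⁻¹(D) is tested on compact K in Z. The embedding being closed, its
  -- preimage of K is compact Hausdorff, so the assumption applies to it, and images of its closed
  -- subsets are compact, hence closed in Z.
  have hK' : IsCompact (e ⁻¹' K) := he.isCompact_preimage hK
  have : CompactSpace (e ⁻¹' K) := isCompact_iff_compactSpace.1 hK'
  have h1 : IsClosed ((fun z : (e ⁻¹' K) => f z.1) ⁻¹' D) :=
    hD.preimage (h (e ⁻¹' K) Subtype.val continuous_subtype_val)
  have h2 : IsClosed ((fun z : (e ⁻¹' K) => e z.1) '' ((fun z : (e ⁻¹' K) => f z.1) ⁻¹' D)) :=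
    (h1.isCompact.image (he.continuous.comp continuous_subtype_val)).isClosed
  have h3 : IsClosed ((Subtype.val : K → Z) ⁻¹'
      ((fun z : (e ⁻¹' K) => e z.1) '' ((fun z : (e ⁻¹' K) => f z.1) ⁻¹' D))) :=
    h2.preimage continuous_subtype_val
  convert h3 using 1
  ext ⟨z, hz⟩
  constructor
  · rintro ⟨w, hw, hwz⟩
    exact ⟨⟨w, by rw [Set.mem_preimage, hwz]; exact hz⟩, hw, hwz⟩
  · rintro ⟨w, hw, hwz⟩
    exact ⟨w.1, hw, hwz⟩

/-! ### Simplices of nerves of over categories -/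

section Canon

variable {C : Type u} [SmallCategory C]

/-- Simplices of the nerve of `C`. -/
abbrev Chain (C : Type u) [SmallCategory C] (m : SimplexCategory) : Type u :=
  (nerve C).obj (op m)

/-- Simplices of the nerve of `C/i`. -/
abbrev OverChain (i : C) (m : SimplexCategory) : Type u :=
  (nerve (CostructuredArrow (𝟭 C) i)).obj (op m)

/-- The last vertex of a chain. -/
def Chain.last {m : SimplexCategory} (σ : Chain C m) : C :=
  CategoryTheory.Functor.obj (C := Fin (m.len + 1)) σ (Fin.last m.len)

/-- The underlying chain of a simplex of `N(C/i)`. -/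
def OverChain.chain {i : C} {m : SimplexCategory} (w : OverChain i m) : Chain C m :=
  CategoryTheory.Functor.comp (C := Fin (m.len + 1)) w (CostructuredArrow.proj (𝟭 C) i)

/-- The structure map of the last vertex of a simplex of `N(C/i)`. -/
def OverChain.hom {i : C} {m : SimplexCategory} (w : OverChain i m) : w.chain.last ⟶ i :=
  CostructuredArrow.hom (CategoryTheory.Functor.obj (C := Fin (m.len + 1)) w (Fin.last m.len))

/-- The simplex of `N(C/i)` given by a chain and a map from its last vertex to `i`. -/
def Chain.over {m : SimplexCategory} (σ : Chain C m) {i : C} (γ : σ.last ⟶ i) : OverChain i m where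
  obj p := CostructuredArrow.mk (S := 𝟭 C) (Y := CategoryTheory.Functor.obj (C := Fin
      (m.len + 1)) σ p)
    (CategoryTheory.Functor.map (C := Fin (m.len + 1)) σ (homOfLE (Fin.le_last p)) ≫ γ)
  map {p q} f := CostructuredArrow.homMk (CategoryTheory.Functor.map (C := Fin (m.len + 1)) σ f) (by
    change CategoryTheory.Functor.map (C := Fin (m.len + 1)) σ f ≫ (CategoryTheory.Functor.map
        (C := Fin (m.len + 1)) σ _ ≫ γ) =
      CategoryTheory.Functor.map (C := Fin (m.len + 1)) σ _ ≫ γ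
    refine (Category.assoc _ _ _).symm.trans (congrArg (· ≫ γ) ?_)
    exact (CategoryTheory.Functor.map_comp (C := Fin (m.len + 1)) σ _ _).symm)
  map_id p := by
    apply CostructuredArrow.hom_ext
    exact CategoryTheory.Functor.map_id (C := Fin (m.len + 1)) σ p
  map_comp f g := by
    apply CostructuredArrow.hom_ext
    exact CategoryTheory.Functor.map_comp (C := Fin (m.len + 1)) σ f g

theorem Chain.over_chain {m : SimplexCategory} (σ : Chain C m) {i : C} (γ : σ.last ⟶ i) :
    (σ.over γ).chain = σ := rfl

theorem Chain.over_hom {m : SimplexCategory} (σ : Chain C m) {i : C} (γ : σ.last ⟶ i) :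
    (σ.over γ).hom = γ := by
  refine (congrArg (· ≫ γ) (CategoryTheory.Functor.map_id (C := Fin (m.len + 1)) σ
      (Fin.last m.len))).trans ?_
  exact Category.id_comp γ

theorem eqToHom_comp_comp {A A' B B' i : C} (e e' : A = A') (d : B' = B) (d' : B = B')
    (f : A' ⟶ B') (k : B' ⟶ i) :
    eqToHom e ≫ f ≫ k = (eqToHom e' ≫ f ≫ eqToHom d) ≫ eqToHom d' ≫ k := by
  subst e d
  simp

/-- The structure map at vertex p is the chain map from p to the last vertex followed by the
structure map there, so the last one determines all others. -/
theorem OverChain.ext {i : C} {m : SimplexCategory} {w w' : OverChain i m}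
    (h : w.chain = w'.chain)
    (hh : ∀ e : w.chain.last = w'.chain.last, eqToHom e ≫ w'.hom = w.hom) : w = w' := by
  refine costructuredArrow_functor_ext (A := Fin (m.len + 1)) (𝟭 C) h fun p e => ?_
  have h1 : ∀ v : OverChain i m, (CategoryTheory.Functor.obj (C := Fin (m.len + 1)) v p).hom =
      CategoryTheory.Functor.map (C := Fin (m.len + 1)) v.chain (homOfLE
          (Fin.le_last p)) ≫ v.hom := fun v =>
    (CostructuredArrow.w (CategoryTheory.Functor.map (C := Fin (m.len + 1)) v
      (homOfLE (Fin.le_last p)))).symm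
  rw [h1 w, h1 w', ← hh (congrArg Chain.last h),
    CategoryTheory.Functor.congr_hom (C := Fin (m.len + 1)) h (homOfLE (Fin.le_last p))]
  exact eqToHom_comp_comp _ _ _ _ _ _

theorem OverChain.eq_over {i : C} {m : SimplexCategory} (w : OverChain i m) :
    w = w.chain.over w.hom :=
  OverChain.ext rfl fun e => by rw [Chain.over_hom]; exact Category.id_comp _

theorem Chain.over_congr {m : SimplexCategory} {σ σ' : Chain C m} (h : σ = σ') {i : C}
    (γ : σ.last ⟶ i) :
    σ.over γ = σ'.over (eqToHom (congrArg Chain.last h.symm) ≫ γ) := by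
  subst h
  simp

theorem Chain.over_injective {m : SimplexCategory} {σ : Chain C m} {i : C}
    {γ γ' : σ.last ⟶ i} (h : σ.over γ = σ.over γ') : γ = γ' := by
  have h1 := Chain.over_hom σ γ
  have h2 : ∀ (w w' : OverChain i m) (e : w = w') (e' : w'.chain.last = w.chain.last),
      eqToHom e' ≫ w.hom = w'.hom := by
    rintro w _ rfl e'
    simp
  have h3 := h2 _ _ h rfl
  rw [Chain.over_hom, Chain.over_hom] at h3
  exact (Category.id_comp γ).symm.trans h3

/-- The map from the last vertex of a face to the last vertex. -/
def Chain.lastMap {m k : SimplexCategory} (σ : Chain C m) (θ : k ⟶ m) :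
    Chain.last ((nerve C).map θ.op σ) ⟶ σ.last :=
  CategoryTheory.Functor.map (C := Fin (m.len + 1)) σ (homOfLE (Fin.le_last (θ (Fin.last k.len))))

/-- A face may omit the last vertex; the chain map from the new last vertex to the old one then
enters the structure map. -/
theorem Chain.map_over {m k : SimplexCategory} (σ : Chain C m) (θ : k ⟶ m) {i : C}
    (γ : σ.last ⟶ i) :
    (nerve (CostructuredArrow (𝟭 C) i)).map θ.op (σ.over γ) =
      Chain.over ((nerve C).map θ.op σ) (σ.lastMap θ ≫ γ) :=
  OverChain.ext rfl fun e => by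
    rw [Chain.over_hom]
    exact Category.id_comp _

/-- Postcomposition of a simplex of `N(C/i)` with a map `i ⟶ j`. -/
theorem Chain.map_over_app {m : SimplexCategory} (σ : Chain C m) {i j : C} (γ : σ.last ⟶ i)
    (β : i ⟶ j) :
    (nerveMap (CostructuredArrow.map (S := 𝟭 C) β)).app (op m) (σ.over γ) = σ.over (γ ≫ β) :=
  OverChain.ext rfl fun e => by
    rw [Chain.over_hom]
    refine (Category.id_comp _).trans ?_
    exact congrArg (· ≫ β) (Chain.over_hom σ γ).symm

end Canon

/-! ### The action of G on diagrams and on simplices of over categories -/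

section Push

variable {G : Type w} [Group G] {I : Type u} [SmallCategory I] {a : CatAction G I}

theorem CatAction.mul_map_comp (a : CatAction G I) (g h : G) {c i j k : I} (γ : c ⟶ i)
    (α : (a.act g).obj i ⟶ j) (β : (a.act h).obj j ⟶ k)
    (e : (a.act h).obj ((a.act g).obj c) = (a.act (h * g)).obj c) :
    eqToHom e ≫ (a.act (h * g)).map γ ≫ eqToHom (a.mul_obj h g i) ≫ (a.act h).map α ≫ β =
      (a.act h).map ((a.act g).map γ ≫ α) ≫ β := by
  rw [a.mul_map]
  simp

namespace GDiagram

variable (X : GDiagram a)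

/-- The map `X i ⟶ X j` given by an element `g` and a map `g i ⟶ j`. -/
def push (g : G) {i j : I} (α : (a.act g).obj i ⟶ j) : X.toFunctor.obj i ⟶ X.toFunctor.obj j :=
  (X.φ g).app i ≫ X.toFunctor.map α

/-- The pairs (g, α : g i ⟶ j) are the morphisms of the Grothendieck construction of the action.
This is its composition law, so a G-diagram is a functor on that category, and naturality and
equivariance become one condition. -/
theorem push_push (g h : G) {i j k : I} (α : (a.act g).obj i ⟶ j) (β : (a.act h).obj j ⟶ k) :
    X.push g α ≫ X.push h β =
      X.push (h * g) (eqToHom (a.mul_obj h g i) ≫ (a.act h).map α ≫ β) := by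
  have := (X.φ h).naturality α
  simp only [push, X.φ_mul, Category.assoc, ← CategoryTheory.Functor.map_comp]
  rw [reassoc_of% this]
  simp

theorem push_one {i j : I} (α : i ⟶ j) :
    X.push 1 (eqToHom (a.one_obj i) ≫ α) = X.toFunctor.map α := by
  rw [push, X.φ_one, ← CategoryTheory.Functor.map_comp]
  simp

theorem push_eq_tr (g : G) {i j : I} (α : (a.act g).obj i ⟶ j) :
    X.push g α = X.tr g rfl ≫ X.toFunctor.map α := by
  simp [push, tr]

/-- A family of maps that commutes with the maps `push` is a morphism of `G`-diagrams. -/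
def homOfPush {K X : GDiagram a} (f : ∀ i, K.toFunctor.obj i ⟶ X.toFunctor.obj i)
    (hf : ∀ (g : G) (i j : I) (α : (a.act g).obj i ⟶ j),
      K.push g α ≫ f j = f i ≫ X.push g α) : FixedHom K X :=
  ⟨({ app := f
      naturality := fun i j α => by
        rw [← K.push_one, ← X.push_one]
        exact hf _ _ _ _ } : K.toFunctor ⟶ X.toFunctor),
    (mem_fixedHom_iff _).2 fun g i j e => hf g i j (eqToHom e)⟩

end GDiagram

/-- The converse of `homOfPush`. -/
theorem FixedHom.push {K X : GDiagram a} (f : FixedHom K X) (g : G) {i j : I}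
    (α : (a.act g).obj i ⟶ j) (z : K.toFunctor.obj i) :
    f.1.app j (K.push g α z) = X.push g α (f.1.app i z) := by
  have h := f.equivariant g rfl z
  have h2 := ConcreteCategory.congr_hom (f.1.naturality α) (K.tr g rfl z)
  rw [K.push_eq_tr, X.push_eq_tr]
  refine h2.trans ?_
  exact congrArg (X.toFunctor.map α) h

/-- The functor `I/i ⥤ I/j`, `(c, γ) ↦ (g c, gγ ≫ α)`. -/
def pushFunctor (g : G) {i j : I} (α : (a.act g).obj i ⟶ j) :
    CostructuredArrow (𝟭 I) i ⥤ CostructuredArrow (𝟭 I) j :=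
  overAct (b := a) (F := 𝟭 I) (fun _ => rfl) g rfl ⋙ CostructuredArrow.map α

theorem overI_push (g : G) {i j : I} (α : (a.act g).obj i ⟶ j) :
    (overI a).push g α = BMap (pushFunctor g α) := by
  rw [pushFunctor, BMap_comp]
  rfl

/-- The action of `pushFunctor` on simplices. -/
def OverChain.push {m : SimplexCategory} {i j : I} (g : G) (α : (a.act g).obj i ⟶ j)
    (w : OverChain i m) : OverChain j m :=
  (nerveMap (pushFunctor g α)).app (op m) w

/-- The action on chains. -/
def Chain.act {m : SimplexCategory} (a : CatAction G I) (g : G) (σ : Chain I m) : Chain I m :=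
  CategoryTheory.Functor.comp (C := Fin (m.len + 1)) σ (a.act g)

theorem Chain.act_one {m : SimplexCategory} (σ : Chain I m) : σ.act a 1 = σ := by
  rw [Chain.act, a.act_one]
  rfl

theorem Chain.act_mul {m : SimplexCategory} (g h : G) (σ : Chain I m) :
    σ.act a (g * h) = (σ.act a h).act a g := by
  rw [Chain.act, a.act_mul]
  rfl

theorem Chain.act_inv_act {m : SimplexCategory} (g : G) (σ : Chain I m) :
    (σ.act a g).act a g⁻¹ = σ := by
  rw [← Chain.act_mul, inv_mul_cancel, Chain.act_one]

theorem Chain.map_act {m k : SimplexCategory} (θ : k ⟶ m) (g : G) (σ : Chain I m) :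
    Chain.act a g ((nerve I).map θ.op σ) = (nerve I).map θ.op (σ.act a g) := rfl

theorem OverChain.push_chain {m : SimplexCategory} {i j : I} (g : G) (α : (a.act g).obj i ⟶ j)
    (w : OverChain i m) : (w.push g α).chain = w.chain.act a g := rfl

theorem OverChain.push_hom {m : SimplexCategory} {i j : I} (g : G) (α : (a.act g).obj i ⟶ j)
    (w : OverChain i m) : (w.push g α).hom = (a.act g).map w.hom ≫ α := by
  change (𝟙 _ ≫ (a.act g).map w.hom ≫ 𝟙 _) ≫ α = _
  simp

theorem OverChain.map_push {m k : SimplexCategory} {i j : I} (θ : k ⟶ m) (g : G)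
    (α : (a.act g).obj i ⟶ j) (w : OverChain i m) :
    OverChain.push g α ((nerve (CostructuredArrow (𝟭 I) i)).map θ.op w) =
      (nerve (CostructuredArrow (𝟭 I) j)).map θ.op (w.push g α) := rfl

theorem OverChain.push_push {m : SimplexCategory} {i j k : I} (g h : G)
    (α : (a.act g).obj i ⟶ j) (β : (a.act h).obj j ⟶ k) (w : OverChain i m) :
    (w.push g α).push h β = w.push (h * g) (eqToHom (a.mul_obj h g i) ≫ (a.act h).map α ≫ β) := by
  refine OverChain.ext ?_ fun e => ?_
  · rw [push_chain, push_chain, push_chain, Chain.act_mul]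
  · rw [push_hom, push_hom, push_hom]
    exact a.mul_map_comp g h w.hom α β e

theorem charMap_push {m : SimplexCategory} {i j : I} (g : G) (α : (a.act g).obj i ⟶ j)
    (w : OverChain i m) (z : TopSimplex m) :
    SSet.charMap (w.push g α) z = (overI a).push g α (SSet.charMap w z) := by
  rw [overI_push]
  exact (SSet.toTop_map_charMap _ _ _).symm

/-! ### Chains in fixed subcategories -/

/-- A chain fixed by a subgroup `H` lies in `I^H`. -/
theorem Chain.exists_fixed {m : SimplexCategory} {H : Subgroup G} {σ : Chain I m}
    (h : ∀ g ∈ H, σ.act a g = σ) :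
    ∃ σ₀ : Chain (FixedCat a H) m, (nerveMap (FixedCat.ι a H)).app (op m) σ₀ = σ :=
  ⟨{  obj := fun p => ⟨CategoryTheory.Functor.obj (C := Fin (m.len + 1)) σ p,
        fun g hg => CategoryTheory.Functor.congr_obj (C := Fin (m.len + 1)) (h g hg) p⟩
      map := fun f => ⟨CategoryTheory.Functor.map (C := Fin (m.len + 1)) σ f,
        fun g hg => CategoryTheory.Functor.congr_hom (C := Fin (m.len + 1)) (h g hg) f⟩
      map_id := fun p => Subtype.ext (CategoryTheory.Functor.map_id (C := Fin (m.len + 1)) σ p)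
      map_comp := fun f g => Subtype.ext (CategoryTheory.Functor.map_comp (C := Fin
          (m.len + 1)) σ f g) }, rfl⟩

theorem ι_comp_act {H : Subgroup G} {g : G} (hg : g ∈ H) :
    FixedCat.ι a H ⋙ a.act g = FixedCat.ι a H :=
  CategoryTheory.Functor.ext (fun i => CatAction.stab_eq i.le hg) fun _ _ α => α.2 g hg

/-- The chain in `I` underlying a chain in `I^H`. -/
abbrev Chain.incl {H : Subgroup G} {m : SimplexCategory} (σ : Chain (FixedCat a H) m) : Chain I m :=
  (nerveMap (FixedCat.ι a H)).app (op m) σ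

theorem Chain.incl_act {H : Subgroup G} {g : G} (hg : g ∈ H) {m : SimplexCategory}
    (σ : Chain (FixedCat a H) m) : σ.incl.act a g = σ.incl :=
  congrArg (CategoryTheory.Functor.comp (C := Fin (m.len + 1)) σ) (ι_comp_act hg)

theorem FixedCat.ext {H : Subgroup G} {i j : FixedCat a H} (h : i.obj = j.obj) : i = j := by
  cases i
  cases j
  subst h
  rfl

theorem Chain.incl_injective {H : Subgroup G} {m : SimplexCategory} :
    Function.Injective (Chain.incl : Chain (FixedCat a H) m → Chain I m) := by
  intro σ σ' h
  have ho : ∀ p, CategoryTheory.Functor.obj (C := Fin (m.len + 1)) σ p =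
      CategoryTheory.Functor.obj (C := Fin (m.len + 1)) σ' p := fun p =>
    FixedCat.ext (CategoryTheory.Functor.congr_obj (C := Fin (m.len + 1)) h p)
  -- Objects of I^H are equal only propositionally, so the inclusion has to be moved past the
  -- transports in the equality of functors.
  have key : ∀ {i i' j j' : FixedCat a H} (e : i = i') (e' : j' = j) (f : i' ⟶ j'),
      (FixedCat.ι a H).map (eqToHom e ≫ f ≫ eqToHom e') = eqToHom (congrArg _ e) ≫
        (FixedCat.ι a H).map f ≫ eqToHom (congrArg _ e') := by
    rintro i _ j' _ rfl rfl f
    simp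
  refine CategoryTheory.Functor.ext (C := Fin (m.len + 1)) ho fun p q f => ?_
  apply Subtype.ext
  refine (CategoryTheory.Functor.congr_hom (C := Fin (m.len + 1)) h f).trans ?_
  exact (key (ho p) (ho q).symm _).symm

theorem fixedOver_over {m : SimplexCategory} (σ : Chain (FixedCat a ⊤) m) {i : FixedCat a ⊤}
    (γ : σ.last ⟶ i) :
    (nerveMap (fixedOver a i)).app (op m) (σ.over γ) = σ.incl.over (i := i.obj) γ.1 :=
  OverChain.ext rfl fun e => by
    refine (Category.id_comp _).trans ((Chain.over_hom σ.incl (i := i.obj) γ.1).trans ?_)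
    exact congrArg Subtype.val (Chain.over_hom σ γ).symm

end Push

/-! ### Gluing along the boundary of a simplex -/

section Boundary

/-- The boundary of the standard topological simplex. -/
def TopBoundary (m : SimplexCategory) : Set (TopSimplex m) := {z | ∃ p, z p = 0}

theorem TopSimplex.continuous_map {k m : SimplexCategory} (θ : k ⟶ m) :
    Continuous (TopSimplex.map θ) := stdSimplex.continuous_map _

theorem TopSimplex.map_apply {k m : SimplexCategory} (θ : k ⟶ m) (z : TopSimplex k)
    (q : Fin (m.len + 1)) : TopSimplex.map θ z q = ∑ p with θ p = q, z p :=
  FunOnFinite.linearMap_apply_apply ..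

theorem TopSimplex.map_apply_mono {k m : SimplexCategory} {θ : k ⟶ m}
    (hθ : Function.Injective θ) (z : TopSimplex k) (p : Fin (k.len + 1)) :
    TopSimplex.map θ z (θ p) = z p := by
  rw [TopSimplex.map_apply, Finset.sum_eq_single p]
  · intro q hq hqp
    exact absurd (hθ (Finset.mem_filter.1 hq).2) hqp
  · simp

theorem TopSimplex.map_apply_of_notMem {k m : SimplexCategory} {θ : k ⟶ m} (z : TopSimplex k)
    {q : Fin (m.len + 1)} (hq : q ∉ Set.range θ) : TopSimplex.map θ z q = 0 := by
  rw [TopSimplex.map_apply, Finset.sum_eq_zero]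
  intro p hp
  exact absurd ⟨p, (Finset.mem_filter.1 hp).2⟩ hq

theorem TopSimplex.map_injective {k m : SimplexCategory} {θ : k ⟶ m}
    (hθ : Function.Injective θ) : Function.Injective (TopSimplex.map θ) := by
  intro z z' h
  apply stdSimplex.ext
  funext p
  rw [← TopSimplex.map_apply_mono hθ z, h, TopSimplex.map_apply_mono hθ]

/-- A point of a simplex that vanishes off the range of an injective map lies in its image. -/
theorem TopSimplex.exists_map_eq {k m : SimplexCategory} {θ : k ⟶ m}
    (hθ : Function.Injective θ) {z : TopSimplex m} (hz : ∀ q, q ∉ Set.range θ → z q = 0) :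
    ∃ z₀ : TopSimplex k, TopSimplex.map θ z₀ = z ∧ ∀ p, z₀ p = z (θ p) := by
  have hsum : ∑ p, z (θ p) = 1 := by
    rw [← stdSimplex.sum_eq_one z]
    refine Finset.sum_of_injOn θ hθ.injOn (by simp) (fun q _ hq => hz q ?_) (fun _ _ => rfl)
    simpa using hq
  let z₀ : TopSimplex k := ⟨fun p => z (θ p), fun p => stdSimplex.zero_le z _, hsum⟩
  refine ⟨z₀, ?_, fun p => rfl⟩
  apply stdSimplex.ext
  funext q
  by_cases hq : q ∈ Set.range θ
  · obtain ⟨p, rfl⟩ := hq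
    exact TopSimplex.map_apply_mono hθ z₀ p
  · rw [TopSimplex.map_apply_of_notMem z₀ hq, hz q hq]

/-- The face spanned by a nonempty set of vertices. -/
theorem SimplexCategory.exists_hom_range {m : SimplexCategory} (s : Finset (Fin (m.len + 1)))
    {k : ℕ} (hk : s.card = k + 1) :
    ∃ θ : SimplexCategory.mk k ⟶ m, Function.Injective θ ∧ Set.range θ = s :=
  ⟨SimplexCategory.Hom.mk (s.orderEmbOfFin hk).toOrderHom, (s.orderEmbOfFin hk).injective,
    Finset.range_orderEmbOfFin s hk⟩

theorem SimplexCategory.hom_ext_of_range {k m : SimplexCategory} {θ θ' : k ⟶ m}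
    (hθ : Function.Injective θ) (hθ' : Function.Injective θ') (h : Set.range θ = Set.range θ') :
    θ = θ' := by
  have h1 : StrictMono θ := θ.toOrderHom.monotone.strictMono_of_injective hθ
  have h2 : StrictMono θ' := θ'.toOrderHom.monotone.strictMono_of_injective hθ'
  have h3 := (StrictMono.range_inj h1 h2).1 h
  exact SimplexCategory.Hom.ext _ _ (OrderHom.ext _ _ h3)

theorem TopSimplex.map_map {a b c : SimplexCategory} (f : a ⟶ b) (g : b ⟶ c) (x : TopSimplex a) :
    TopSimplex.map g (TopSimplex.map f x) = TopSimplex.map (f ≫ g) x :=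
  stdSimplex.map_comp_apply _ _ _

/-- If two faces of a simplex have a common point, then it comes from a common face. -/
theorem TopSimplex.exists_common {k k' m : SimplexCategory} {θ : k ⟶ m} {θ' : k' ⟶ m}
    (hθ : Function.Injective θ) (hθ' : Function.Injective θ') {z : TopSimplex k}
    {z' : TopSimplex k'} (h : TopSimplex.map θ z = TopSimplex.map θ' z') :
    ∃ (l : SimplexCategory) (η : l ⟶ k) (η' : l ⟶ k') (z₀ : TopSimplex l),
      η ≫ θ = η' ≫ θ' ∧ TopSimplex.map η z₀ = z ∧ TopSimplex.map η' z₀ = z' := by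
  classical
  -- The common face is spanned by the vertices with nonzero coordinate. Both supports have the same
  -- image in m, namely the support of the common point.
  let s : Finset (Fin (k.len + 1)) := {p | z p ≠ 0}
  let s' : Finset (Fin (k'.len + 1)) := {p | z' p ≠ 0}
  have himg : ∀ {k : SimplexCategory} {θ : k ⟶ m} (_ : Function.Injective θ) (z : TopSimplex k)
      (q : Fin (m.len + 1)), (∃ p, z p ≠ 0 ∧ θ p = q) ↔ TopSimplex.map θ z q ≠ 0 := by
    intro k θ hθ z q
    constructor
    · rintro ⟨p, hp, rfl⟩
      rwa [TopSimplex.map_apply_mono hθ]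
    · intro hq
      by_cases hr : q ∈ Set.range θ
      · obtain ⟨p, rfl⟩ := hr
        exact ⟨p, by rwa [TopSimplex.map_apply_mono hθ] at hq, rfl⟩
      · exact absurd (TopSimplex.map_apply_of_notMem z hr) hq
  have hss : s.image θ = s'.image θ' := by
    ext q
    simp only [Finset.mem_image, s, s', Finset.mem_filter, Finset.mem_univ, true_and]
    rw [himg hθ, himg hθ', h]
  have hcard : s.card = s'.card := by
    rw [← Finset.card_image_of_injective s hθ, hss, Finset.card_image_of_injective s' hθ']
  -- The coordinates sum to one, so the support is nonempty and spans a simplex of dimension one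
  -- less than its cardinality.
  have hne : s.card ≠ 0 := by
    intro h0
    have : ∀ p, z p = 0 := by
      intro p
      by_contra hp
      have : p ∈ s := by simpa [s] using hp
      rw [Finset.card_eq_zero.1 h0] at this
      simp at this
    have h1 := stdSimplex.sum_eq_one z
    simp [this] at h1
  obtain ⟨l, hl⟩ := Nat.exists_eq_succ_of_ne_zero hne
  obtain ⟨η, hη, hηs⟩ := SimplexCategory.exists_hom_range s hl
  obtain ⟨η', hη', hηs'⟩ := SimplexCategory.exists_hom_range s' (hcard ▸ hl)
  have hcomp : η ≫ θ = η' ≫ θ' := by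
    refine SimplexCategory.hom_ext_of_range (θ := η ≫ θ) (θ' := η' ≫ θ')
      (fun _ _ e => hη (hθ e)) (fun _ _ e => hη' (hθ' e)) ?_
    change Set.range (θ ∘ η) = Set.range (θ' ∘ η')
    rw [Set.range_comp, Set.range_comp, hηs, hηs']
    exact_mod_cast congrArg (fun t : Finset _ => (t : Set (Fin (m.len + 1)))) hss
  obtain ⟨z₀, hz₀, -⟩ := TopSimplex.exists_map_eq (z := z) hη (fun q hq => by
    by_contra h0
    apply hq
    rw [hηs]
    simpa [s] using h0)
  refine ⟨_, η, η', z₀, hcomp, hz₀, ?_⟩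
  apply TopSimplex.map_injective hθ'
  rw [← h, ← hz₀]
  rw [TopSimplex.map_map, TopSimplex.map_map, hcomp]

theorem TopSimplex.map_δ_mem {n : ℕ} (p : Fin (n + 2)) (z : TopSimplex (SimplexCategory.mk n)) :
    TopSimplex.map (SimplexCategory.δ p) z ∈ TopBoundary (SimplexCategory.mk (n + 1)) :=
  ⟨p, TopSimplex.map_apply_of_notMem z (by
    rintro ⟨q, hq⟩
    exact Fin.succAbove_ne p q hq)⟩

theorem SimplexCategory.δ_apply_injective {n : ℕ} (p : Fin (n + 2)) :
    Function.Injective (SimplexCategory.δ p : SimplexCategory.mk n ⟶ _) :=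
  Fin.succAbove_right_injective

/-- A point whose p-th coordinate vanishes lies in the face opposite to p. -/
theorem TopBoundary.exists_δ {n : ℕ} {z : TopSimplex (SimplexCategory.mk (n + 1))}
    (hz : z ∈ TopBoundary _) :
    ∃ (p : Fin (n + 2)) (z₀ : TopSimplex (SimplexCategory.mk n)),
      TopSimplex.map (SimplexCategory.δ p) z₀ = z := by
  obtain ⟨p, hp⟩ := hz
  obtain ⟨z₀, hz₀, -⟩ := TopSimplex.exists_map_eq (z := z)
    (SimplexCategory.δ_apply_injective p) (fun q hq => by
      by_cases hqp : q = p
      · rw [hqp, hp]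
      · obtain ⟨r, hr⟩ := Fin.exists_succAbove_eq hqp
        exact absurd ⟨r, hr⟩ hq)
  exact ⟨p, z₀, hz₀⟩

/-- Compatible maps on the faces of a simplex glue to a map on its boundary. -/
theorem exists_glue_boundary {T Y : Type*} [TopologicalSpace T] [TopologicalSpace Y]
    [CompactSpace T] [T2Space T] {n : ℕ}
    (y : Fin (n + 2) → C(T × TopSimplex (SimplexCategory.mk n), Y))
    (hy : ∀ (p q : Fin (n + 2)) (l : SimplexCategory) (η η' : l ⟶ SimplexCategory.mk n),
      η ≫ SimplexCategory.δ p = η' ≫ SimplexCategory.δ q →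
      ∀ t z, y p (t, TopSimplex.map η z) = y q (t, TopSimplex.map η' z)) :
    ∃ r : C(T × TopBoundary (SimplexCategory.mk (n + 1)), Y), ∀ p t z,
      r (t, ⟨TopSimplex.map (SimplexCategory.δ p) z, TopSimplex.map_δ_mem p z⟩) = y p (t, z) := by
  let P : (Σ _ : Fin (n + 2), T × TopSimplex (SimplexCategory.mk n)) →
      T × TopBoundary (SimplexCategory.mk (n + 1)) := fun d =>
    (d.2.1, ⟨TopSimplex.map (SimplexCategory.δ d.1) d.2.2, TopSimplex.map_δ_mem d.1 d.2.2⟩)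
  have hP : Continuous P := continuous_sigma fun p => by
    have h1 : Continuous fun z : TopSimplex (SimplexCategory.mk n) =>
        (⟨TopSimplex.map (SimplexCategory.δ p) z, TopSimplex.map_δ_mem p z⟩ :
          TopBoundary (SimplexCategory.mk (n + 1))) :=
      Continuous.subtype_mk (TopSimplex.continuous_map (SimplexCategory.δ p)) _
    exact continuous_fst.prodMk (h1.comp continuous_snd)
  have hsurj : Function.Surjective P := by
    rintro ⟨t, z, hz⟩
    obtain ⟨p, z₀, hz₀⟩ := TopBoundary.exists_δ hz
    exact ⟨⟨p, t, z₀⟩, Prod.ext rfl (Subtype.ext hz₀)⟩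
  -- A continuous surjection from a compact space to a Hausdorff space is closed, hence a quotient
  -- map. What remains is to see that the given maps are constant on its fibers, where
  -- `TopSimplex.exists_common` enters.
  have hq : Topology.IsQuotientMap P := hP.isClosedMap.isQuotientMap hP hsurj
  let Q : C(Σ _ : Fin (n + 2), T × TopSimplex (SimplexCategory.mk n), Y) :=
    ⟨fun d => y d.1 d.2, continuous_sigma fun p => (y p).continuous⟩
  have hf : Function.FactorsThrough Q (⟨P, hP⟩ : C(_, _)) := by
    rintro ⟨p, t, z⟩ ⟨p', t', z'⟩ h
    have ht : t = t' := congrArg Prod.fst h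
    have hz : TopSimplex.map (SimplexCategory.δ p) z = TopSimplex.map (SimplexCategory.δ p') z' :=
      congrArg (fun d => d.2.1) h
    obtain ⟨l, η, η', z₀, h1, h2, h3⟩ := TopSimplex.exists_common
      (SimplexCategory.δ_apply_injective p) (SimplexCategory.δ_apply_injective p') hz
    rw [← ht, ← h2, ← h3]
    exact hy p p' l η η' h1 t z₀
  obtain ⟨r, hr⟩ : ∃ r : C(T × TopBoundary (SimplexCategory.mk (n + 1)), Y),
      r.comp ⟨P, hP⟩ = Q := ⟨hq.lift (f := ⟨P, hP⟩) Q hf, hq.lift_comp (f := ⟨P, hP⟩) Q hf⟩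
  exact ⟨r, fun p t z => congrArg (fun f => f ⟨p, t, z⟩) hr⟩

end Boundary

/-! ### Extension of families of morphisms -/

section Extension

variable {G : Type w} [Group G] {I : Type u} [SmallCategory I] {a : CatAction G I}

/-- The face of a parametrized singular simplex. -/
noncomputable def faceMap {T Y : Type*} [TopologicalSpace T] [TopologicalSpace Y]
    {k m : SimplexCategory}
    (θ : k ⟶ m) (y : C(T × TopSimplex m, Y)) : C(T × TopSimplex k, Y) :=
  ⟨fun p => y (p.1, TopSimplex.map θ p.2), y.continuous.comp
    (continuous_fst.prodMk ((TopSimplex.continuous_map θ).comp continuous_snd))⟩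

theorem faceMap_comp {T Y : Type*} [TopologicalSpace T] [TopologicalSpace Y]
    {l k m : SimplexCategory} (η : l ⟶ k) (θ : k ⟶ m) (y : C(T × TopSimplex m, Y)) :
    faceMap (η ≫ θ) y = faceMap η (faceMap θ y) := by
  refine ContinuousMap.ext fun p => ?_
  change y (p.1, TopSimplex.map (η ≫ θ) p.2) = y (p.1, TopSimplex.map θ (TopSimplex.map η p.2))
  rw [TopSimplex.map_map]

/-- The face of a simplex of `N(I/i)`. -/
abbrev OverChain.face {i : I} {k m : SimplexCategory} (θ : k ⟶ m) (w : OverChain i m) :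
    OverChain i k := (nerve (CostructuredArrow (𝟭 I) i)).map θ.op w

theorem OverChain.face_comp {i : I} {l k m : SimplexCategory} (η : l ⟶ k) (θ : k ⟶ m)
    (w : OverChain i m) : w.face (η ≫ θ) = (w.face θ).face η := rfl

/-- A degeneracy determines the simplex it degenerates: pull back along a section. -/
theorem OverChain.face_of_section {i : I} {k m : SimplexCategory} {s : k ⟶ m} {θ : m ⟶ k}
    (h : s ≫ θ = 𝟙 k) (w : OverChain i k) : (w.face θ).face s = w := by
  rw [← OverChain.face_comp, h]
  rfl

/-- The value of a point of `holim X` on a simplex of `N(I/i)`. -/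
noncomputable def FixedHom.onSimplex {X : GDiagram a} (f : FixedHolim X) {i : I}
    {m : SimplexCategory} (w : OverChain i m) (z : TopSimplex m) : X.toFunctor.obj i :=
  f.1.app i (SSet.charMap w z)

theorem FixedHom.onSimplex_face {X : GDiagram a} (f : FixedHolim X) {i : I}
    {k m : SimplexCategory} (θ : k ⟶ m) (w : OverChain i m) (z : TopSimplex k) :
    f.onSimplex (w.face θ) z = f.onSimplex w (TopSimplex.map θ z) :=
  congrArg (f.1.app i) (SSet.charMap_map θ w z)

theorem FixedHom.onSimplex_push {X : GDiagram a} (f : FixedHolim X) {i j : I}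
    {m : SimplexCategory} (g : G) (α : (a.act g).obj i ⟶ j) (w : OverChain i m)
    (z : TopSimplex m) : f.onSimplex (w.push g α) z = X.push g α (f.onSimplex w z) :=
  (congrArg (f.1.app j) (charMap_push g α w z)).trans (f.push g α _)

theorem FixedHom.ext_onSimplex {X : GDiagram a} {f f' : FixedHolim X}
    (h : ∀ (i : I) (m : SimplexCategory) (w : OverChain i m) (z : TopSimplex m),
      f.onSimplex w z = f'.onSimplex w z) : f = f' :=
  Subtype.ext (GHom.ext fun i => SSet.toTop_hom_ext (h i))

theorem FixedHom.continuous_onSimplex {X : GDiagram a} {A : Type*} [TopologicalSpace A]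
    {f : A → FixedHolim X} (hf : Continuous f) {i : I} {m : SimplexCategory} (w : OverChain i m) :
    Continuous fun p : A × TopSimplex m => (f p.1).onSimplex w p.2 :=
  have h : Continuous fun s => (f s).1 := continuous_subtype_val.comp hf
  SSet.continuous_charMap_of_continuous ((HomSpace.continuous_comp (K := (overI a).toFunctor)
    (X := X.toFunctor) i).comp h) w

namespace GDiagram

variable (X : GDiagram a) {T : Type} [TopologicalSpace T]

/-- The action of `push` on parametrized singular simplices. -/
def pushMap (g : G) {i j : I} (α : (a.act g).obj i ⟶ j) {m : SimplexCategory}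
    (y : C(T × TopSimplex m, X.toFunctor.obj i)) : C(T × TopSimplex m, X.toFunctor.obj j) :=
  (X.push g α).hom.comp y

theorem pushMap_pushMap (g h : G) {i j k : I} (α : (a.act g).obj i ⟶ j)
    (β : (a.act h).obj j ⟶ k) {m : SimplexCategory}
    (y : C(T × TopSimplex m, X.toFunctor.obj i)) :
    X.pushMap h β (X.pushMap g α y) =
      X.pushMap (h * g) (eqToHom (a.mul_obj h g i) ≫ (a.act h).map α ≫ β) y := by
  ext p
  exact ConcreteCategory.congr_hom (X.push_push g h α β) (y p)

variable (T) in
/-- A simplex of `N(I/i)` with a parametrized singular simplex of `X i`. -/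
abbrev Datum : Type u :=
  Σ (i : I) (m : SimplexCategory), OverChain i m × C(T × TopSimplex m, X.toFunctor.obj i)

variable {X} {A : Type} [TopologicalSpace A]

/-- Partial extensions of a family of morphisms `f` along `j : A → T`. -/
structure IsPartial (j : C(A, T)) (f : A → FixedHolim X) (R : Set (X.Datum T)) : Prop where
  push {i m w y} (h : ⟨i, m, w, y⟩ ∈ R) (g : G) {i' : I} (α : (a.act g).obj i ⟶ i') :
    (⟨i', m, w.push g α, X.pushMap g α y⟩ : X.Datum T) ∈ R
  face {i m w y} (h : ⟨i, m, w, y⟩ ∈ R) {k : SimplexCategory} (θ : k ⟶ m) :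
    (⟨i, k, w.face θ, faceMap θ y⟩ : X.Datum T) ∈ R
  unique {i m w y y'} (h : ⟨i, m, w, y⟩ ∈ R) (h' : ⟨i, m, w, y'⟩ ∈ R) : y = y'
  compat {i m w y} (h : ⟨i, m, w, y⟩ ∈ R) (s : A) (z : TopSimplex m) :
    y (j s, z) = (f s).onSimplex w z
  -- Whether a simplex is in the domain of R depends only on the G-orbit of its chain, neither on i
  -- nor on the structure map. A missing simplex may therefore be replaced by its chain over its own
  -- last vertex.
  saturated {i m w y} (h : ⟨i, m, w, y⟩ ∈ R) (g : G) {i' : I} (w' : OverChain i' m)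
    (h' : w'.chain = w.chain.act a g) : ∃ y', (⟨i', m, w', y'⟩ : X.Datum T) ∈ R

variable {j : C(A, T)} {f : A → FixedHolim X}

/-- Upper bounds for Zorn's lemma. Only uniqueness involves two elements of R, and these lie in a
common member of the chain. -/
theorem IsPartial.sUnion {c : Set (Set (X.Datum T))} (hc : ∀ R ∈ c, IsPartial j f R)
    (hch : IsChain (· ⊆ ·) c) : IsPartial j f (⋃₀ c) where
  push := by
    rintro i m w y ⟨R, hR, h⟩ g i' α
    exact ⟨R, hR, (hc R hR).push h g α⟩
  face := by
    rintro i m w y ⟨R, hR, h⟩ k θ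
    exact ⟨R, hR, (hc R hR).face h θ⟩
  unique := by
    rintro i m w y y' ⟨R, hR, h⟩ ⟨R', hR', h'⟩
    rcases hch.total hR hR' with hs | hs
    · exact (hc R' hR').unique (hs h) h'
    · exact (hc R hR).unique h (hs h')
  compat := by
    rintro i m w y ⟨R, hR, h⟩
    exact (hc R hR).compat h
  saturated := by
    rintro i m w y ⟨R, hR, h⟩ g i' w' h'
    obtain ⟨y', hy'⟩ := (hc R hR).saturated h g w' h'
    exact ⟨y', R, hR, hy'⟩

/-- The extension property for a pair of spaces `A → T` times a simplex and its boundary. -/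
def CellExtension (j : C(A, T)) (m : SimplexCategory) (Y : Type*) [TopologicalSpace Y] : Prop :=
  ∀ (v : C(A × TopSimplex m, Y)) (r : C(T × TopBoundary m, Y)),
    (∀ s (z : TopBoundary m), v (s, z) = r (j s, z)) →
    ∃ y : C(T × TopSimplex m, Y), (∀ s z, y (j s, z) = v (s, z)) ∧
      ∀ t (z : TopBoundary m), y (t, z) = r (t, z)

/-- The simplex σ over its own last vertex is universal: pushing it forward produces every simplex
whose chain is a translate of σ. -/
theorem _root_.OverChain.push_over_one {m : SimplexCategory} (σ : Chain I m) (g : G) {i : I}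
    (α : (a.act g).obj σ.last ⟶ i) :
    (σ.over (𝟙 σ.last)).push g α = (σ.act a g).over α := by
  refine OverChain.ext rfl fun e => ?_
  refine (Category.id_comp _).trans ((Chain.over_hom (σ.act a g) α).trans ?_)
  rw [OverChain.push_hom, Chain.over_hom]
  exact ((congrArg (· ≫ α) ((a.act g).map_id σ.last)).trans (Category.id_comp α)).symm

/-- The stabilizer of σ fixes the universal simplex, which is why values on it must be fixed points
for that stabilizer. -/
theorem _root_.OverChain.push_over_eq {m : SimplexCategory} {σ : Chain I m} {g : G}
    (h : σ.act a g = σ) (e : (a.act g).obj σ.last = σ.last) :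
    (σ.over (𝟙 σ.last)).push g (eqToHom e) = σ.over (𝟙 σ.last) := by
  rw [OverChain.push_over_one]
  refine (Chain.over_congr h _).trans (congrArg (fun γ => σ.over γ) ?_)
  exact eqToHom_trans _ _

theorem _root_.Chain.act_mem_nonDegenerate {n : ℕ} {σ : Chain I (SimplexCategory.mk n)}
    (h : σ ∈ (nerve I).nonDegenerate n) (g : G) : σ.act a g ∈ (nerve I).nonDegenerate n := by
  intro h'
  apply h
  obtain ⟨k, hk, θ, τ, hτ⟩ := h'
  refine ⟨k, hk, θ, Chain.act a g⁻¹ τ, ?_⟩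
  rw [← Chain.map_act, hτ, Chain.act_inv_act]

/-- A surjective monotone map sends the last vertex to the last vertex. -/
theorem _root_.Chain.exists_lastMap_eq {k m : SimplexCategory} (σ : Chain I m) (θ : k ⟶ m)
    [Epi θ] : ∃ e, σ.lastMap θ = eqToHom e := by
  have h : θ (Fin.last k.len) = Fin.last m.len := by
    obtain ⟨p, hp⟩ := SimplexCategory.epi_iff_surjective.1 ‹Epi θ› (Fin.last m.len)
    exact le_antisymm (Fin.le_last _) (hp ▸ θ.toOrderHom.monotone (Fin.le_last p))
  have key : ∀ (p q : Fin (m.len + 1)) (f : p ⟶ q) (_ : p = q),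
      ∃ e, CategoryTheory.Functor.map (C := Fin (m.len + 1)) σ f = eqToHom e := by
    rintro p _ f rfl
    exact ⟨rfl, CategoryTheory.Functor.map_id (C := Fin (m.len + 1)) σ p⟩
  exact key _ _ _ h

theorem eqToHom_trans_assoc_self {i j k : I} (e : i = j) (f : i ⟶ k) :
    eqToHom e ≫ eqToHom e.symm ≫ f = f := by
  subst e
  simp

/-- A degeneracy keeps the last vertex, so the structure map of w can serve, up to transport, as the
structure map β before degenerating. -/
theorem _root_.OverChain.exists_push_face {k m : SimplexCategory} {σ : Chain I m} {θ : k ⟶ m}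
    [Epi θ] {g : G} {i : I} {w : OverChain i k} (h : w.chain = (nerve I).map θ.op (σ.act a g)) :
    ∃ β : (a.act g).obj σ.last ⟶ i, w = ((σ.over (𝟙 σ.last)).push g β).face θ := by
  obtain ⟨e, he⟩ := Chain.exists_lastMap_eq (σ.act a g) θ
  refine ⟨eqToHom e.symm ≫ eqToHom (congrArg Chain.last h.symm) ≫ w.hom, ?_⟩
  rw [OverChain.push_over_one, OverChain.face]
  refine Eq.trans ?_ (Chain.map_over (σ.act a g) θ _).symm
  refine (OverChain.eq_over w).trans ((Chain.over_congr h _).trans ?_)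
  congr 1
  rw [he]
  exact (eqToHom_trans_assoc_self e _).symm

/-- Values on the generated cell are well defined. Two descriptions of one simplex differ by an
element h of the stabilizer of σ; the structure maps then correspond, and y is fixed by h. -/
theorem pushMap_congr_of_push_eq {X : GDiagram a} {m : SimplexCategory} {σ : Chain I m}
    {y : C(T × TopSimplex m, X.toFunctor.obj σ.last)} {h : G} (hσ : σ.act a h = σ)
    (e : (a.act h).obj σ.last = σ.last) (hy : X.pushMap h (eqToHom e) y = y) {g g' : G}
    (hg : g' * h = g) {i : I} {α : (a.act g).obj σ.last ⟶ i} {α' : (a.act g').obj σ.last ⟶ i}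
    (hx : (σ.over (𝟙 σ.last)).push g α = (σ.over (𝟙 σ.last)).push g' α') :
    X.pushMap g α y = X.pushMap g' α' y := by
  subst hg
  have h1 := OverChain.push_push _ _ (eqToHom e) α' (σ.over (𝟙 σ.last))
  have h2 := X.pushMap_pushMap _ _ (eqToHom e) α' y
  rw [OverChain.push_over_eq hσ e] at h1
  rw [hy] at h2
  rw [h1, OverChain.push_over_one, OverChain.push_over_one] at hx
  rw [h2, Chain.over_injective hx]

/-- The data generated by a simplex and a singular simplex. -/
def GeneratedBy (X : GDiagram a) {i₀ : I} {m₀ : SimplexCategory} (x : OverChain i₀ m₀)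
    (y : C(T × TopSimplex m₀, X.toFunctor.obj i₀)) (i : I) (m : SimplexCategory)
    (w : OverChain i m) (y' : C(T × TopSimplex m, X.toFunctor.obj i)) : Prop :=
  ∃ (g : G) (α : (a.act g).obj i₀ ⟶ i) (θ : m ⟶ m₀), Epi θ ∧
    w = (x.push g α).face θ ∧ y' = faceMap θ (X.pushMap g α y)

/-- A partial extension can be enlarged by a new simplex. -/
theorem IsPartial.union {R : Set (X.Datum T)} (hR : IsPartial j f R) {n : ℕ}
    {σ : Chain I (SimplexCategory.mk n)} (hσ : σ ∈ (nerve I).nonDegenerate n)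
    (hnot : ∀ y, ⟨_, _, σ.over (𝟙 σ.last), y⟩ ∉ R)
    {y : C(T × TopSimplex (SimplexCategory.mk n), X.toFunctor.obj σ.last)}
    (hcompat : ∀ s z, y (j s, z) = (f s).onSimplex (σ.over (𝟙 σ.last)) z)
    (hface : ∀ {k : SimplexCategory} (θ : k ⟶ SimplexCategory.mk n), ¬ Epi θ →
      (⟨_, k, (σ.over (𝟙 σ.last)).face θ, faceMap θ y⟩ : X.Datum T) ∈ R)
    (hfix : ∀ (g : G) (_ : σ.act a g = σ) (e : (a.act g).obj σ.last = σ.last),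
      X.pushMap g (eqToHom e) y = y) :
    IsPartial j f (R ∪ {d | GeneratedBy X (σ.over (𝟙 σ.last)) y d.1 d.2.1 d.2.2.1 d.2.2.2}) := by
  -- If R had a value on a degeneracy of a translate of σ, a section of the degeneracy and
  -- saturation would give it a value on σ itself.
  have hdisj : ∀ {i m w y' y''}, ⟨i, m, w, y'⟩ ∈ R →
      GeneratedBy X (σ.over (𝟙 σ.last)) y i m w y'' → False := by
    rintro i m w y' y'' h ⟨g, α, θ, hθ, hw, -⟩
    subst hw
    obtain ⟨⟨s, hs⟩⟩ := isSplitEpi_of_epi θ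
    have h1 := hR.face h s
    rw [OverChain.face_of_section hs] at h1
    obtain ⟨y', hy'⟩ := hR.saturated h1 g⁻¹ (σ.over (𝟙 σ.last)) (by
      rw [OverChain.push_chain, Chain.over_chain, Chain.act_inv_act])
    exact hnot _ hy'
  refine ⟨?_, ?_, ?_, ?_, ?_⟩
  · rintro i m w y' (h | h) g i' α
    · exact Or.inl (hR.push h g α)
    · obtain ⟨g', α', θ, hθ, hw, hy⟩ : GeneratedBy X _ y i m w y' := h
      subst hw hy
      refine Or.inr ⟨g * g', eqToHom (a.mul_obj g g' σ.last) ≫ (a.act g).map α' ≫ α, θ, hθ, ?_, ?_⟩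
      · rw [← OverChain.push_push]
        rfl
      · rw [← pushMap_pushMap]
        rfl
  · rintro i m w y' (h | h) k η
    · exact Or.inl (hR.face h η)
    · obtain ⟨g', α', θ, hθ, hw, hy⟩ : GeneratedBy X _ y i m w y' := h
      subst hw hy
      -- Either the result is again a degeneracy of the new cell, or it comes from a proper face of
      -- σ, on which R is already defined.
      by_cases he : Epi (η ≫ θ)
      · exact Or.inr ⟨g', α', η ≫ θ, he, rfl, (faceMap_comp _ _ _).symm⟩
      · refine Or.inl ?_
        have := hR.push (hface _ he) g' α'
        rw [← faceMap_comp]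
        exact this
  · rintro i m w y₁ y₂ (h | h) (h' | h')
    · exact hR.unique h h'
    · exact (hdisj h h').elim
    · exact (hdisj h' h).elim
    · obtain ⟨g, α, θ, hθ, hw, hy⟩ : GeneratedBy X _ y i m w y₁ := h
      obtain ⟨g', α', θ', hθ', hw', hy'⟩ : GeneratedBy X _ y i m w y₂ := h'
      subst hw hy hy'
      have hchain : (nerve I).map θ.op (σ.act a g) = (nerve I).map θ'.op (σ.act a g') :=
        congrArg OverChain.chain hw'
      -- By the Eilenberg-Zilber lemma the nondegenerate chain and the degeneracy are unique, so g
      -- and g' differ by an element of the stabilizer of σ.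
      have hsim : (σ.act a g) = (σ.act a g') := congrArg Subtype.val
        ((nerve I).unique_nonDegenerate_simplex (n := m.len) _ θ
          ⟨_, Chain.act_mem_nonDegenerate hσ g⟩ rfl θ' ⟨_,
              Chain.act_mem_nonDegenerate hσ g'⟩ hchain)
      have hmap : θ = θ' := (nerve I).unique_nonDegenerate_map (n := m.len) _ θ
          ⟨_, Chain.act_mem_nonDegenerate hσ g⟩ rfl θ' ⟨_, Chain.act_mem_nonDegenerate hσ g'⟩ hchain
      subst hmap
      obtain ⟨⟨s, hs⟩⟩ := isSplitEpi_of_epi θ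
      have hx := congrArg (OverChain.face s) hw'
      rw [OverChain.face_of_section hs, OverChain.face_of_section hs] at hx
      congr 1
      have hfix' : σ.act a (g'⁻¹ * g) = σ := by
        rw [Chain.act_mul, hsim, Chain.act_inv_act]
      have e : (a.act (g'⁻¹ * g)).obj σ.last = σ.last := congrArg Chain.last hfix'
      have hg : g' * (g'⁻¹ * g) = g := by group
      rw [pushMap_congr_of_push_eq hfix' e (hfix _ hfix' e) hg hx]
  · rintro i m w y' (h | h) s z
    · exact hR.compat h s z
    · obtain ⟨g, α, θ, hθ, hw, hy⟩ : GeneratedBy X _ y i m w y' := h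
      subst hw hy
      change X.push g α (y (j s, TopSimplex.map θ z)) = _
      rw [hcompat, FixedHom.onSimplex_face, FixedHom.onSimplex_push]
  · rintro i m w y' (h | h) g i' w' hw'
    · obtain ⟨y'', hy''⟩ := hR.saturated h g w' hw'
      exact ⟨y'', Or.inl hy''⟩
    · obtain ⟨g', α', θ, hθ, hw, hy⟩ : GeneratedBy X _ y i m w y' := h
      subst hw hy
      obtain ⟨β, hβ⟩ := OverChain.exists_push_face (g := g * g') (σ := σ) (θ := θ) (w := w') (by
        rw [hw', Chain.act_mul]
        rfl)
      exact ⟨faceMap θ (X.pushMap (g * g') β y), Or.inr ⟨g * g', β, θ, hθ, hβ, rfl⟩⟩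

end GDiagram

end Extension

/-! ### Adding a cell, and the existence of total extensions -/

section Extension

variable {G : Type w} [Group G] {I : Type u} [SmallCategory I] {a : CatAction G I}

/-- The stabilizer of a chain. -/
def Chain.stabilizer {m : SimplexCategory} (a : CatAction G I) (σ : Chain I m) : Subgroup G where
  carrier := {g | σ.act a g = σ}
  one_mem' := σ.act_one
  mul_mem' {g h} hg hh := by
    change σ.act a (g * h) = σ
    rw [Chain.act_mul, show σ.act a h = σ from hh]
    exact hg
  inv_mem' {g} hg := by
    change σ.act a g⁻¹ = σ
    conv_lhs => rw [← show σ.act a g = σ from hg]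
    exact σ.act_inv_act g

theorem Chain.stabilizer_le {m : SimplexCategory} (σ : Chain I m) :
    σ.stabilizer a ≤ a.stabilizer σ.last := fun _ hg => congrArg Chain.last hg

theorem faceMap_id {T Y : Type*} [TopologicalSpace T] [TopologicalSpace Y] {m : SimplexCategory}
    (y : C(T × TopSimplex m, Y)) : faceMap (𝟙 m) y = y := by
  refine ContinuousMap.ext fun p => congrArg (fun z => y (p.1, z)) ?_
  exact stdSimplex.map_id_apply p.2

theorem TopBoundary.isEmpty_zero : IsEmpty (TopBoundary (SimplexCategory.mk 0)) := by
  refine ⟨fun ⟨z, p, hp⟩ => ?_⟩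
  have h := stdSimplex.sum_eq_one z
  rw [Fintype.sum_eq_single p (fun q hq => absurd (Subsingleton.elim (α := Fin 1) q p) hq), hp] at h
  exact zero_ne_one h

theorem SimplexCategory.epi_to_zero {k : SimplexCategory} (θ : k ⟶ SimplexCategory.mk 0) :
    Epi θ :=
  SimplexCategory.epi_iff_surjective.2 fun _ => ⟨0, Subsingleton.elim (α := Fin 1) _ _⟩

namespace GDiagram

variable {X : GDiagram a} {T : Type} [TopologicalSpace T] {A : Type} [TopologicalSpace A]
  {j : C(A, T)} {f : A → FixedHolim X}

/-- The stabilizer of σ fixes every face of the universal simplex, so single-valuedness of R forces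
the values there to be fixed. This places the boundary data in the fixed space. -/
theorem IsPartial.pushMap_eq {R : Set (X.Datum T)} (hR : IsPartial j f R) {m k : SimplexCategory}
    {σ : Chain I m} {θ : k ⟶ m} {y : C(T × TopSimplex k, X.toFunctor.obj σ.last)}
    (hy : ⟨_, k, (σ.over (𝟙 σ.last)).face θ, y⟩ ∈ R) {g : G} (hg : σ.act a g = σ)
    (e : (a.act g).obj σ.last = σ.last) : X.pushMap g (eqToHom e) y = y := by
  have h := hR.push hy g (eqToHom e)
  rw [OverChain.face, OverChain.map_push, OverChain.push_over_eq hg e] at h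
  exact hR.unique h hy

/-- The extension of a partial extension to a new simplex. -/
theorem IsPartial.exists_cell [CompactSpace T] [T2Space T] {R : Set (X.Datum T)}
    (hR : IsPartial j f R) (hf : Continuous f) {n : ℕ} {σ : Chain I (SimplexCategory.mk n)}
    (hlow : ∀ (i : I) (k : SimplexCategory), k.len < n → ∀ w : OverChain i k,
      ∃ y, (⟨i, k, w, y⟩ : X.Datum T) ∈ R)
    (hcell : CellExtension j (SimplexCategory.mk n) (X.FixedSpace (σ.stabilizer_le (a := a)))) :
    ∃ y : C(T × TopSimplex (SimplexCategory.mk n), X.toFunctor.obj σ.last),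
      (∀ s z, y (j s, z) = (f s).onSimplex (σ.over (𝟙 σ.last)) z) ∧
      (∀ {k : SimplexCategory} (θ : k ⟶ SimplexCategory.mk n), ¬ Epi θ →
        (⟨_, k, (σ.over (𝟙 σ.last)).face θ, faceMap θ y⟩ : X.Datum T) ∈ R) ∧
      (∀ (g : G) (_ : σ.act a g = σ) (e : (a.act g).obj σ.last = σ.last),
        X.pushMap g (eqToHom e) y = y) := by
  have hmem : ∀ s z, ∀ g (hg : g ∈ σ.stabilizer a), X.tr g (σ.stabilizer_le hg)
      ((f s).onSimplex (σ.over (𝟙 σ.last)) z) = (f s).onSimplex (σ.over (𝟙 σ.last)) z := by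
    intro s z g hg
    have e : (a.act g).obj σ.last = σ.last := σ.stabilizer_le hg
    exact ((f s).onSimplex_push g (eqToHom e) _ z).symm.trans
      (congrArg (fun w => (f s).onSimplex w z) (OverChain.push_over_eq hg e))
  let v : C(A × TopSimplex (SimplexCategory.mk n), X.FixedSpace (σ.stabilizer_le (a := a))) :=
    ⟨fun p => ⟨(f p.1).onSimplex (σ.over (𝟙 σ.last)) p.2, hmem p.1 p.2⟩,
      (FixedHom.continuous_onSimplex hf _).subtype_mk _⟩
  -- It suffices to find boundary values r in the fixed space, compatible with f, such that every
  -- filling of r has all its proper faces in R; the cell condition then supplies a filling.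
  suffices h : ∃ r : C(T × TopBoundary (SimplexCategory.mk n),
      X.FixedSpace (σ.stabilizer_le (a := a))),
      (∀ s (z : TopBoundary (SimplexCategory.mk n)), v (s, z) = r (j s, z)) ∧
      ∀ y : C(T × TopSimplex (SimplexCategory.mk n), X.toFunctor.obj σ.last),
        (∀ t (z : TopBoundary (SimplexCategory.mk n)), y (t, z) = (r (t, z)).1) →
        ∀ {k : SimplexCategory} (θ : k ⟶ SimplexCategory.mk n), ¬ Epi θ →
          (⟨_, k, (σ.over (𝟙 σ.last)).face θ, faceMap θ y⟩ : X.Datum T) ∈ R by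
    obtain ⟨r, hvr, hr⟩ := h
    obtain ⟨y, hy, hy'⟩ := hcell v r hvr
    refine ⟨⟨fun p => (y p).1, continuous_subtype_val.comp y.continuous⟩, ?_, ?_, ?_⟩
    · exact fun s z => congrArg Subtype.val (hy s z)
    · exact hr _ fun t z => congrArg Subtype.val (hy' t z)
    · intro g hg e
      ext p
      exact (y p).2 g hg
  rcases n with _ | n
  -- A 0-simplex has empty boundary, and every operator to it is surjective.
  · have := TopBoundary.isEmpty_zero
    exact ⟨⟨fun p => isEmptyElim p.2, continuous_of_const fun p => isEmptyElim p.2⟩,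
      fun s z => isEmptyElim z, fun y _ k θ hθ => absurd (SimplexCategory.epi_to_zero θ) hθ⟩
  choose y hy using fun p : Fin (n + 2) => hlow σ.last (SimplexCategory.mk n) (Nat.lt_succ_self n)
    ((σ.over (𝟙 σ.last)).face (SimplexCategory.δ p))
  have hyfix : ∀ p q, ∀ g (hg : g ∈ σ.stabilizer a), X.tr g (σ.stabilizer_le hg) (y p q) = y p q :=
    fun p q g hg => congrArg (fun f => f q) (hR.pushMap_eq (hy p) hg (σ.stabilizer_le hg))
  -- The values of R on the codimension-one faces agree on common faces because R is closed under
  -- faces and single-valued.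
  obtain ⟨r, hr⟩ := exists_glue_boundary (T := T)
    (fun p => (⟨fun q => ⟨y p q, hyfix p q⟩, (y p).continuous.subtype_mk _⟩ :
      C(T × TopSimplex (SimplexCategory.mk n), X.FixedSpace (σ.stabilizer_le (a := a)))))
    (fun p q l η η' h t z => by
      apply Subtype.ext
      have h1 := hR.face (hy p) η
      have h2 := hR.face (hy q) η'
      rw [← OverChain.face_comp] at h1 h2
      rw [h] at h1
      exact congrArg (fun f => f (t, z)) (hR.unique h1 h2))
  refine ⟨r, fun s z => ?_, fun y' hy' k θ hθ => ?_⟩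
  · obtain ⟨z, hz⟩ := z
    obtain ⟨p, z, rfl⟩ := TopBoundary.exists_δ hz
    rw [hr]
    apply Subtype.ext
    change (f s).onSimplex _ (TopSimplex.map _ z) = y p (j s, z)
    rw [hR.compat (hy p), FixedHom.onSimplex_face]
  -- A non-surjective operator factors through some coface, where y' has the values chosen in R.
  · obtain ⟨p, θ', rfl⟩ := SimplexCategory.eq_comp_δ_of_not_surjective θ
      (fun h => hθ (SimplexCategory.epi_iff_surjective.2 h))
    have h : faceMap (SimplexCategory.δ p) y' = y p := by
      ext ⟨t, z⟩
      exact (hy' t ⟨_, TopSimplex.map_δ_mem p z⟩).trans (congrArg Subtype.val (hr p t z))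
    rw [faceMap_comp, h, OverChain.face_comp]
    exact hR.face (hy p) θ'

/-- A partial extension that is defined on the chains fixed by `G` extends to all simplices. -/
theorem IsPartial.exists_total [CompactSpace T] [T2Space T] {R₀ : Set (X.Datum T)}
    (h₀ : IsPartial j f R₀) (hf : Continuous f)
    (hbase : ∀ (m : SimplexCategory) (σ : Chain (FixedCat a ⊤) m),
      ∃ y, (⟨_, m, σ.incl.over (𝟙 σ.incl.last), y⟩ : X.Datum T) ∈ R₀)
    (hcell : ∀ (n : ℕ) (σ : Chain I (SimplexCategory.mk n)), σ ∈ (nerve I).nonDegenerate n →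
      σ.stabilizer a ≠ ⊤ →
      CellExtension j (SimplexCategory.mk n) (X.FixedSpace (σ.stabilizer_le (a := a)))) :
    ∃ R, IsPartial j f R ∧ R₀ ⊆ R ∧ ∀ (i : I) (m : SimplexCategory) (w : OverChain i m),
      ∃ y, (⟨i, m, w, y⟩ : X.Datum T) ∈ R := by
  obtain ⟨R, hR₀, hmax⟩ := zorn_subset_nonempty {R : Set (X.Datum T) | IsPartial j f R}
    (fun c hc hch _ => ⟨⋃₀ c, IsPartial.sUnion hc hch, fun s hs => Set.subset_sUnion_of_mem hs⟩)
    R₀ h₀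
  have hR : IsPartial j f R := hmax.prop
  refine ⟨R, hR, hR₀, ?_⟩
  suffices h : ∀ (n : ℕ) (i : I) (w : OverChain i (SimplexCategory.mk n)),
      ∃ y, (⟨i, _, w, y⟩ : X.Datum T) ∈ R from fun i m => h m.len i
  intro n
  induction n using Nat.strong_induction_on with
  | _ n ih =>
  intro i w
  by_contra hw
  -- Saturation with g = 1 carries a value on the universal simplex to any simplex with the same
  -- chain.
  have hnot : ∀ y, ⟨_, _, w.chain.over (𝟙 w.chain.last), y⟩ ∉ R := fun y hy =>
    hw (hR.saturated hy 1 w (Chain.act_one _).symm)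
  -- A degenerate chain would receive a value from a simplex of lower dimension.
  have hσ : w.chain ∈ (nerve I).nonDegenerate n := by
    rintro ⟨k, hk, θ, τ, hτ⟩
    obtain ⟨y, hy⟩ := ih k hk _ (Chain.over (m := SimplexCategory.mk k) τ (𝟙 _))
    exact hw (hR.saturated (hR.face hy θ) 1 w (hτ.symm.trans (Chain.act_one _).symm))
  -- A chain fixed by all of G lies in I^G, where R₀ is already defined.
  have hstab : w.chain.stabilizer a ≠ ⊤ := by
    intro h
    obtain ⟨σ₀, hσ₀⟩ := Chain.exists_fixed (H := ⊤) (σ := w.chain) fun g _ => by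
      have : g ∈ w.chain.stabilizer a := h ▸ Subgroup.mem_top g
      exact this
    obtain ⟨y, hy⟩ := hbase _ σ₀
    exact hw (hR.saturated (hR₀ hy) 1 w (hσ₀.symm.trans (Chain.act_one _).symm))
  obtain ⟨y, h1, h2, h3⟩ := hR.exists_cell hf (fun i k hk w => ih k.len hk i w)
    (hcell n w.chain hσ hstab)
  have hgen : GeneratedBy X (w.chain.over (𝟙 w.chain.last)) y _ _
      (w.chain.over (𝟙 w.chain.last)) y :=
    ⟨1, eqToHom (a.one_obj _), 𝟙 _, inferInstance,
      (OverChain.push_over_eq (Chain.act_one _) (a.one_obj _)).symm,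
      (h3 1 (Chain.act_one _) (a.one_obj _)).symm.trans (faceMap_id _).symm⟩
  -- The enlarged partial extension contains the new cell, so by maximality R does too.
  exact hnot y (hmax.le_of_ge (hR.union hσ hnot h1 h2 h3) Set.subset_union_left (Or.inr hgen))

end GDiagram

end Extension

/-! ### The data prescribed on chains of I^G, and the relative extension theorem -/

section BaseExtension

variable {G : Type w} [Group G] {I : Type u} [SmallCategory I] {a : CatAction G I}

theorem restriction_charMap {X : GDiagram a} (f : FixedHolim X) {m : SimplexCategory}
    (σ : Chain (FixedCat a ⊤) m) {i : FixedCat a ⊤} (γ : σ.last ⟶ i) (z : TopSimplex m) :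
    ((restriction X f).comp i (SSet.charMap (σ.over γ) z)).1 =
      f.onSimplex (σ.incl.over (i := i.obj) γ.1) z := by
  change f.1.app i.obj (BMap (fixedOver a i) (SSet.charMap (σ.over γ) z)) = _
  rw [BMap, SSet.toTop_map_charMap, fixedOver_over]
  rfl

theorem FixedHom.map_onSimplex_over {X : GDiagram a} (f : FixedHolim X) {m : SimplexCategory}
    (σ : Chain I m) {i i' : I} (γ : σ.last ⟶ i) (β : i ⟶ i') (z : TopSimplex m) :
    X.toFunctor.map β (f.onSimplex (σ.over γ) z) = f.onSimplex (σ.over (γ ≫ β)) z := by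
  rw [← Chain.map_over_app]
  refine (ConcreteCategory.congr_hom (f.1.naturality β) (SSet.charMap (σ.over γ) z)).symm.trans ?_
  exact congrArg (f.1.app i') (SSet.toTop_map_charMap _ _ _)

namespace GDiagram

variable {X : GDiagram a} {T : Type} [TopologicalSpace T]

theorem map_push (g : G) {i i' k k' : I} (γ : i ⟶ i') (α : (a.act g).obj i' ⟶ k)
    (e : (a.act g).obj i = k') :
    X.toFunctor.map γ ≫ X.push g α =
      X.tr g e ≫ X.toFunctor.map (eqToHom e.symm ≫ (a.act g).map γ ≫ α) := by
  subst e
  rw [push_eq_tr, reassoc_of% (X.map_tr g γ rfl rfl), ← CategoryTheory.Functor.map_comp]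
  simp

theorem FixedSpace.continuous_val {H : Subgroup G} {i : I} (hH : H ≤ a.stabilizer i) :
    Continuous fun x : X.FixedSpace hH => x.1 := continuous_subtype_val

/-- The value of a family of points of `holim X^G` on a chain of `I^G`. -/
noncomputable def baseMap (b : T → Holim (X.fixedDiagram ⊤)) (hb : Continuous b)
    {m : SimplexCategory} (σ : Chain (FixedCat a ⊤) m) :
    C(T × TopSimplex m, X.toFunctor.obj σ.incl.last) :=
  ⟨fun p => ((b p.1).comp σ.last (SSet.charMap (σ.over (𝟙 σ.last)) p.2)).1,
    (FixedSpace.continuous_val σ.last.le).comp (SSet.continuous_charMap_of_continuous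
      ((HomSpace.continuous_comp σ.last).comp hb) _)⟩

/-- The simplex (σ, γ) is the image of σ over its last vertex under γ, so naturality of b gives its
value. -/
theorem map_baseMap (b : T → Holim (X.fixedDiagram ⊤)) (hb : Continuous b) {m : SimplexCategory}
    (σ : Chain (FixedCat a ⊤) m) {i : FixedCat a ⊤} (γ : σ.last ⟶ i) (t : T) (z : TopSimplex m) :
    X.toFunctor.map γ.1 (baseMap b hb σ (t, z)) =
      ((b t).comp i (SSet.charMap (σ.over γ) z)).1 := by
  have h := Chain.map_over_app σ (𝟙 _) γ
  rw [Category.id_comp] at h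
  rw [← h]
  have h2 := ConcreteCategory.congr_hom (NatTrans.naturality (b t) γ)
    (SSet.charMap (σ.over (𝟙 σ.last)) z)
  refine (congrArg Subtype.val h2).symm.trans ?_
  exact congrArg (fun x => ((b t).comp i x).1) (SSet.toTop_map_charMap _ _ _)

theorem map_lastMap_baseMap (b : T → Holim (X.fixedDiagram ⊤)) (hb : Continuous b)
    {k m : SimplexCategory} (θ : k ⟶ m) (σ : Chain (FixedCat a ⊤) m) (t : T) (z : TopSimplex k) :
    X.toFunctor.map (σ.incl.lastMap θ)
      (baseMap b hb ((nerve (FixedCat a ⊤)).map θ.op σ) (t, z)) =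
        baseMap b hb σ (t, TopSimplex.map θ z) := by
  refine (map_baseMap b hb _ (σ.lastMap θ) t z).trans ?_
  have h := Chain.map_over σ θ (𝟙 _)
  rw [Category.comp_id] at h
  rw [← h, SSet.charMap_map]
  rfl

/-- The data on chains of `I^G` given by a family of points of `holim X^G`. -/
def baseData (b : T → Holim (X.fixedDiagram ⊤)) (hb : Continuous b) : Set (X.Datum T) :=
  {d | ∃ (σ : Chain (FixedCat a ⊤) d.2.1) (γ : σ.incl.last ⟶ d.1),
    d.2.2.1 = σ.incl.over γ ∧ d.2.2.2 = (X.toFunctor.map γ).hom.comp (baseMap b hb σ)}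

variable {A : Type} [TopologicalSpace A] {j : C(A, T)} {f : A → FixedHolim X}
  {b : T → Holim (X.fixedDiagram ⊤)}

theorem mem_baseData (hb : Continuous b) {m : SimplexCategory} (σ : Chain (FixedCat a ⊤) m) {i : I}
    (γ : σ.incl.last ⟶ i) :
    (⟨i, m, σ.incl.over γ, (X.toFunctor.map γ).hom.comp (baseMap b hb σ)⟩ : X.Datum T) ∈
      baseData b hb := ⟨σ, γ, rfl, rfl⟩

theorem exists_of_mem_baseData {hb : Continuous b} {i : I} {m : SimplexCategory}
    {w : OverChain i m} {y : C(T × TopSimplex m, X.toFunctor.obj i)}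
    (h : (⟨i, m, w, y⟩ : X.Datum T) ∈ baseData b hb) :
    ∃ (σ : Chain (FixedCat a ⊤) m) (γ : σ.incl.last ⟶ i),
      w = σ.incl.over γ ∧ y = (X.toFunctor.map γ).hom.comp (baseMap b hb σ) := h

/-- G acts trivially on chains of I^G and b has values in fixed points, so pushing forward only
alters the structure map. Uniqueness holds because I^G → I is injective on chains; compatibility
with f is `hfb`. -/
theorem isPartial_baseData (hb : Continuous b) (hfb : ∀ s, restriction X (f s) = b (j s)) :
    IsPartial j f (baseData b hb) := by
  refine ⟨?_, ?_, ?_, ?_, ?_⟩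
  · intro i m w y h g i' α
    obtain ⟨σ, γ, rfl, rfl⟩ := exists_of_mem_baseData h
    have e : (a.act g).obj σ.incl.last = σ.incl.last := CatAction.stab_eq σ.last.le
        (Subgroup.mem_top g)
    have h1 : (σ.incl.over γ).push g α =
        σ.incl.over (eqToHom e.symm ≫ (a.act g).map γ ≫ α) := by
      refine OverChain.ext (σ.incl_act (Subgroup.mem_top g)) fun e' => ?_
      rw [Chain.over_hom, OverChain.push_hom, Chain.over_hom]
      exact eqToHom_trans_assoc_self e _
    have h2 : X.pushMap g α ((X.toFunctor.map γ).hom.comp (baseMap b hb σ)) =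
        (X.toFunctor.map (eqToHom e.symm ≫ (a.act g).map γ ≫ α)).hom.comp (baseMap b hb σ) := by
      ext p
      have h3 := ConcreteCategory.congr_hom (X.map_push g γ α e) (baseMap b hb σ p)
      refine h3.trans (congrArg (X.toFunctor.map (eqToHom e.symm ≫ (a.act g).map γ ≫ α)) ?_)
      exact ((b p.1).comp σ.last (SSet.charMap (σ.over (𝟙 σ.last)) p.2)).2 g (Subgroup.mem_top g)
    rw [h1, h2]
    exact mem_baseData hb σ _
  · intro i m w y h k θ
    obtain ⟨σ, γ, rfl, rfl⟩ := exists_of_mem_baseData h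
    have h1 : (σ.incl.over γ).face θ =
        Chain.over (Chain.incl ((nerve (FixedCat a ⊤)).map θ.op σ)) (σ.incl.lastMap θ ≫ γ) :=
      Chain.map_over σ.incl θ γ
    have h2 : faceMap θ ((X.toFunctor.map γ).hom.comp (baseMap b hb σ)) =
        (X.toFunctor.map (σ.incl.lastMap θ ≫ γ)).hom.comp
          (baseMap b hb ((nerve (FixedCat a ⊤)).map θ.op σ)) := by
      ext p
      refine (congrArg (X.toFunctor.map γ) (map_lastMap_baseMap b hb θ σ p.1 p.2).symm).trans ?_
      exact (ConcreteCategory.congr_hom (X.toFunctor.map_comp (σ.incl.lastMap θ) γ) _).symm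
    rw [h1, h2]
    exact mem_baseData hb _ _
  · intro i m w y y' h h'
    obtain ⟨σ, γ, rfl, rfl⟩ := exists_of_mem_baseData h
    obtain ⟨σ', γ', hw, rfl⟩ := exists_of_mem_baseData h'
    obtain rfl : σ = σ' := Chain.incl_injective (congrArg OverChain.chain hw)
    rw [Chain.over_injective hw]
  · intro i m w y h s z
    obtain ⟨σ, γ, rfl, rfl⟩ := exists_of_mem_baseData h
    have h1 : baseMap b hb σ (j s, z) = (f s).onSimplex (σ.incl.over (𝟙 σ.incl.last)) z := by
      refine Eq.trans ?_ (restriction_charMap (f s) σ (𝟙 σ.last) z)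
      rw [hfb]
      rfl
    refine (congrArg (X.toFunctor.map γ) h1).trans ?_
    rw [FixedHom.map_onSimplex_over, Category.id_comp]
  · intro i m w y h g i' w' h'
    obtain ⟨σ, γ, rfl, rfl⟩ := exists_of_mem_baseData h
    have h1 : w'.chain = σ.incl := h'.trans (σ.incl_act (Subgroup.mem_top g))
    refine ⟨(X.toFunctor.map (eqToHom (congrArg Chain.last h1.symm) ≫ w'.hom)).hom.comp
      (baseMap b hb σ), σ, eqToHom (congrArg Chain.last h1.symm) ≫ w'.hom, ?_, rfl⟩
    exact (OverChain.eq_over w').trans (Chain.over_congr h1 _)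

/-- A total R is a function on simplices. Closure under faces lets it descend to realizations,
closure under push makes the result a morphism of G-diagrams, and continuity in t is checked on each
simplex. -/
theorem IsPartial.exists_family [CompactSpace T] [T2Space T] {R : Set (X.Datum T)}
    (hR : IsPartial j f R)
    (htot : ∀ (i : I) (m : SimplexCategory) (w : OverChain i m),
      ∃ y, (⟨i, m, w, y⟩ : X.Datum T) ∈ R) :
    ∃ F : T → FixedHolim X, Continuous F ∧ ∀ {i m w y}, (⟨i, m, w, y⟩ : X.Datum T) ∈ R →
      ∀ t z, (F t).onSimplex w z = y (t, z) := by
  choose y hy using htot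
  have hface : ∀ (i : I) (m k : SimplexCategory) (θ : k ⟶ m) (w : OverChain i m) (t : T)
      (z : TopSimplex k), y i k (w.face θ) (t, z) = y i m w (t, TopSimplex.map θ z) :=
    fun i m k θ w t z =>
      congrArg (fun v => v (t, z)) (hR.unique (hy i k (w.face θ)) (hR.face (hy i m w) θ))
  have hpush : ∀ (i i' : I) (m : SimplexCategory) (w : OverChain i m) (g : G)
      (α : (a.act g).obj i ⟶ i') (t : T) (z : TopSimplex m),
      y i' m (w.push g α) (t, z) = X.push g α (y i m w (t, z)) :=
    fun i i' m w g α t z =>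
      congrArg (fun v => v (t, z)) (hR.unique (hy i' m (w.push g α)) (hR.push (hy i m w) g α))
  have hdesc := fun (t : T) (i : I) => SSet.exists_toTop_desc
    (S := nerve (CostructuredArrow (𝟭 I) i)) (Y := X.toFunctor.obj i)
    (fun m w => (y i m w).comp ⟨fun z => (t, z), by fun_prop⟩)
    (fun m k θ w z => hface i m k θ w t z)
  choose F hF using hdesc
  let F' : T → FixedHolim X := fun t => homOfPush (K := overI a) (X := X) (F t)
    fun g i i' α => SSet.toTop_hom_ext fun m w z => by
      refine (congrArg (F t i') (charMap_push g α w z).symm).trans ?_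
      refine (hF t i' m _ z).trans ((hpush i i' m w g α t z).trans ?_)
      exact congrArg (X.push g α) (hF t i m w z).symm
  have hF' : ∀ t i m (w : OverChain i m) z, (F' t).onSimplex w z = y i m w (t, z) :=
    fun t i m w z => hF t i m w z
  refine ⟨F', ?_, ?_⟩
  · refine Continuous.subtype_mk (HomSpace.continuous_of_comp (K := (overI a).toFunctor)
      (X := X.toFunctor) fun i => ?_) _
    refine SSet.continuous_of_charMap _ fun m w => ?_
    exact (y i m w).continuous.congr fun p => (hF' p.1 i m w p.2).symm
  · intro i m w y' h t z
    rw [hF', hR.unique h (hy i m w)]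

/-- The relative homotopy extension and lifting property of the restriction map. -/
theorem exists_extension [CompactSpace T] [T2Space T] (hf : Continuous f) (hb : Continuous b)
    (hfb : ∀ s, restriction X (f s) = b (j s))
    (hcell : ∀ (n : ℕ) (σ : Chain I (SimplexCategory.mk n)), σ ∈ (nerve I).nonDegenerate n →
      σ.stabilizer a ≠ ⊤ →
      CellExtension j (SimplexCategory.mk n) (X.FixedSpace (σ.stabilizer_le (a := a)))) :
    ∃ F : T → FixedHolim X, Continuous F ∧ (∀ s, F (j s) = f s) ∧
      ∀ t, restriction X (F t) = b t := by
  obtain ⟨R, hR, hsub, htot⟩ := (isPartial_baseData hb hfb).exists_total hf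
    (fun m σ => ⟨_, mem_baseData hb σ (𝟙 _)⟩) hcell
  obtain ⟨F, hF, hFR⟩ := hR.exists_family htot
  refine ⟨F, hF, fun s => ?_, fun t => ?_⟩
  · refine FixedHom.ext_onSimplex fun i m w z => ?_
    obtain ⟨y, hy⟩ := htot i m w
    rw [hFR hy, hR.compat hy]
  · refine NatTrans.ext (funext fun i => SSet.toTop_hom_ext fun m w z => Subtype.ext ?_)
    obtain ⟨σ, γ, rfl⟩ : ∃ (σ : Chain (FixedCat a ⊤) m) (γ : σ.last ⟶ i), w = σ.over γ :=
      ⟨_, _, OverChain.eq_over w⟩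
    refine (restriction_charMap (F t) σ γ z).trans ?_
    rw [hFR (hsub (mem_baseData hb σ (i := i.obj) γ.1))]
    exact map_baseMap b hb σ γ t z

end GDiagram

end BaseExtension

/-! ### Discs, cylinders and simplices -/

section Discs

theorem exists_glue_closed {Z Y : Type*} [TopologicalSpace Z] [TopologicalSpace Y] {A B : Set Z}
    (hA : IsClosed A) (hB : IsClosed B) (hAB : ∀ z, z ∈ A ∨ z ∈ B) (f : C(A, Y)) (g : C(B, Y))
    (h : ∀ z (ha : z ∈ A) (hb : z ∈ B), f ⟨z, ha⟩ = g ⟨z, hb⟩) :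
    ∃ F : C(Z, Y), (∀ z (ha : z ∈ A), F z = f ⟨z, ha⟩) ∧ ∀ z (hb : z ∈ B), F z = g ⟨z, hb⟩ := by
  classical
  let F : Z → Y := fun z => if ha : z ∈ A then f ⟨z, ha⟩ else g ⟨z, (hAB z).resolve_left ha⟩
  have hFA : ∀ z (ha : z ∈ A), F z = f ⟨z, ha⟩ := fun z ha => dif_pos ha
  have hFB : ∀ z (hb : z ∈ B), F z = g ⟨z, hb⟩ := fun z hb => by
    by_cases ha : z ∈ A
    · rw [hFA z ha, h z ha hb]
    · exact dif_neg ha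
  have h1 : ContinuousOn F A := continuousOn_iff_continuous_domRestrict.2
    (f.continuous.congr fun z => (hFA z.1 z.2).symm)
  have h2 : ContinuousOn F B := continuousOn_iff_continuous_domRestrict.2
    (g.continuous.congr fun z => (hFB z.1 z.2).symm)
  have h3 : Continuous F := by
    rw [← continuousOn_univ, ← Set.eq_univ_of_forall (s := A ∪ B) hAB]
    exact h1.union_of_isClosed h2 hA hB
  exact ⟨⟨F, h3⟩, hFA, hFB⟩

/-- The cylinder `B × [0, 1]` retracts to the union of its bottom and the cylinder over `S`. -/
def CylinderRetraction {B : Type*} [TopologicalSpace B] (S : Set B) : Prop :=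
  ∃ ρ : C(B × unitInterval, B × unitInterval), (∀ p, (ρ p).1 ∈ S ∨ (ρ p).2 = 0) ∧
    ∀ p : B × unitInterval, p.1 ∈ S ∨ p.2 = 0 → ρ p = p

theorem CylinderRetraction.of_homeomorph {B B' : Type*} [TopologicalSpace B] [TopologicalSpace B']
    {S : Set B} {S' : Set B'} (h : CylinderRetraction S') (e : B ≃ₜ B')
    (he : ∀ z, e z ∈ S' ↔ z ∈ S) : CylinderRetraction S := by
  obtain ⟨ρ, h1, h2⟩ := h
  refine ⟨⟨fun p => (e.symm (ρ (e p.1, p.2)).1, (ρ (e p.1, p.2)).2), by fun_prop⟩,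
    fun p => ?_, fun p hp => ?_⟩
  · refine (h1 (e p.1, p.2)).imp_left fun h => ?_
    rw [← he]
    simpa using h
  · have := h2 (e p.1, p.2) (hp.imp_left (he p.1).2)
    simp [this]

/-- Retract the cylinder, then apply r on the part landing over S and v on the part landing at the
bottom; these overlap where v and r agree. -/
theorem CylinderRetraction.exists_extension {B Q Y : Type*} [TopologicalSpace B]
    [TopologicalSpace Q] [TopologicalSpace Y] {S : Set B} (hS : CylinderRetraction S)
    (hc : IsClosed S) (v : C(Q × B, Y)) (r : C((Q × unitInterval) × S, Y))
    (hvr : ∀ q (z : S), v (q, z) = r ((q, 0), z)) :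
    ∃ y : C((Q × unitInterval) × B, Y), (∀ q z, y ((q, 0), z) = v (q, z)) ∧
      ∀ p (z : S), y (p, z) = r (p, z) := by
  obtain ⟨ρ, h1, h2⟩ := hS
  have hρ : Continuous fun p : (Q × unitInterval) × B => ρ (p.2, p.1.2) := by fun_prop
  obtain ⟨y, hy1, hy2⟩ := exists_glue_closed
    (A := {p : (Q × unitInterval) × B | (ρ (p.2, p.1.2)).1 ∈ S})
    (B := {p : (Q × unitInterval) × B | (ρ (p.2, p.1.2)).2 = 0})
    (hc.preimage (continuous_fst.comp hρ)) (isClosed_singleton.preimage (continuous_snd.comp hρ))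
    (fun p => h1 _)
    ⟨fun p => r ((p.1.1.1, (ρ (p.1.2, p.1.1.2)).2), ⟨(ρ (p.1.2, p.1.1.2)).1, p.2⟩),
      r.continuous.comp (((continuous_fst.comp (continuous_fst.comp continuous_subtype_val)).prodMk
        (continuous_snd.comp (hρ.comp continuous_subtype_val))).prodMk
        ((continuous_fst.comp (hρ.comp continuous_subtype_val)).subtype_mk _))⟩
    ⟨fun p => v (p.1.1.1, (ρ (p.1.2, p.1.1.2)).1),
      v.continuous.comp ((continuous_fst.comp (continuous_fst.comp continuous_subtype_val)).prodMk
        (continuous_fst.comp (hρ.comp continuous_subtype_val)))⟩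
    (fun p ha hb => by
      have hb' : (ρ (p.2, p.1.2)).2 = 0 := hb
      change r ((p.1.1, (ρ (p.2, p.1.2)).2), ⟨(ρ (p.2, p.1.2)).1, ha⟩) = _
      rw [hb']
      exact (hvr _ ⟨_, ha⟩).symm)
  refine ⟨y, fun q z => ?_, fun p z => ?_⟩
  · have h := h2 (z, 0) (Or.inr rfl)
    rw [hy2 ((q, 0), z) (by change (ρ (z, 0)).2 = 0; rw [h])]
    change v (q, (ρ (z, 0)).1) = _
    rw [h]
  · have h := h2 (z.1, p.2) (Or.inl z.2)
    rw [hy1 (p, z) (by change (ρ (z.1, p.2)).1 ∈ S; rw [h]; exact z.2)]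
    change r ((p.1, (ρ (z.1, p.2)).2), ⟨(ρ (z.1, p.2)).1, _⟩) = _
    congr 1
    refine Prod.ext (Prod.ext rfl ?_) (Subtype.ext ?_)
    · change (ρ (z.1, p.2)).2 = p.2
      rw [h]
    · exact congrArg (fun q => q.1) h

/-- Radial projection from the point (0, 2) above the cylinder. The scale M is the larger of the
factors at which the ray meets the side and the bottom; it lies between 1/2 and 1, and equals 1 on
side and bottom. -/
theorem cylinderRetraction_closedBall {V : Type*} [NormedAddCommGroup V] [NormedSpace ℝ V] :
    CylinderRetraction {x : Metric.closedBall (0 : V) 1 | ‖x.1‖ = 1} := by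
  let M : Metric.closedBall (0 : V) 1 × unitInterval → ℝ :=
    fun p => max ‖p.1.1‖ ((2 - p.2.1) / 2)
  have hM : Continuous M := by fun_prop
  have hM1 : ∀ p, 1 / 2 ≤ M p := fun p => le_max_of_le_right (by
    have := p.2.2.2
    linarith)
  have hM0 : ∀ p, M p ≠ 0 := fun p => by have := hM1 p; positivity
  have hMpos : ∀ p, 0 < M p := fun p => by have := hM1 p; linarith
  have hx : ∀ p : Metric.closedBall (0 : V) 1 × unitInterval, ‖p.1.1‖ ≤ 1 :=
    fun p => mem_closedBall_zero_iff.1 p.1.2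
  have hMle : ∀ p, M p ≤ 1 := fun p => max_le (hx p) (by
    have := p.2.2.1
    linarith)
  have hnorm : ∀ p, ‖(M p)⁻¹ • p.1.1‖ = ‖p.1.1‖ / M p := fun p => by
    rw [norm_smul, norm_inv, Real.norm_of_nonneg (hMpos p).le, inv_mul_eq_div]
  have hmem1 : ∀ p, (M p)⁻¹ • p.1.1 ∈ Metric.closedBall (0 : V) 1 := fun p => by
    rw [mem_closedBall_zero_iff, hnorm, div_le_one (hMpos p)]
    exact le_max_left _ _
  have hmem2 : ∀ p, 2 - (2 - p.2.1) / M p ∈ Set.Icc (0 : ℝ) 1 := fun p => by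
    have h1 : (2 - p.2.1) / M p ≤ 2 := by
      rw [div_le_iff₀ (hMpos p)]
      have : (2 - p.2.1) / 2 ≤ M p := le_max_right _ _
      linarith
    have h2 : 1 ≤ (2 - p.2.1) / M p := by
      rw [le_div_iff₀ (hMpos p)]
      have := hMle p
      have := p.2.2.2
      linarith
    exact ⟨by linarith, by linarith⟩
  refine ⟨⟨fun p => (⟨_, hmem1 p⟩, ⟨_, hmem2 p⟩), ?_⟩, fun p => ?_, fun p hp => ?_⟩
  · refine Continuous.prodMk (Continuous.subtype_mk ?_ _) (Continuous.subtype_mk ?_ _)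
    · exact (hM.inv₀ hM0).smul (by fun_prop)
    · exact continuous_const.sub (Continuous.div (by fun_prop) hM hM0)
  · rcases max_choice ‖p.1.1‖ ((2 - p.2.1) / 2) with h | h
    · left
      have h' : M p = ‖p.1.1‖ := h
      change ‖(M p)⁻¹ • p.1.1‖ = 1
      rw [hnorm, ← h', div_self (hM0 p)]
    · right
      have h' : M p = (2 - p.2.1) / 2 := h
      apply Subtype.ext
      change 2 - (2 - p.2.1) / M p = 0
      have h3 : 2 - p.2.1 = 2 * M p := by linarith
      rw [h3, mul_div_assoc, div_self (hM0 p)]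
      norm_num
  · have h1 : M p = 1 := by
      rcases hp with hp | hp
      · have hp' : ‖p.1.1‖ = 1 := hp
        exact le_antisymm (hMle p) (le_max_of_le_left hp'.ge)
      · exact le_antisymm (hMle p) (le_max_of_le_right (by rw [hp]; norm_num))
    refine Prod.ext (Subtype.ext ?_) (Subtype.ext ?_)
    · change (M p)⁻¹ • p.1.1 = p.1.1
      rw [h1, inv_one, one_smul]
    · change 2 - (2 - p.2.1) / M p = p.2.1
      rw [h1]
      ring

/-- A homeomorphism of a simplex with a disc. -/
theorem TopSimplex.exists_homeomorph_closedBall (m : ℕ) :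
    ∃ e : TopSimplex (SimplexCategory.mk m) ≃ₜ
        Metric.closedBall (0 : EuclideanSpace ℝ (Fin m)) 1,
      ∀ z, ‖(e z).1‖ = 1 ↔ z ∈ TopBoundary (SimplexCategory.mk m) := by
  -- Barycentric coordinates for an affine basis identify the simplex with a convex body, which is
  -- homeomorphic to the ball with interior corresponding to interior.
  obtain ⟨b⟩ := AffineBasis.exists_affineBasis_of_finiteDimensional (k := ℝ)
    (P := EuclideanSpace ℝ (Fin m)) (ι := Fin (m + 1)) (by simp)
  let c : TopSimplex (SimplexCategory.mk m) → EuclideanSpace ℝ (Fin m) :=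
    fun z => ∑ i : Fin (m + 1), z i • b i
  have hz : ∀ z : TopSimplex (SimplexCategory.mk m), ∑ i : Fin (m + 1), z i = 1 :=
    fun z => stdSimplex.sum_eq_one z
  have hc : Continuous c := by
    refine continuous_finsetSum _ fun i _ => ?_
    refine Continuous.fun_smul ?_ continuous_const
    exact (continuous_apply i).comp continuous_subtype_val
  have hcoord : ∀ z (i : Fin (m + 1)), b.coord i (c z) = z i := fun z i => by
    have h := b.coord_apply_combination_of_mem (Finset.mem_univ i) (hz z)
    rwa [Finset.affineCombination_eq_linear_combination _ _ _ (hz z)] at h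
  have hK : convexHull ℝ (Set.range b) = {x | ∀ i, 0 ≤ b.coord i x} :=
    b.convexHull_eq_nonneg_coord
  have hint : interior (convexHull ℝ (Set.range b)) = {x | ∀ i, 0 < b.coord i x} :=
    b.interior_convexHull
  have hcpt : IsCompact (convexHull ℝ (Set.range b)) := 
    (Set.finite_range b).isCompact_convexHull ℝ
  have hne : (interior (convexHull ℝ (Set.range b))).Nonempty :=
    interior_convexHull_nonempty_iff_affineSpan_eq_top.2 b.tot
  obtain ⟨h, hi, hcl, -⟩ := exists_homeomorph_image_interior_closure_frontier_eq_unitBall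
    (convex_convexHull ℝ (Set.range b)) hne hcpt.isBounded
  rw [hcpt.isClosed.closure_eq] at hcl
  have hmem : ∀ z, h (c z) ∈ Metric.closedBall (0 : EuclideanSpace ℝ (Fin m)) 1 := fun z => by
    rw [← hcl]
    refine Set.mem_image_of_mem _ ?_
    rw [hK]
    exact fun i => (hcoord z i).symm ▸ stdSimplex.zero_le z i
  let F : TopSimplex (SimplexCategory.mk m) →
    Metric.closedBall (0 : EuclideanSpace ℝ (Fin m)) 1 := fun z => ⟨h (c z), hmem z⟩
  have hF : Continuous F := (h.continuous.comp hc).subtype_mk _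
  have hinj : Function.Injective F := fun z z' hzz => by
    have h1 : c z = c z' := h.injective (congrArg Subtype.val hzz)
    refine Subtype.ext (funext fun i => ?_)
    have := hcoord z i
    rw [h1, hcoord z' i] at this
    exact this.symm
  have hsurj : Function.Surjective F := fun ⟨x, hx⟩ => by
    rw [← hcl] at hx
    obtain ⟨y, hy, rfl⟩ := hx
    rw [hK] at hy
    refine ⟨⟨fun i => b.coord i y, hy, b.sum_coord_apply_eq_one y⟩, Subtype.ext ?_⟩
    exact congrArg h (b.linear_combination_coord_eq_self y)
  refine ⟨Continuous.homeoOfEquivCompactToT2 (f := Equiv.ofBijective F ⟨hinj, hsurj⟩) hF,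
    fun z => ?_⟩
  change ‖h (c z)‖ = 1 ↔ _
  -- Interior points are those with all barycentric coordinates positive, so the boundary is where
  -- one of them vanishes.
  have hlt : ‖h (c z)‖ < 1 ↔ ∀ i : Fin (m + 1), 0 < z i := by
    rw [← mem_ball_zero_iff, ← hi, h.injective.mem_set_image, hint]
    exact forall_congr' fun i => by rw [hcoord]
  have hle := mem_closedBall_zero_iff.1 (hmem z)
  constructor
  · intro h1
    by_contra hnot
    refine h1.not_lt (hlt.2 fun i => ?_)
    exact lt_of_le_of_ne (stdSimplex.zero_le z i) fun h0 => hnot ⟨i, h0.symm⟩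
  · rintro ⟨i, h0⟩
    refine le_antisymm hle (not_lt.1 fun h1 => ?_)
    exact (hlt.1 h1 i).ne' h0

/-- Spheres of arbitrary norms can be used to test connectivity. -/
theorem IsNConnected.exists_extension_closedBall {V : Type*} [NormedAddCommGroup V]
    [NormedSpace ℝ V] [FiniteDimensional ℝ V] {Y : Type*} [TopologicalSpace Y] {n : ℤ}
    (hY : IsNConnected n Y) (hV : (Module.finrank ℝ V : ℤ) ≤ n + 1)
    (f : C(Metric.sphere (0 : V) 1, Y)) :
    ∃ F : C(Metric.closedBall (0 : V) 1, Y), ∀ x : Metric.sphere (0 : V) 1,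
      F ⟨x.1, Metric.sphere_subset_closedBall x.2⟩ = f x := by
  let L : V ≃L[ℝ] EuclideanSpace ℝ (Fin (Module.finrank ℝ V)) :=
    ContinuousLinearEquiv.ofFinrankEq (by simp)
  -- L carries the unit ball of V to a convex body in Euclidean space, and h straightens that body
  -- to the Euclidean ball.
  obtain ⟨h, -, hcl, hfr⟩ := exists_homeomorph_image_interior_closure_frontier_eq_unitBall
    (s := L '' Metric.closedBall 0 1) ((convex_closedBall (0 : V) 1).linear_image L.toLinearMap) (by
      have : (L.toHomeomorph '' interior (Metric.closedBall (0 : V) 1)) =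
          interior (L.toHomeomorph '' Metric.closedBall (0 : V) 1) :=
              L.toHomeomorph.image_interior _
      refine Set.Nonempty.mono this.le (Set.Nonempty.image _ ⟨0, ?_⟩)
      exact Metric.ball_subset_interior_closedBall (Metric.mem_ball_self one_pos))
    ((isCompact_closedBall (0 : V) 1).image L.continuous).isBounded
  rw [((isCompact_closedBall (0 : V) 1).image L.continuous).isClosed.closure_eq] at hcl
  have hfr' : h '' (L '' Metric.sphere 0 1) = Metric.sphere 0 1 := by
    rw [← hfr, ← frontier_closedBall (0 : V) one_ne_zero]
    exact congrArg (h '' ·) (L.toHomeomorph.image_frontier _)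
  let e : V ≃ₜ EuclideanSpace ℝ (Fin (Module.finrank ℝ V)) := L.toHomeomorph.trans h
  have he1 : e '' Metric.closedBall 0 1 = Metric.closedBall 0 1 := by
    rw [← hcl, Set.image_image]
    rfl
  have he2 : e '' Metric.sphere 0 1 = Metric.sphere 0 1 := by
    rw [← hfr', Set.image_image]
    rfl
  have hs : ∀ x : Metric.sphere (0 : EuclideanSpace ℝ (Fin (Module.finrank ℝ V))) 1,
      e.symm x ∈ Metric.sphere (0 : V) 1 := fun x => by
    obtain ⟨y, hy, hxy⟩ : x.1 ∈ e '' Metric.sphere 0 1 := he2.symm.le x.2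
    rw [← hxy]
    simpa using hy
  obtain ⟨F, hF⟩ := hY _ hV (f.comp ⟨fun x => ⟨e.symm x, hs x⟩, by fun_prop⟩)
  refine ⟨F.comp ⟨fun x => ⟨e x, by rw [← he1]; exact Set.mem_image_of_mem _ x.2⟩, by fun_prop⟩,
    fun x => ?_⟩
  have := hF ⟨e x, by rw [← he2]; exact Set.mem_image_of_mem _ x.2⟩
  refine this.trans (congrArg f (Subtype.ext ?_))
  exact e.symm_apply_apply _

end Discs

/-! ### The cell extension property for cylinders and for discs -/

section CellExtensions

theorem TopBoundary.cylinderRetraction (m : ℕ) :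
    IsClosed (TopBoundary (SimplexCategory.mk m)) ∧
      CylinderRetraction (TopBoundary (SimplexCategory.mk m)) := by
  obtain ⟨e, he⟩ := TopSimplex.exists_homeomorph_closedBall m
  refine ⟨?_, cylinderRetraction_closedBall.of_homeomorph e he⟩
  have h : TopBoundary (SimplexCategory.mk m) = {z | ‖(e z).1‖ = 1} := Set.ext fun z => (he z).symm
  rw [h]
  exact isClosed_eq (by fun_prop) continuous_const

namespace GDiagram

theorem cellExtension_cylinder {Q : Type} [TopologicalSpace Q] {j : C(Q, Q × unitInterval)}
    (hj : ∀ q, j q = (q, 0)) (m : ℕ) (Y : Type*) [TopologicalSpace Y] :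
    CellExtension j (SimplexCategory.mk m) Y := by
  intro v r h
  obtain ⟨hc, hr⟩ := TopBoundary.cylinderRetraction m
  obtain ⟨y, h1, h2⟩ := hr.exists_extension hc v r fun q z => by rw [h, hj]
  exact ⟨y, fun s z => by rw [hj, h1], h2⟩

/-- The product D^k × D^m is the unit ball of the sup norm, and its sphere is the union of S^(k-1) ×
D^m and D^k × S^(m-1). There v and r combine to a map, which extends because the ball has dimension
k + m ≤ n + 1. -/
theorem cellExtension_sphere {k m : ℕ} {n : ℤ} {Y : Type*} [TopologicalSpace Y]
    (hY : IsNConnected n Y) (hn : (k : ℤ) + m ≤ n + 1)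
    {j : C(Metric.sphere (0 : EuclideanSpace ℝ (Fin k)) 1,
      Metric.closedBall (0 : EuclideanSpace ℝ (Fin k)) 1)} (hj : ∀ x, (j x).1 = x.1) :
    CellExtension j (SimplexCategory.mk m) Y := by
  intro v r h
  obtain ⟨e, he⟩ := TopSimplex.exists_homeomorph_closedBall m
  have hmax : ∀ p : Metric.sphere (0 : EuclideanSpace ℝ (Fin k) × EuclideanSpace ℝ (Fin m)) 1,
      max ‖p.1.1‖ ‖p.1.2‖ = 1 := fun p => mem_sphere_zero_iff_norm.1 p.2
  have hle1 : ∀ p : Metric.sphere (0 : EuclideanSpace ℝ (Fin k) × EuclideanSpace ℝ (Fin m)) 1,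
      p.1.1 ∈ Metric.closedBall (0 : EuclideanSpace ℝ (Fin k)) 1 := fun p =>
    mem_closedBall_zero_iff.2 ((le_max_left _ _).trans (hmax p).le)
  have hle2 : ∀ p : Metric.sphere (0 : EuclideanSpace ℝ (Fin k) × EuclideanSpace ℝ (Fin m)) 1,
      p.1.2 ∈ Metric.closedBall (0 : EuclideanSpace ℝ (Fin m)) 1 := fun p =>
    mem_closedBall_zero_iff.2 ((le_max_right _ _).trans (hmax p).le)
  let c : Metric.sphere (0 : EuclideanSpace ℝ (Fin k) × EuclideanSpace ℝ (Fin m)) 1 →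
    TopSimplex (SimplexCategory.mk m) := fun p => e.symm ⟨p.1.2, hle2 p⟩
  have hc : Continuous c := by fun_prop
  have hcb : ∀ p, ‖p.1.2‖ = 1 → c p ∈ TopBoundary (SimplexCategory.mk m) := fun p hp => by
    rw [← he]
    simpa [c] using hp
  obtain ⟨φ, hφ1, hφ2⟩ := exists_glue_closed
    (A := {p : Metric.sphere (0 : EuclideanSpace ℝ (Fin k) × EuclideanSpace ℝ (Fin m)) 1 |
      ‖p.1.1‖ = 1}) (B := {p | ‖p.1.2‖ = 1})
    (isClosed_eq (by fun_prop) continuous_const) (isClosed_eq (by fun_prop) continuous_const)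
    (fun p => (max_choice ‖p.1.1‖ ‖p.1.2‖).imp (fun h => h.symm.trans (hmax p))
      fun h => h.symm.trans (hmax p))
    (v.comp ⟨fun p => (⟨p.1.1.1, mem_sphere_zero_iff_norm.2 p.2⟩, c p.1), by fun_prop⟩)
    (r.comp ⟨fun p => (⟨p.1.1.1, hle1 p.1⟩, ⟨c p.1, hcb p.1 p.2⟩), by fun_prop⟩)
    (fun p ha hb => by
      refine (h ⟨p.1.1, mem_sphere_zero_iff_norm.2 ha⟩ ⟨c p, hcb p hb⟩).trans ?_
      exact congrArg (fun t => r (t, ⟨c p, hcb p hb⟩)) (Subtype.ext (hj _)))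
  obtain ⟨Φ, hΦ⟩ := hY.exists_extension_closedBall (by simpa using hn) φ
  have hmem : ∀ (t : Metric.closedBall (0 : EuclideanSpace ℝ (Fin k)) 1) z,
      (t.1, (e z).1) ∈ Metric.closedBall (0 : EuclideanSpace ℝ (Fin k) × EuclideanSpace ℝ
          (Fin m)) 1 :=
    fun t z => mem_closedBall_zero_iff.2 (max_le (mem_closedBall_zero_iff.1 t.2)
      (mem_closedBall_zero_iff.1 (e z).2))
  refine ⟨Φ.comp ⟨fun p => ⟨(p.1.1, (e p.2).1), hmem p.1 p.2⟩, by fun_prop⟩,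
    fun s z => ?_, fun t z => ?_⟩
  · have hs : ‖s.1‖ = 1 := mem_sphere_zero_iff_norm.1 s.2
    have hq : (s.1, (e z).1) ∈
        Metric.sphere (0 : EuclideanSpace ℝ (Fin k) × EuclideanSpace ℝ (Fin m)) 1 :=
      mem_sphere_zero_iff_norm.2 ((max_eq_left
        ((mem_closedBall_zero_iff.1 (e z).2).trans hs.ge)).trans hs)
    have h1 := (hΦ ⟨_, hq⟩).trans (hφ1 ⟨_, hq⟩ hs)
    have h2 : (⟨((j s).1, (e z).1), hmem (j s) z⟩ : Metric.closedBall
        (0 : EuclideanSpace ℝ (Fin k) × EuclideanSpace ℝ (Fin m)) 1) =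
        ⟨(s.1, (e z).1), Metric.sphere_subset_closedBall hq⟩ :=
      Subtype.ext (Prod.ext (hj s) rfl)
    refine (congrArg Φ h2).trans (h1.trans ?_)
    exact congrArg (fun z => v (s, z)) (e.symm_apply_apply z)
  · have hz : ‖(e z.1).1‖ = 1 := (he _).2 z.2
    have hq : (t.1, (e z).1) ∈
        Metric.sphere (0 : EuclideanSpace ℝ (Fin k) × EuclideanSpace ℝ (Fin m)) 1 :=
      mem_sphere_zero_iff_norm.2 ((max_eq_right
        ((mem_closedBall_zero_iff.1 t.2).trans hz.ge)).trans hz)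
    refine ((hΦ ⟨_, hq⟩).trans (hφ2 ⟨_, hq⟩ hz)).trans ?_
    exact congrArg (fun z => r (t, z)) (Subtype.ext (e.symm_apply_apply z.1))

end GDiagram

end CellExtensions

/-! ### From the numerical bound to connectivity of fixed spaces -/

section Bounds

theorem IsNConnected.mono {n m : ℤ} (h : m ≤ n) {Y : Type*} [TopologicalSpace Y]
    (hY : IsNConnected n Y) : IsNConnected m Y := fun k hk => hY k (by lia)

/-- If Y were not n-connected, monotonicity would bound every integer in the supremum by n - 1. -/
theorem isNConnected_of_le_conn {n : ℤ} {Y : Type*} [TopologicalSpace Y]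
    (h : ((n : ℝ) : EReal) ≤ conn Y) : IsNConnected n Y := by
  by_contra hn
  have h1 : conn Y ≤ (((n - 1 : ℤ) : ℝ) : EReal) := iSup_le fun m => by
    rw [EReal.coe_le_coe_iff, Int.cast_le]
    by_contra hm
    exact hn (m.2.2.mono (by lia))
  have h2 := h.trans h1
  rw [EReal.coe_le_coe_iff, Int.cast_le] at h2
  lia

theorem isNConnected_of_le_conn_sub {n : ℤ} {m : ℕ} {Y : Type*} [TopologicalSpace Y] {d : EReal}
    (hm : ((m : ℝ) : EReal) ≤ d) (h : ((n : ℝ) : EReal) ≤ conn Y - d + 1) :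
    IsNConnected (n + m - 1) Y := by
  apply isNConnected_of_le_conn
  -- Replacing d by the finite m leaves a subtraction that involves no difference of infinities.
  have h1 : ((n : ℝ) : EReal) ≤ conn Y - ((m : ℝ) : EReal) + 1 :=
    h.trans (add_le_add_left (EReal.sub_le_sub le_rfl hm) 1)
  generalize conn Y = c at h1
  induction c using EReal.rec with
  | bot => simp at h1
  | top => exact le_top
  | coe c =>
    rw [← EReal.coe_one, ← EReal.coe_sub, ← EReal.coe_add, EReal.coe_le_coe_iff] at h1
    rw [EReal.coe_le_coe_iff]
    push_cast
    linarith

theorem nonDegenerate_of_map {S S' : SSet.{u}} (F : S ⟶ S') {n : ℕ}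
    {x : S.obj (op (SimplexCategory.mk n))}
    (h : F.app (op (SimplexCategory.mk n)) x ∈ S'.nonDegenerate n) : x ∈ S.nonDegenerate n := by
  rintro ⟨k, hk, θ, y, rfl⟩
  exact h ⟨k, hk, θ, F.app _ y, (ConcreteCategory.congr_hom (F.naturality θ.op) y).symm⟩

variable {G : Type w} [Group G] {I : Type u} [SmallCategory I] {a : CatAction G I}

/-- This yields m ≤ dim N(I^H/l) for a nondegenerate m-chain σ. As H fixes σ, it lifts to I^H over
its last vertex, and the lift is nondegenerate because its image in N(I) is. -/
theorem Chain.exists_over_nonDegenerate {n : ℕ} {σ : Chain I (SimplexCategory.mk n)}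
    (hσ : σ ∈ (nerve I).nonDegenerate n) {H : Subgroup G} (hH : H ≤ σ.stabilizer a)
    (hi : H ≤ a.stabilizer σ.last) :
    ∃ w : OverChain (⟨σ.last, hi⟩ : FixedCat a H) (SimplexCategory.mk n), w.chain.incl = σ ∧
      w ∈ (nerve (Over (⟨σ.last, hi⟩ : FixedCat a H))).nonDegenerate n := by
  obtain ⟨σ₀, hσ₀⟩ := Chain.exists_fixed (H := H) (σ := σ) fun g hg => hH hg
  have e : σ₀.last = (⟨σ.last, hi⟩ : FixedCat a H) := FixedCat.ext (congrArg Chain.last hσ₀)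
  refine ⟨σ₀.over (eqToHom e), hσ₀, ?_⟩
  refine nonDegenerate_of_map (nerveMap (Over.forget _ ⋙ FixedCat.ι a H)) ?_
  have h : (nerveMap (Over.forget (⟨σ.last, hi⟩ : FixedCat a H) ⋙ FixedCat.ι a H)).app
      (op (SimplexCategory.mk n)) (σ₀.over (eqToHom e)) = σ := hσ₀
  rw [h]
  exact hσ

/-- If every morphism of I^H/i came from ι^H/i, every edge of the chain would be fixed by G, and
hence so would the chain. -/
theorem ProperOnMorphisms.of_stabilizer_ne_top {m : SimplexCategory} {i : I} {H : Subgroup G}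
    (hi : H ≤ a.stabilizer i) (w : OverChain (⟨i, hi⟩ : FixedCat a H) m)
    (hw : w.chain.incl.stabilizer a ≠ ⊤) : ProperOnMorphisms a i H hi := by
  intro hs
  apply hw
  have key : ∀ (A : Arrow (Over (⟨i, hi⟩ : FixedCat a H))) (g : G),
      Arrow.mk ((a.act g).map A.hom.left.1) = Arrow.mk A.hom.left.1 := by
    intro A g
    obtain ⟨B, rfl⟩ := hs A
    exact congrArg (fun F : FixedCat a ⊤ ⥤ I => Arrow.mk (F.map B.hom.left))
      (ι_comp_act (a := a) (Subgroup.mem_top g))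
  refine eq_top_iff.2 fun g _ => ?_
  have key' : ∀ (p q : Fin (m.len + 1)) (f : p ⟶ q),
      Arrow.mk ((a.act g).map
        (CategoryTheory.Functor.map (C := Fin (m.len + 1)) w.chain.incl f)) =
      Arrow.mk (CategoryTheory.Functor.map (C := Fin (m.len + 1)) w.chain.incl f) :=
    fun p q f => key (Arrow.mk (CategoryTheory.Functor.map (C := Fin (m.len + 1)) w f)) g
  exact Functor.hext (C := Fin (m.len + 1))
    (fun p => congrArg (fun A => A.left) (key' p p (𝟙 p)))
    (fun p q f => congr_arg_heq (fun A => A.hom) (key' p q f))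

/-- The bound is used for H the stabilizer of σ and i its last vertex, where the dimension term is
at least m. -/
theorem isNConnected_fixedSpace {X : GDiagram a} {n : ℤ}
    (hn : ((n : ℝ) : EReal) ≤ connBound X + 1) {m : ℕ} {σ : Chain I (SimplexCategory.mk m)}
    (hσ : σ ∈ (nerve I).nonDegenerate m) (hstab : σ.stabilizer a ≠ ⊤) :
    IsNConnected (n + m - 1) (X.FixedSpace (σ.stabilizer_le (a := a))) := by
  obtain ⟨w, hw, hw'⟩ := Chain.exists_over_nonDegenerate hσ le_rfl (σ.stabilizer_le (a := a))
  have hp := ProperOnMorphisms.of_stabilizer_ne_top _ w (hw.symm ▸ hstab)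
  have hm : ((m : ℝ) : EReal) ≤
      (nerve (Over (⟨σ.last, σ.stabilizer_le⟩ : FixedCat a (σ.stabilizer a)))).dim :=
    le_iSup (fun n : {n : ℕ // ((nerve (Over (⟨σ.last, σ.stabilizer_le⟩ :
      FixedCat a (σ.stabilizer a)))).nonDegenerate n).Nonempty} => ((n.1 : ℝ) : EReal)) ⟨m, w, hw'⟩
  refine isNConnected_of_le_conn_sub hm (hn.trans (add_le_add_left ?_ 1))
  exact iInf_le_of_le σ.last (iInf_le_of_le (σ.stabilizer a)
    (iInf_le_of_le σ.stabilizer_le (iInf_le_of_le hp le_rfl)))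

end Bounds

/-! ### Homotopy lifting for r and connectivity of its homotopy fibers -/

section Restriction

variable {G : Type w} [Group G] {I : Type u} [SmallCategory I] {a : CatAction G I}
  {X : GDiagram a}

/-- The restriction map has the homotopy lifting property for compact Hausdorff spaces. -/
theorem restriction_exists_lift {Q : Type} [TopologicalSpace Q] [CompactSpace Q] [T2Space Q]
    (f : C(Q, FixedHolim X)) (h : C(Q × unitInterval, Holim (X.fixedDiagram ⊤)))
    (hf : ∀ z, h (z, 0) = restriction X (f z)) :
    ∃ l : C(Q × unitInterval, FixedHolim X),
      (∀ z, l (z, 0) = f z) ∧ ∀ z, restriction X (l z) = h z := by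
  obtain ⟨F, hF, h1, h2⟩ := GDiagram.exists_extension
    (j := (⟨fun q => (q, 0), by fun_prop⟩ : C(Q, Q × unitInterval))) f.continuous h.continuous
    (fun s => (hf s).symm)
    (fun n σ _ _ => GDiagram.cellExtension_cylinder (fun _ => rfl) n _)
  exact ⟨⟨F, hF⟩, h1, h2⟩

/-- The homotopy fibers of the restriction map. -/
theorem restriction_isNConnected_hoFiber {n : ℤ} (hn : ((n : ℝ) : EReal) ≤ connBound X + 1)
    (b : Holim (X.fixedDiagram ⊤)) : IsNConnected (n - 1) (HoFiber (restriction X) b) := by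
  intro k hk f
  have hf1 : Continuous fun s => (f s).1.1 :=
    continuous_fst.comp (continuous_subtype_val.comp f.continuous)
  have hf2 : Continuous fun s => (f s).1.2 :=
    continuous_snd.comp (continuous_subtype_val.comp f.continuous)
  have hsph : ∀ z : {x : Metric.closedBall (0 : EuclideanSpace ℝ (Fin k)) 1 | ‖x.1‖ = 1},
      z.1.1 ∈ Metric.sphere (0 : EuclideanSpace ℝ (Fin k)) 1 := fun z =>
    mem_sphere_zero_iff_norm.2 z.2
  -- P is a homotopy on D^k starting at the constant b and running backwards along the given paths
  -- over the sphere. At time 1 it restricts on the sphere to r f, so it is the base datum of a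
  -- relative lifting problem.
  obtain ⟨P, hP1, hP2⟩ := (cylinderRetraction_closedBall
      (V := EuclideanSpace ℝ (Fin k))).exists_extension (Q := Unit)
    (isClosed_eq (by fun_prop) continuous_const)
    (ContinuousMap.const _ b)
    ⟨fun p => (f ⟨p.2.1.1, hsph p.2⟩).1.2 (unitInterval.symm p.1.2), by fun_prop⟩
    (fun q z => by
      refine (f ⟨z.1.1, hsph z⟩).2.2.symm.trans ?_
      change (f ⟨z.1.1, hsph z⟩).1.2 1 = (f ⟨z.1.1, hsph z⟩).1.2 (unitInterval.symm 0)
      rw [unitInterval.symm_zero])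
  have hPs : ∀ (s : Metric.sphere (0 : EuclideanSpace ℝ (Fin k)) 1) (t : unitInterval),
      P (((), t), ⟨s.1, Metric.sphere_subset_closedBall s.2⟩) =
        (f s).1.2 (unitInterval.symm t) := fun s t =>
    hP2 ((), t) ⟨⟨s.1, Metric.sphere_subset_closedBall s.2⟩, mem_sphere_zero_iff_norm.1 s.2⟩
  obtain ⟨F, hF, h1, h2⟩ := GDiagram.exists_extension (X := X)
    (j := (⟨fun s => ⟨s.1, Metric.sphere_subset_closedBall s.2⟩, by fun_prop⟩ :
      C(Metric.sphere (0 : EuclideanSpace ℝ (Fin k)) 1,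
        Metric.closedBall (0 : EuclideanSpace ℝ (Fin k)) 1)))
    (f := fun s => (f s).1.1) (b := fun x => P (((), 1), x)) hf1 (by fun_prop)
    (fun s => by
      refine (f s).2.1.symm.trans (Eq.symm ((hPs s 1).trans ?_))
      rw [unitInterval.symm_one])
    -- The fixed space is (n+m-1)-connected and k ≤ n, hence k + m is within range.
    (fun m σ hσ hstab => GDiagram.cellExtension_sphere (isNConnected_fixedSpace hn hσ hstab)
      (by clear hP1 hP2 hPs; lia) fun _ => rfl)
  -- The reversed homotopy supplies the paths from r(F x) to b.
  let q : C(Metric.closedBall (0 : EuclideanSpace ℝ (Fin k)) 1,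
      C(unitInterval, Holim (X.fixedDiagram ⊤))) :=
    ContinuousMap.curry ⟨fun p => P (((), unitInterval.symm p.2), p.1), by fun_prop⟩
  refine ⟨⟨fun x => ⟨(F x, q x), ?_, ?_⟩, (hF.prodMk q.continuous).subtype_mk _⟩, fun s => ?_⟩
  · change P (((), unitInterval.symm 0), x) = _
    rw [h2, unitInterval.symm_zero]
  · change P (((), unitInterval.symm 1), x) = _
    rw [unitInterval.symm_one]
    exact hP1 () x
  · refine Subtype.ext (Prod.ext (h1 s) (ContinuousMap.ext fun t => ?_))
    refine (hPs s (unitInterval.symm t)).trans ?_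
    rw [unitInterval.symm_symm]

end Restriction

/-! ### Closedness of fixed points and continuity of r -/

section Closed

variable {G : Type w} [Group G] {I : Type u} [SmallCategory I] {a : CatAction G I}

instance GHom.t2Space {K X : GDiagram a} [∀ i, T2Space (X.toFunctor.obj i)] :
    T2Space (GHom K X) :=
  HomSpace.t2Space (K := K.toFunctor) (X := X.toFunctor)

instance GHom.compactlyCoherent {K X : GDiagram a} : CompactlyCoherentSpace (GHom K X) :=
  HomSpace.compactlyCoherent (K := K.toFunctor) (X := X.toFunctor)

theorem GHom.continuous_eval {K X : GDiagram a} (i : I) (z : K.toFunctor.obj i) :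
    Continuous fun f : GHom K X => f.app i z :=
  (continuous_eval_const z).comp
    (HomSpace.continuous_comp (K := K.toFunctor) (X := X.toFunctor) i)

/-- Equivariance is a family of equalities between continuous functions of f with values in
Hausdorff spaces. -/
theorem isClosed_fixedPoints_gHom {K X : GDiagram a} [∀ i, T2Space (X.toFunctor.obj i)] :
    IsClosed (MulAction.fixedPoints G (GHom K X)) := by
  have h : MulAction.fixedPoints G (GHom K X) = {f | ∀ (g : G) (i j : I)
      (e : (a.act g).obj i = j) (z : K.toFunctor.obj i),
      f.app j (K.tr g e z) = X.tr g e (f.app i z)} := by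
    ext f
    rw [mem_fixedHom_iff]
    refine forall_congr' fun g => forall_congr' fun i => forall_congr' fun j =>
      forall_congr' fun e => ⟨fun h z => ConcreteCategory.congr_hom h z, fun h => ?_⟩
    ext z
    exact h z
  rw [h]
  simp only [Set.ofPred_forall]
  refine isClosed_iInter fun g => isClosed_iInter fun i => isClosed_iInter fun j =>
    isClosed_iInter fun e => isClosed_iInter fun z => isClosed_eq (GHom.continuous_eval j _) ?_
  exact (X.tr g e).hom.continuous.comp (GHom.continuous_eval i z)

theorem FixedHom.isClosedEmbedding_val {K X : GDiagram a} [∀ i, T2Space (X.toFunctor.obj i)] :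
    Topology.IsClosedEmbedding (Subtype.val : FixedHom K X → GHom K X) :=
  isClosed_fixedPoints_gHom.isClosedEmbedding_subtypeVal

theorem FixedHom.continuous_of_comp {K X : GDiagram a} {T : Type*} [TopologicalSpace T]
    [CompactSpace T] {f : T → FixedHom K X}
    (hf : ∀ i, Continuous fun t => ((f t).1.app i).hom) : Continuous f :=
  Continuous.subtype_mk
    (HomSpace.continuous_of_comp (K := K.toFunctor) (X := X.toFunctor) hf) _

theorem GDiagram.FixedSpace.isEmbedding_val {X : GDiagram a} {H : Subgroup G} {i : I}
    (hH : H ≤ a.stabilizer i) :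
    Topology.IsEmbedding fun x : X.FixedSpace hH => x.1 := Topology.IsEmbedding.subtypeVal

/-- The source is closed in a compactly generated Hausdorff space, so compact parameter spaces
suffice. For these, continuity is tested on simplices, where r only evaluates f on a simplex of
N(I/i). -/
theorem continuous_restriction {X : GDiagram a} [∀ i, T2Space (X.toFunctor.obj i)] :
    Continuous (restriction X) := by
  refine FixedHom.isClosedEmbedding_val.continuous_of_compact fun T _ _ _ k hk => ?_
  refine HomSpace.continuous_of_comp fun i => SSet.continuous_of_charMap _ fun m v => ?_
  obtain ⟨σ, γ, rfl⟩ : ∃ (σ : Chain (FixedCat a ⊤) m) (γ : σ.last ⟶ i), v = σ.over γ :=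
    ⟨_, _, OverChain.eq_over v⟩
  refine (GDiagram.FixedSpace.isEmbedding_val (X := X) i.le).continuous_iff.2 ?_
  exact (FixedHom.continuous_onSimplex hk (σ.incl.over (i := i.obj) γ.1)).congr fun p =>
    (restriction_charMap (k p.1) σ γ p.2).symm

end Closed

/-! ### Families of maps on a quotient -/

section Quotients

/-- Transposing turns the family into a map from the quotient to C(T, Y), whose continuity is tested
on B and on the extra point. -/
theorem continuous_of_quotRel {A B : Type u} [TopologicalSpace B] {j : A → B} {T Y : Type*}
    [TopologicalSpace T] [CompactSpace T] [T2Space T] [TopologicalSpace Y]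
    {F : T → C(Quot (QuotRel j), Y)}
    (h : Continuous fun p : B × T => F p.2 (Quot.mk _ (Sum.inl p.1)))
    (h' : Continuous fun t => F t (Quot.mk _ (Sum.inr PUnit.unit))) : Continuous F := by
  have hq : ∀ q, Continuous fun t => F t q := by
    rintro ⟨z | z⟩
    · exact h.comp (by fun_prop : Continuous fun t => (z, t))
    · exact h'
  let Φ : Quot (QuotRel j) → C(T, Y) := fun q => ⟨fun t => F t q, hq q⟩
  have hΦ : Continuous Φ := by
    refine isQuotientMap_quot_mk.continuous_iff.2 (continuous_sum_dom.2 ⟨?_, ?_⟩)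
    · exact (ContinuousMap.curry ⟨_, h⟩).continuous
    · exact continuous_of_const fun _ _ => rfl
  have hu : Continuous fun p : Quot (QuotRel j) × T => F p.2 p.1 :=
    ContinuousMap.continuous_uncurry_of_continuous ⟨Φ, hΦ⟩
  exact ContinuousMap.continuous_of_continuous_uncurry _ (hu.comp continuous_swap)

end Quotients

/-! ### The fiber of r as a space of pointed transformations -/

section Fiber

variable {G : Type w} [Group G] {I : Type u} [SmallCategory I] {a : CatAction G I}
  {X : GDiagram a}

/-- A chain in `I^G` over `i`, as a simplex of `N(ι/i)`. -/
theorem exists_overIncl_eq {i : I} {m : SimplexCategory}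
    (v : (nerve (CostructuredArrow (FixedCat.ι a ⊤) i)).obj (op m)) :
    ∃ (σ : Chain (FixedCat a ⊤) m) (γ : σ.incl.last ⟶ i),
      (nerveMap (overIncl (FixedCat.ι a ⊤) i)).app (op m) v = σ.incl.over γ :=
  ⟨CategoryTheory.Functor.comp (C := Fin (m.len + 1)) v (CostructuredArrow.proj _ i), _,
    OverChain.eq_over ((nerveMap (overIncl (FixedCat.ι a ⊤) i)).app (op m) v)⟩

theorem FixedHom.map_pt (x : FixedHom (pt a) X) {i j : I} (α : i ⟶ j) :
    X.toFunctor.map α (x.1.app i PUnit.unit) = x.1.app j PUnit.unit :=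
  (ConcreteCategory.congr_hom (x.1.naturality α) PUnit.unit).symm

/-- Points of the fiber over a constant transformation are constant on `B(ι/i)`. -/
theorem app_iotaIncl_of_restriction_eq {x : FixedLim X} {f : FixedHolim X}
    (h : restriction X f = constHolim X x) (i : I) (z : (overIota a).toFunctor.obj i) :
    f.1.app i ((iotaIncl a).1.app i z) = x.1.app i PUnit.unit := by
  obtain ⟨m, v, y, rfl⟩ := SSet.exists_charMap_eq z
  obtain ⟨σ, γ, hv⟩ := exists_overIncl_eq v
  have h1 : (iotaIncl a).1.app i (SSet.charMap v y) = SSet.charMap (σ.incl.over γ) y := by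
    rw [← hv]
    exact SSet.toTop_map_charMap _ _ _
  -- Over the last vertex of σ, an object of I^G, the value is given by the restriction; naturality
  -- along γ and of x carries it to i.
  have h2 := restriction_charMap f σ (𝟙 σ.last) y
  rw [h] at h2
  have h3 := f.map_onSimplex_over σ.incl (𝟙 σ.incl.last) γ y
  rw [Category.id_comp] at h3
  rw [h1]
  refine h3.symm.trans ((congrArg (X.toFunctor.map γ) h2.symm).trans ?_)
  exact x.map_pt γ

/-- The functor `I^G/i ⥤ ι/i`. -/
def fixedOverIota (a : CatAction G I) (i : FixedCat a ⊤) :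
    CostructuredArrow (𝟭 (FixedCat a ⊤)) i ⥤ CostructuredArrow (FixedCat.ι a ⊤) i.obj where
  obj x := CostructuredArrow.mk (S := FixedCat.ι a ⊤) (Y := x.left) x.hom.1
  map f := CostructuredArrow.homMk f.left (congrArg Subtype.val (CostructuredArrow.w f))

/-- Pointed transformations restrict to constant transformations. -/
theorem restriction_comp_quotientProj {x : FixedLim X}
    {k : FixedHom (quotientDiagram (iotaIncl a)) X}
    (hk : (quotientPt (iotaIncl a)).1.comp k.1 = x.1) :
    restriction X ((quotientProj (iotaIncl a)).comp k) = constHolim X x := by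
  refine HomSpace.ext_comp fun i z => Subtype.ext ?_
  -- For i in I^G the functor I^G/i ⥤ I/i factors through ι/i, so its image is collapsed in the
  -- quotient.
  have h1 : BMap (fixedOver a i) z =
      (iotaIncl a).1.app i.obj (BMap (fixedOverIota a i) z) :=
    ConcreteCategory.congr_hom
      (BMap_comp (fixedOverIota a i) (overIncl (FixedCat.ι a ⊤) i.obj)) z
  have h2 : ((restriction X ((quotientProj (iotaIncl a)).comp k)).comp i z).1 =
      k.1.app i.obj (Quot.mk _ (Sum.inl (BMap (fixedOver a i) z))) := rfl
  have h3 : (Quot.mk (QuotRel ((iotaIncl a).1.app i.obj)) (Sum.inl (BMap (fixedOver a i) z))) =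
      Quot.mk _ (Sum.inr PUnit.unit) := by
    rw [h1]
    exact Quot.sound (QuotRel.glue _)
  refine h2.trans ((congrArg (k.1.app i.obj) h3).trans ?_)
  exact congrArg (fun f : GHom (pt a) X => f.app i.obj PUnit.unit) hk

/-- The transformation on the quotient induced by a point of a fiber. -/
noncomputable def quotientDesc (x : FixedLim X) (f : FixedHolim X)
    (h : restriction X f = constHolim X x) : FixedHom (quotientDiagram (iotaIncl a)) X :=
  GDiagram.homOfPush (fun i => TopCat.ofHom ⟨Quot.lift
      (Sum.elim (f.1.app i) fun y => x.1.app i y) (by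
        rintro _ _ ⟨z⟩
        exact app_iotaIncl_of_restriction_eq h i z),
      isQuotientMap_quot_mk.continuous_iff.2
        ((f.1.app i).hom.continuous.sumElim (x.1.app i).hom.continuous)⟩)
    fun g i j α => by
      ext ⟨z | z⟩
      · exact f.push g α z
      · exact x.push g α z

theorem quotientDesc_comp (x : FixedLim X) (f : FixedHolim X)
    (h : restriction X f = constHolim X x) :
    (quotientPt (iotaIncl a)).1.comp (quotientDesc x f h).1 = x.1 := rfl

theorem quotientProj_comp_quotientDesc (x : FixedLim X) (f : FixedHolim X)
    (h : restriction X f = constHolim X x) :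
    (quotientProj (iotaIncl a)).1.comp (quotientDesc x f h).1 = f.1 := rfl

theorem eq_of_comp_quotientProj {k k' : GHom (quotientDiagram (iotaIncl a)) X}
    (h : (quotientProj (iotaIncl a)).1.comp k = (quotientProj (iotaIncl a)).1.comp k')
    (h' : (quotientPt (iotaIncl a)).1.comp k = (quotientPt (iotaIncl a)).1.comp k') : k = k' := by
  refine GHom.ext fun i => ?_
  ext ⟨z | z⟩
  · exact congrArg (fun f : GHom (overI a) X => f.app i z) h
  · exact congrArg (fun f : GHom (pt a) X => f.app i z) h'

variable [∀ i, T2Space (X.toFunctor.obj i)]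

instance GDiagram.FixedSpace.t2Space {H : Subgroup G} {i : I} (hH : H ≤ a.stabilizer i) :
    T2Space (X.FixedSpace hH) :=
  (GDiagram.FixedSpace.isEmbedding_val (X := X) hH).t2Space

/-- Preserving base points is, like equivariance, a closed condition on evaluations. -/
theorem isClosedEmbedding_fixedPointedHom {K : GDiagram a} (k : FixedHom (pt a) K)
    (x : FixedHom (pt a) X) :
    Topology.IsClosedEmbedding fun f : FixedPointedHom k x => f.1.1 := by
  refine ⟨Topology.IsEmbedding.subtypeVal.comp Topology.IsEmbedding.subtypeVal, ?_⟩
  have h : Set.range (fun f : FixedPointedHom k x => f.1.1) =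
      MulAction.fixedPoints G (GHom K X) ∩
        ⋂ i, {f | f.app i (k.1.app i PUnit.unit) = x.1.app i PUnit.unit} := by
    ext f
    constructor
    · rintro ⟨f, rfl⟩
      exact ⟨fun g => congrArg Subtype.val (f.2 g), Set.mem_iInter.2 fun i =>
        congrArg (fun f : GHom (pt a) X => f.app i PUnit.unit) f.1.2⟩
    · rintro ⟨h1, h2⟩
      refine ⟨⟨⟨f, GHom.ext fun i => ?_⟩, fun g => Subtype.ext (h1 g)⟩, rfl⟩
      ext ⟨⟩
      exact Set.mem_iInter.1 h2 i
  rw [h]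
  exact isClosed_fixedPoints_gHom.inter (isClosed_iInter fun i =>
    isClosed_eq (GHom.continuous_eval i _) continuous_const)

theorem isClosedEmbedding_fiber (x : FixedLim X) :
    Topology.IsClosedEmbedding
      fun f : {f : FixedHolim X // restriction X f = constHolim X x} => f.1.1 :=
  have : T2Space (Holim (X.fixedDiagram ⊤)) := @HomSpace.t2Space _ _ _ _ fun i =>
    GDiagram.FixedSpace.t2Space (X := X) i.le
  FixedHom.isClosedEmbedding_val.comp
    (isClosed_eq continuous_restriction continuous_const).isClosedEmbedding_subtypeVal

/-- The fiber of the restriction map is the space of pointed transformations on the quotient. -/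
noncomputable def fiberHomeomorph (x : FixedLim X) :
    FixedPointedHom (quotientPt (iotaIncl a)) x ≃ₜ
      {f : FixedHolim X // restriction X f = constHolim X x} where
  toFun k := ⟨(quotientProj (iotaIncl a)).comp ⟨k.1.1, fun g => congrArg Subtype.val (k.2 g)⟩,
    restriction_comp_quotientProj k.1.2⟩
  invFun f := ⟨⟨(quotientDesc x f.1 f.2).1, quotientDesc_comp x f.1 f.2⟩,
    fun g => Subtype.ext ((quotientDesc x f.1 f.2).2 g)⟩
  left_inv k := Subtype.ext (Subtype.ext (eq_of_comp_quotientProj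
    rfl k.1.2.symm))
  right_inv f := Subtype.ext (Subtype.ext (quotientProj_comp_quotientDesc x f.1 f.2))
  continuous_toFun := by
    refine (isClosedEmbedding_fixedPointedHom _ x).continuous_of_compact fun T _ _ _ k hk => ?_
    refine Continuous.subtype_mk (FixedHom.continuous_of_comp fun i => ?_) _
    have h := (HomSpace.continuous_comp (K := (quotientDiagram (iotaIncl a)).toFunctor)
      (X := X.toFunctor) i).comp ((isClosedEmbedding_fixedPointedHom _ x).continuous.comp hk)
    exact (ContinuousMap.continuous_precomp ((quotientProj (iotaIncl a)).1.app i).hom).comp h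
  continuous_invFun := by
    refine (isClosedEmbedding_fiber x).continuous_of_compact fun T _ _ _ k hk => ?_
    refine Continuous.subtype_mk (Continuous.subtype_mk (HomSpace.continuous_of_comp
      (K := (quotientDiagram (iotaIncl a)).toFunctor) (X := X.toFunctor) fun i => ?_) _) _
    -- On B(I/i) × T continuity is checked simplexwise; at the base point the value is constant in
    -- t.
    refine continuous_of_quotRel ?_ ?_
    · refine SSet.continuous_uncurry_of_charMap (fun t => ((k t).1.1.app i).hom) fun m w => ?_
      exact FixedHom.continuous_onSimplex (continuous_subtype_val.comp hk) w
    · exact continuous_const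

end Fiber

/-! ### The three assertions together -/

theorem mainTheorem12 {G : Type w} [Group G] {I : Type u} [SmallCategory I] (a : CatAction G I)
    (X : GDiagram a)
    [∀ i, T2Space (X.toFunctor.obj i)] [∀ i, CompactlyGeneratedSpace (X.toFunctor.obj i)]
    (hfin : ∀ i : I, ∃ d : ℕ, (nerve (Over i)).HasDimensionLE d) :
    IsSerreFibration (restriction X) ∧
    (∀ x : FixedLim X,
      ∃ e : FixedPointedHom (quotientPt (iotaIncl a)) x ≃ₜ
          {f : FixedHolim X // restriction X f = constHolim X x},
        ∀ (k : FixedPointedHom (quotientPt (iotaIncl a)) x),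
          (e k).1.1 = (quotientProj (iotaIncl a)).1.comp k.1.1) ∧
    (SurjectiveOnPiZero (fun x : FixedLim X => restriction X (limToHolim X x)) →
      ∀ n : ℤ, ((n : ℝ) : EReal) ≤ connBound X + 1 → IsNConnectedMap n (restriction X)) :=
  ⟨⟨continuous_restriction, fun _ f h hf => restriction_exists_lift f h hf⟩,
    fun x => ⟨fiberHomeomorph x, fun _ => rfl⟩,
    fun _ _ hn => ⟨continuous_restriction, restriction_isNConnected_hoFiber hn⟩⟩
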